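/- Let $(\Omega,\mathcal F,\mathbb P)$ be a probability space, $\mathbb T:\Omega\to\Omega$ a bijective bimeasurable transformation preserving $\mathbb P$, and $\mathcal F_0\subseteq\mathcal F$ a sub-$\sigma$-algebra with $\mathcal F_0\subseteq\mathbb T^{-1}(\mathcal F_0)$. Put $\mathcal F_i=\mathbb T^{-i}(\mathcal F_0)$, and assume that $\mathcal F_{-\infty}=\bigcap_{i\in\mathbb Z}\mathcal F_i$ is trivial. Let $\epsilon_0\in\mathbb L^2(\Omega)$ be a centred random variable, measurable with respect to $\mathcal F_\infty=\bigvee_{i\in\mathbb Z}\mathcal F_i$, let $\epsilon_i=\epsilon_0\circ\mathbb T^i$ for $i\in\mathbb Z$, and assume Hannan's condition $$\sum_{i\in\mathbb Z}\|P_0(\epsilon_i)\|_{\mathbb L^2}<\infty,\qquad P_0(Z)=\mathbb E(Z|\mathcal F_0)-\mathbb E(Z|\mathcal F_{-1}).$$ Let $\gamma(k)=\mathbb E(\epsilon_0\epsilon_k)$ and let $f(\lambda)=\frac1{2\pi}\sum_{k\in\mathbb Z}\gamma(k)e^{ik\lambda}$ be the spectral density. Let $(x_{i,j})_{i\ge1,\,1\le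 j\le p}$ be a random real array independent of the process $(\epsilon_i)_{i\in\mathbb Z}$, let $X=(x_{i,j})_{1\le i\le n,\,1\le j\le p}$, let $d_j(n)=(\sum_{i=1}^n x_{i,j}^2)^{1/2}$ and $D(n)=\mathrm{diag}(d_1(n),\dots,d_p(n))$. Assume that, almost surely, for all $j,l\in\{1,\dots,p\}$ and all integers $k\ge0$, as $n\to\infty$, $$d_j(n)\to\infty,\qquad \frac{\sup_{1\le i\le n}|x_{i,j}|}{d_j(n)}\to0,\qquad \sum_{m=1}^{n-k}\frac{x_{m,j}x_{m+k,l}}{d_j(n)d_l(n)}\to\rho_{j,l}(k),$$ and that $R(0)$ is positive definite, where $R(k)=[\rho_{j,l}(k)]_{1\le j,l\le p}$. A spectral measure of $R$ is a $p\times p$ matrix $F_X$ of complex measures on $[-\pi,\pi]$, with Hermitian positive semidefinite values, such that $R(k)=\int_{-\pi}^{\pi}e^{ik\lambda}F_X(d\lambda)$ for all $k\ge0$. Given such an $F_X$, let $$F=\frac1{2\pi}\int_{-\pi}^{\pi}F_X(d\lambda),\qquad G=\frac1{2\pi}\int_{-\pi}^{\pi}f(\lambda)F_X(d\lambda),\qquad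 C=F^{-1}GF^{-1}.$$ Let $\beta\in\mathbb R^p$, $Y=X\beta+\epsilon$ with $\epsilon=(\epsilon_1,\dots,\epsilon_n)^t$, $\hat\beta=(X^tX)^{-1}X^tY$, $\hat\epsilon=Y-X\hat\beta$, and $\hat\gamma^*_k=\frac1n\sum_{j=1}^{n-|k|}\hat\epsilon_j\hat\epsilon_{j+|k|}$ for $|k|\le n-1$. Let $K:\mathbb R\to\mathbb R$ be nonnegative, symmetric, continuous and compactly supported, with $K(0)=1$ and integrable Fourier transform. Let $(h_n)$ be a sequence of positive reals with $h_n\to\infty$ and $$h_n\,\mathbb E\Big(|\epsilon_0|^2\Big(1\wedge\frac{h_n}{n}|\epsilon_0|^2\Big)\Big)\xrightarrow[n\to\infty]{}0.$$ Put $$\widehat\Gamma^*_{n,h_n}=\Big[K\Big(\frac{j-l}{h_n}\Big)\hat\gamma^*_{j-l}\Big]_{1\le j,l\le n},\qquad C_n=D(n)(X^tX)^{-1}X^t\,\widehat\Gamma^*_{n,h_n}\,X(X^tX)^{-1}D(n).$$ Then $\sum_{k\in\mathbb Z}|\gamma(k)|<\infty$, almost surely $R$ has a spectral measure (so $f$ and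 $C$ are well defined), and, for every choice $F_X$ of a spectral measure, $C_n$ converges in probability to $C=F^{-1}GF^{-1}$ as $n\to\infty$: for all $j,l\in\{1,\dots,p\}$ and all $\delta>0$, $\mathbb P\big(|(C_n)_{j,l}-C_{j,l}|\ge\delta\big)\to0$. -/

import Mathlib

open MeasureTheory Filter Topology Matrix
open scoped FourierTransform ENNReal ComplexOrder

noncomputable section

namespace HannanRegression

/-! ### The error process -/

section Errors

variable {Ω : Type*} (F₀ : MeasurableSpace Ω) [mΩ : MeasurableSpace Ω]

/-- The `i`-th iterate `𝕋ⁱ`, `i ∈ ℤ`, of a bijective bimeasurable transformation. -/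
def iter (T : Ω ≃ᵐ Ω) (i : ℤ) : Ω → Ω :=
  ⇑((T.toEquiv : Equiv.Perm Ω) ^ i)

/-- The stationary process `εᵢ = ε₀ ∘ 𝕋ⁱ`. -/
def err (T : Ω ≃ᵐ Ω) (ε₀ : Ω → ℝ) (i : ℤ) (ω : Ω) : ℝ :=
  ε₀ (iter T i ω)

/-- The σ-algebras `𝓕ᵢ = 𝕋⁻ⁱ(𝓕₀)`. -/
abbrev filt (T : Ω ≃ᵐ Ω) (i : ℤ) : MeasurableSpace Ω :=
  F₀.comap (iter T i)

/-- `P_j(Z) = 𝔼(Z | 𝓕_j) - 𝔼(Z | 𝓕_{j-1})`. -/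
def proj (P : Measure Ω) (T : Ω ≃ᵐ Ω) (j : ℤ) (Z : Ω → ℝ) : Ω → ℝ :=
  P[Z | filt F₀ T j] - P[Z | filt F₀ T (j - 1)]

/-- Hannan's condition `∑_{i ∈ ℤ} ‖P₀(εᵢ)‖_{L²} < ∞`. -/
def HannanCondition (P : Measure Ω) (T : Ω ≃ᵐ Ω) (ε₀ : Ω → ℝ) : Prop :=
  ∑' i : ℤ, eLpNorm (proj F₀ P T 0 (err T ε₀ i)) 2 P < ∞

/-- The autocovariance function of the (centred) error process, `γ(k) = 𝔼(ε₀ ε_k)`. -/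
def autocov (P : Measure Ω) (T : Ω ≃ᵐ Ω) (ε₀ : Ω → ℝ) (k : ℤ) : ℝ :=
  ∫ ω, err T ε₀ 0 ω * err T ε₀ k ω ∂P

/-- The (continuous version of the) spectral density
`f(θ) = (1/2π) ∑_{k ∈ ℤ} γ(k) e^{ikθ}`. -/
def specDensity (P : Measure Ω) (T : Ω ≃ᵐ Ω) (ε₀ : Ω → ℝ) (θ : ℝ) : ℂ :=
  (1 / (2 * Real.pi) : ℂ) *
    ∑' k : ℤ, (autocov P T ε₀ k : ℂ) * Complex.exp (Complex.I * k * θ)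

end Errors

/-! ### The design

A realisation of the design is an array `x : ℕ → Fin p → ℝ`; `x i` is the row number `i + 1`, so
that the first `n` rows are those with `i < n`. -/

section Design

variable {p : ℕ}

/-- The `n × p` design matrix. -/
def designMatrix (x : ℕ → Fin p → ℝ) (n : ℕ) : Matrix (Fin n) (Fin p) ℝ :=
  Matrix.of fun i j => x i j

/-- `d_j(n)`, the Euclidean norm of the `j`-th column of the `n × p` design matrix. -/
def colNorm (x : ℕ → Fin p → ℝ) (n : ℕ) (j : Fin p) : ℝ :=
  √(∑ i ∈ Finset.range n, x i j ^ 2)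

/-- `D(n)`, the diagonal matrix of the column norms. -/
def normMatrix (x : ℕ → Fin p → ℝ) (n : ℕ) : Matrix (Fin p) (Fin p) ℝ :=
  Matrix.diagonal (colNorm x n)

/-- `∑_{m=1}^{n-k} x_{m,j} x_{m+k,l} / (d_j(n) d_l(n))`. -/
def empCorr (x : ℕ → Fin p → ℝ) (n k : ℕ) (j l : Fin p) : ℝ :=
  ∑ m ∈ Finset.range (n - k), x m j * x (m + k) l / (colNorm x n j * colNorm x n l)

/-- Hannan's conditions on a realisation `x` of the design, with limiting correlation
matrices `R k = [ρ_{j,l}(k)]`, `k ≥ 0`. -/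
structure HannanDesign (x : ℕ → Fin p → ℝ) (R : ℕ → Matrix (Fin p) (Fin p) ℝ) : Prop where
  norm_tendsto : ∀ j, Tendsto (fun n => colNorm x n j) atTop atTop
  sup_negligible : ∀ j,
    Tendsto (fun n : ℕ => (⨆ i : Fin n, |x i j|) / colNorm x n j) atTop (𝓝 0)
  corr_tendsto : ∀ (j l : Fin p) (k : ℕ), Tendsto (fun n => empCorr x n k j l) atTop (𝓝 (R k j l))
  posDef : (R 0).PosDef

/-- A `p × p` matrix of complex measures on `[-π, π]`. -/
abbrev MatrixMeasure (p : ℕ) : Type :=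
  Fin p → Fin p → ComplexMeasure (Set.Icc (-Real.pi) Real.pi)

/-- The integral of a complex function against a complex measure on `[-π, π]`. -/
def cintegral (g : ℝ → ℂ) (μ : ComplexMeasure (Set.Icc (-Real.pi) Real.pi)) : ℂ :=
  μ.integral (fun θ => g θ) (ContinuousLinearMap.mul ℝ ℂ)

/-- `M` is a spectral measure of `(R k)_{k ≥ 0}`: it takes values in the Hermitian positive
semidefinite matrices, and `R k = ∫ e^{ikθ} M(dθ)`. -/
structure IsSpectralMeasure (R : ℕ → Matrix (Fin p) (Fin p) ℝ) (M : MatrixMeasure p) : Prop where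
  posSemidef : ∀ A, MeasurableSet A → (Matrix.of fun j l => M j l A).PosSemidef
  fourier : ∀ (k : ℕ) (j l : Fin p),
    cintegral (fun θ => Complex.exp (Complex.I * k * θ)) (M j l) = (R k j l : ℂ)

/-- `F = (1/2π) ∫ M(dθ)`. -/
def matF (M : MatrixMeasure p) : Matrix (Fin p) (Fin p) ℂ :=
  Matrix.of fun j l => (1 / (2 * Real.pi) : ℂ) * M j l Set.univ

/-- `G = (1/2π) ∫ f(θ) M(dθ)`. -/
def matG (f : ℝ → ℂ) (M : MatrixMeasure p) : Matrix (Fin p) (Fin p) ℂ :=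
  Matrix.of fun j l => (1 / (2 * Real.pi) : ℂ) * cintegral f (M j l)

/-- The limiting covariance matrix `C = F⁻¹ G F⁻¹`. -/
def limitCov (f : ℝ → ℂ) (M : MatrixMeasure p) : Matrix (Fin p) (Fin p) ℂ :=
  (matF M)⁻¹ * matG f M * (matF M)⁻¹

end Design

/-! ### The estimator

The functions below take realisations: `x` of the design and `y` of the observations, where
`x i` and `y i` belong to the row number `i + 1`. -/

section Estimator

variable {p : ℕ}

/-- The observations of the linear model, `Y = Xβ + ε`, for realisations `x` of the design
and `e` of the error process. -/
def observation (β : Fin p → ℝ) (x : ℕ → Fin p → ℝ) (e : ℤ → ℝ) (i : ℕ) : ℝ :=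
  ∑ j, x i j * β j + e (i + 1)

/-- The least squares estimator `(XᵗX)⁻¹ Xᵗ Y` from the first `n` observations. -/
def leastSquares (x : ℕ → Fin p → ℝ) (y : ℕ → ℝ) (n : ℕ) : Fin p → ℝ :=
  ((designMatrix x n)ᵀ * designMatrix x n)⁻¹ *ᵥ ((designMatrix x n)ᵀ *ᵥ fun i : Fin n => y i)

/-- The residuals. -/
def residual (x : ℕ → Fin p → ℝ) (y : ℕ → ℝ) (n i : ℕ) : ℝ :=
  y i - ∑ j, x i j * leastSquares x y n j

/-- The empirical autocovariances of the residuals,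
`(1/n) ∑_{j=1}^{n-|k|} ε̂_j ε̂_{j+|k|}`. -/
def residualAutocov (x : ℕ → Fin p → ℝ) (y : ℕ → ℝ) (n : ℕ) (k : ℤ) : ℝ :=
  (1 / (n : ℝ)) *
    ∑ i ∈ Finset.range (n - k.natAbs), residual x y n i * residual x y n (i + k.natAbs)

/-- The tapered covariance matrix estimator with kernel `K` and bandwidth `h`. -/
def taperedCov (K : ℝ → ℝ) (h : ℝ) (x : ℕ → Fin p → ℝ) (y : ℕ → ℝ) (n : ℕ) :
    Matrix (Fin n) (Fin n) ℝ :=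
  Matrix.of fun j l =>
    K (((j : ℝ) - (l : ℝ)) / h) * residualAutocov x y n ((j : ℤ) - (l : ℤ))

/-- The estimator `C_n = D(n) (XᵗX)⁻¹ Xᵗ Γ̂* X (XᵗX)⁻¹ D(n)`. -/
def covEstimator (K : ℝ → ℝ) (h : ℝ) (x : ℕ → Fin p → ℝ) (y : ℕ → ℝ) (n : ℕ) :
    Matrix (Fin p) (Fin p) ℝ :=
  normMatrix x n * ((designMatrix x n)ᵀ * designMatrix x n)⁻¹ * (designMatrix x n)ᵀ *
    taperedCov K h x y n * designMatrix x n *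
    ((designMatrix x n)ᵀ * designMatrix x n)⁻¹ * normMatrix x n

/-- The admissible kernels. -/
structure IsKernel (K : ℝ → ℝ) : Prop where
  nonneg : ∀ u, 0 ≤ K u
  symm : ∀ u, K (-u) = K u
  apply_zero : K 0 = 1
  continuous : Continuous K
  hasCompactSupport : HasCompactSupport K
  integrable_fourier : Integrable (𝓕 fun u : ℝ => (K u : ℂ))

end Estimator

end HannanRegression

end

/-! Let `Z` be the design with columns scaled to norm one. The scaling by `D(n)` cancels and `C_n`
is `ZᵗΓ̂Z` between two inverses of the Gram matrix `ZᵗZ`, which converges to `R(0)`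
(`covEstimator_eq`). The matrix `Γ̂` and the products of columns of `Z` interact only through lags,
so their roles can be exchanged (`toeplitzForm_mul_lagSum_comm`): an entry of `ZᵗΓ̂Z` is `n⁻¹ ∑
w(s-t) ε̂ₛ ε̂ₜ`, where `w(k)` is `K(k/hₙ)` times a lag sum of two columns. For a fixed design these
weights are deterministic, bounded, supported on lags of order `hₙ`, and convergent at each lag
because `K(0) = 1`. The limit should therefore be `∑ γ(k) ρ(k)`, which is `G` in spectral form up to
powers of `2π`.

Residuals are replaced by errors as follows. They differ by a projection on `p` columns, which stays
bounded in mean square because `∑ |γ(k)| < ∞`; a Schur bound makes the replacement cost `O(hₙ/√n)`.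
The bandwidth condition forces `hₙ = o(√n)` unless the errors vanish almost surely, a case where
everything is zero (`tendsto_bandwidth_div_sqrt`).

The core is the `L¹` convergence of the form in the errors (`tendsto_toeplitzForm_err`). In `L²`,
`εᵢ = ∑ᵣ P₀(εᵣ) ∘ 𝕋^(i-r)`, a sum of shifted innovations. For two innovations `f`, `g` the tapered
form has `L¹` norm at most `const · n ‖f‖ ‖g‖`, with a constant independent of the bandwidth
(`IsInnovation.integral_abs_toeplitzForm_le`); this rests on the integrability of the Fourier
transform of `K`. With Hannan's condition it gives a summable bound over pairs of innovations, so by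
dominated convergence a single pair suffices, and by density a bounded pair. There the off-diagonal
parts are sums of martingale differences with variance `O(n hₙ) = o(n²)`, while the diagonal is an
ergodic average, convergent because the remote past is trivial.

A spectral measure is obtained as a weak limit of periodograms of the design, whose Fourier
coefficients are the empirical correlations; positivity passes to the limit through polarisation.
The resulting `C` depends on `R` only (`IsSpectralMeasure.limitCov_eq`). A random design is frozen
first, and independence with Fubini then turns conditional `L¹` convergence into convergence in
probability (`tendstoInMeasure_of_indepFun`). -/

namespace HannanRegression

/-! ### Lag sums and Toeplitz forms -/

/-- `∑ uₛ vₜ` over the pairs `s, t < n` with `s - t = k`. -/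
noncomputable def lagSum (n : ℕ) (u v : ℕ → ℝ) (k : ℤ) : ℝ :=
  ∑ s ∈ Finset.range n, ∑ t ∈ Finset.range n, if (s : ℤ) - t = k then u s * v t else 0

/-- The quadratic form `∑ w(i - j) aᵢ bⱼ` over `i, j < n`. -/
noncomputable def toeplitzForm (n : ℕ) (w : ℤ → ℝ) (a b : ℕ → ℝ) : ℝ :=
  ∑ i ∈ Finset.range n, ∑ j ∈ Finset.range n, w ((i : ℤ) - j) * (a i * b j)

theorem sum_ite_intCast_sub_le {n : ℕ} {a : ℕ → ℝ} (ha : ∀ i, 0 ≤ a i) (k : ℤ) :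
    ∑ s ∈ Finset.range n, ∑ t ∈ Finset.range n, (if (s : ℤ) - t = k then a s else 0)
      ≤ ∑ s ∈ Finset.range n, a s := by
  refine Finset.sum_le_sum fun s _ => ?_
  rw [← Finset.sum_filter, Finset.sum_const, nsmul_eq_mul]
  have : (Finset.filter (fun t : ℕ => (s : ℤ) - t = k) (Finset.range n)).card ≤ 1 := by
    rw [Finset.card_le_one]
    intro x hx y hy
    simp only [Finset.mem_filter] at hx hy
    omega
  have h1 : ((Finset.filter (fun t : ℕ => (s : ℤ) - t = k) (Finset.range n)).card : ℝ) ≤ 1 := by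
    exact_mod_cast this
  nlinarith [ha s]

theorem lagSum_neg (n : ℕ) (u v : ℕ → ℝ) (k : ℤ) : lagSum n u v (-k) = lagSum n v u k := by
  unfold lagSum
  rw [Finset.sum_comm]
  refine Finset.sum_congr rfl fun s _ => Finset.sum_congr rfl fun t _ => ?_
  have : ((t : ℤ) - s = -k) ↔ ((s : ℤ) - t = k) := by omega
  simp only [this, mul_comm]

/-- For a fixed lag each index occurs in at most one pair, so `|uv| ≤ (u² + v²)/2` sums to at most
`1`. -/
theorem abs_lagSum_le {n : ℕ} {u v : ℕ → ℝ} (hu : ∑ i ∈ Finset.range n, u i ^ 2 ≤ 1)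
    (hv : ∑ i ∈ Finset.range n, v i ^ 2 ≤ 1) (k : ℤ) : |lagSum n u v k| ≤ 1 := by
  have h1 := sum_ite_intCast_sub_le (n := n) (a := fun i => u i ^ 2) (fun i => sq_nonneg _) k
  have h2 := sum_ite_intCast_sub_le (n := n) (a := fun i => v i ^ 2) (fun i => sq_nonneg _) (-k)
  rw [Finset.sum_comm] at h2
  have h3 : |lagSum n u v k| ≤ ∑ s ∈ Finset.range n, ∑ t ∈ Finset.range n,
      ((if (s : ℤ) - t = k then u s ^ 2 else 0) + (if (t : ℤ) - s = -k then v t ^ 2 else 0)) / 2 := by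
    unfold lagSum
    refine (Finset.abs_sum_le_sum_abs _ _).trans (Finset.sum_le_sum fun s _ => ?_)
    refine (Finset.abs_sum_le_sum_abs _ _).trans (Finset.sum_le_sum fun t _ => ?_)
    have : ((t : ℤ) - s = -k) ↔ ((s : ℤ) - t = k) := by omega
    simp only [this]
    split_ifs
    · rw [abs_mul]
      nlinarith [sq_nonneg (|u s| - |v t|), sq_abs (u s), sq_abs (v t)]
    · simp
  simp only [← Finset.sum_div, Finset.sum_add_distrib] at h3
  linarith

theorem lagSum_natCast (n k : ℕ) (u v : ℕ → ℝ) :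
    lagSum n u v k = ∑ t ∈ Finset.range (n - k), u (t + k) * v t := by
  unfold lagSum
  rw [Finset.sum_comm]
  have h1 : ∀ t ∈ Finset.range n, (∑ s ∈ Finset.range n,
      if (s : ℤ) - t = (k : ℤ) then u s * v t else 0)
        = if t < n - k then u (t + k) * v t else 0 := by
    intro t _
    split_ifs with ht
    · rw [Finset.sum_eq_single (t + k)]
      · simp
      · intro s _ hs
        rw [if_neg]
        omega
      · intro hs
        simp only [Finset.mem_range] at hs
        omega
    · refine Finset.sum_eq_zero fun s hs => ?_
      rw [if_neg]
      simp only [Finset.mem_range] at hs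
      omega
  rw [Finset.sum_congr rfl h1, ← Finset.sum_filter]
  refine Finset.sum_congr ?_ fun _ _ => rfl
  ext t
  simp only [Finset.mem_filter, Finset.mem_range]
  omega

/-- Exchanging the roles of the two pairs of sequences in a tapered double lag sum. -/
theorem toeplitzForm_mul_lagSum_comm (n : ℕ) (w : ℤ → ℝ) (u v a b : ℕ → ℝ) :
    toeplitzForm n (fun k => w k * lagSum n a b k) u v
      = toeplitzForm n (fun k => w k * lagSum n u v k) a b := by
  -- Both sides are the same sum over quadruples with `s - t = i - j`; on that set the weight can be
  -- read off either pair.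
  have key : ∀ u v a b : ℕ → ℝ, toeplitzForm n (fun k => w k * lagSum n a b k) u v
      = ∑ s ∈ Finset.range n, ∑ t ∈ Finset.range n, ∑ i ∈ Finset.range n, ∑ j ∈ Finset.range n,
        if (s : ℤ) - t = (i : ℤ) - j then w (s - t) * (u s * v t * (a i * b j)) else 0 := by
    intro u v a b
    unfold toeplitzForm lagSum
    refine Finset.sum_congr rfl fun s _ => Finset.sum_congr rfl fun t _ => ?_
    beta_reduce
    rw [Finset.mul_sum, Finset.sum_mul]
    refine Finset.sum_congr rfl fun i _ => ?_
    rw [Finset.mul_sum, Finset.sum_mul]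
    refine Finset.sum_congr rfl fun j _ => ?_
    by_cases h : (s : ℤ) - t = (i : ℤ) - j
    · rw [if_pos h, if_pos h.symm]
      ring
    · rw [if_neg h, if_neg (fun h' => h h'.symm)]
      ring
  rw [key, key]
  have comm4 : ∀ g : ℕ → ℕ → ℕ → ℕ → ℝ,
      ∑ s ∈ Finset.range n, ∑ t ∈ Finset.range n, ∑ i ∈ Finset.range n, ∑ j ∈ Finset.range n,
        g s t i j
      = ∑ i ∈ Finset.range n, ∑ j ∈ Finset.range n, ∑ s ∈ Finset.range n, ∑ t ∈ Finset.range n,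
        g s t i j := by
    intro g
    simp only [← Finset.sum_product' (s := Finset.range n) (t := Finset.range n)]
    exact Finset.sum_comm
  rw [comm4]
  refine Finset.sum_congr rfl fun s _ => Finset.sum_congr rfl fun t _ =>
    Finset.sum_congr rfl fun i _ => Finset.sum_congr rfl fun j _ => ?_
  by_cases h : (s : ℤ) - t = (i : ℤ) - j
  · rw [if_pos h, if_pos h.symm, h]
    ring
  · rw [if_neg h, if_neg (fun h' => h h'.symm)]

/-! ### Factorisation of lag sums through shifts -/

/-- Diagonal shift of a sequence, extended by zero. -/
noncomputable def shiftSeq (n m : ℕ) (u : ℕ → ℝ) (i : ℕ) : ℝ :=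
  ∑ s ∈ Finset.range n, if s + n = i + m then u s else 0

/-- At most one term of the defining sum is nonzero, so squaring commutes with the sum. -/
theorem shiftSeq_sq (n m : ℕ) (u : ℕ → ℝ) (i : ℕ) :
    shiftSeq n m u i ^ 2 = ∑ s ∈ Finset.range n, if s + n = i + m then u s ^ 2 else 0 := by
  unfold shiftSeq
  by_cases h : ∃ s ∈ Finset.range n, s + n = i + m
  · obtain ⟨s, hs, hsm⟩ := h
    rw [Finset.sum_eq_single s, Finset.sum_eq_single s]
    · simp [hsm]
    · intro t _ ht
      rw [if_neg]
      omega
    · exact fun h => absurd hs h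
    · intro t _ ht
      rw [if_neg]
      omega
    · exact fun h => absurd hs h
  · push Not at h
    rw [Finset.sum_eq_zero, Finset.sum_eq_zero]
    · simp
    · intro s hs
      rw [if_neg (h s hs)]
    · intro s hs
      rw [if_neg (h s hs)]

/-- Exactly one shift carries `s` to `i`. The offset `n` keeps `m = s + n - i` a natural number
below `2n`. -/
theorem sum_ite_shift {n i s : ℕ} (hi : i < n) (hs : s < n) (c : ℝ) :
    ∑ m ∈ Finset.range (2 * n), (if s + n = i + m then c else 0) = c := by
  rw [Finset.sum_eq_single (s + n - i)]
  · rw [if_pos (by omega)]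
  · intro m _ hm
    rw [if_neg (by omega)]
  · intro h
    simp only [Finset.mem_range] at h
    omega

theorem sum_sum_shiftSeq_sq (n : ℕ) (u : ℕ → ℝ) :
    ∑ m ∈ Finset.range (2 * n), ∑ i ∈ Finset.range n, shiftSeq n m u i ^ 2
      = n * ∑ i ∈ Finset.range n, u i ^ 2 := by
  simp only [shiftSeq_sq]
  rw [Finset.sum_comm]
  have : ∀ i ∈ Finset.range n, ∑ m ∈ Finset.range (2 * n), ∑ s ∈ Finset.range n,
      (if s + n = i + m then u s ^ 2 else 0) = ∑ s ∈ Finset.range n, u s ^ 2 := by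
    intro i hi
    rw [Finset.sum_comm]
    refine Finset.sum_congr rfl fun s hs => ?_
    exact sum_ite_shift (Finset.mem_range.1 hi) (Finset.mem_range.1 hs) _
  rw [Finset.sum_congr rfl this]
  simp

/-- A pair with `s - t = i - j` is moved to `(i, j)` by one common shift. This writes the Toeplitz
matrix of lag sums as a sum of rank-one matrices, of total squared norm `n` by
`sum_sum_shiftSeq_sq`. -/
theorem lagSum_eq_sum_shiftSeq {n i j : ℕ} (hi : i < n) (u v : ℕ → ℝ) :
    lagSum n u v ((i : ℤ) - j)
      = ∑ m ∈ Finset.range (2 * n), shiftSeq n m u i * shiftSeq n m v j := by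
  unfold lagSum shiftSeq
  simp only [Finset.sum_mul_sum]
  symm
  rw [Finset.sum_comm]
  refine Finset.sum_congr rfl fun s hs => ?_
  rw [Finset.sum_comm]
  refine Finset.sum_congr rfl fun t ht => ?_
  rw [Finset.mem_range] at hs ht
  by_cases h : (s : ℤ) - t = (i : ℤ) - j
  · rw [if_pos h, ← sum_ite_shift hi hs (u s * v t)]
    refine Finset.sum_congr rfl fun m _ => ?_
    have : t + n = j + m ↔ s + n = i + m := by omega
    simp only [this]
    split_ifs <;> simp
  · rw [if_neg h]
    refine Finset.sum_eq_zero fun m _ => ?_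
    by_cases h1 : s + n = i + m
    · have : ¬ (t + n = j + m) := by omega
      simp [this]
    · simp [h1]

/-- The double sum `∑ αᵢ βⱼ cᵢⱼ` is bounded, as a bilinear form, by `L`. -/
def BilinBounded (n : ℕ) (c : ℕ → ℕ → ℝ) (L : ℝ) : Prop :=
  ∀ α β : ℕ → ℝ, |∑ i ∈ Finset.range n, ∑ j ∈ Finset.range n, α i * β j * c i j|
    ≤ L * (((∑ i ∈ Finset.range n, α i ^ 2) + ∑ i ∈ Finset.range n, β i ^ 2) / 2)

/-- The rank-one factorisation turns the entrywise product into `2n` evaluations of the form `c`.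
The squared norms of all shifted vectors add up to `n` on each side, whence `n * L` with no loss
from the number of lags. -/
theorem BilinBounded.abs_sum_lagSum_le {n : ℕ} {c : ℕ → ℕ → ℝ} {L : ℝ} (hc : BilinBounded n c L)
    (hL : 0 ≤ L) {u v : ℕ → ℝ} (hu : ∑ i ∈ Finset.range n, u i ^ 2 ≤ 1)
    (hv : ∑ i ∈ Finset.range n, v i ^ 2 ≤ 1) {a b : ℕ → ℝ} (ha : ∀ i, |a i| ≤ 1)
    (hb : ∀ i, |b i| ≤ 1) :
    |∑ i ∈ Finset.range n, ∑ j ∈ Finset.range n,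
      a i * b j * lagSum n u v ((i : ℤ) - j) * c i j| ≤ n * L := by
  have h1 : ∑ i ∈ Finset.range n, ∑ j ∈ Finset.range n,
      a i * b j * lagSum n u v ((i : ℤ) - j) * c i j
      = ∑ m ∈ Finset.range (2 * n), ∑ i ∈ Finset.range n, ∑ j ∈ Finset.range n,
        (a i * shiftSeq n m u i) * (b j * shiftSeq n m v j) * c i j := by
    symm
    rw [Finset.sum_comm]
    refine Finset.sum_congr rfl fun i hi => ?_
    rw [Finset.sum_comm]
    refine Finset.sum_congr rfl fun j _ => ?_
    rw [lagSum_eq_sum_shiftSeq (Finset.mem_range.1 hi), Finset.mul_sum,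
      Finset.sum_mul]
    refine Finset.sum_congr rfl fun m _ => ?_
    ring
  rw [h1]
  have hsq : ∀ {x y : ℝ}, |x| ≤ 1 → (x * y) ^ 2 ≤ y ^ 2 := by
    intro x y hx
    rw [mul_pow]
    have : x ^ 2 ≤ 1 := by rw [← sq_abs]; nlinarith [abs_nonneg x]
    nlinarith [sq_nonneg y]
  calc _ ≤ ∑ m ∈ Finset.range (2 * n), L * (((∑ i ∈ Finset.range n, shiftSeq n m u i ^ 2)
        + ∑ i ∈ Finset.range n, shiftSeq n m v i ^ 2) / 2) := by
        refine (Finset.abs_sum_le_sum_abs _ _).trans (Finset.sum_le_sum fun m _ => ?_)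
        refine (hc _ _).trans ?_
        have e1 := Finset.sum_le_sum fun i (_ : i ∈ Finset.range n) =>
          hsq (y := shiftSeq n m u i) (ha i)
        have e2 := Finset.sum_le_sum fun i (_ : i ∈ Finset.range n) =>
          hsq (y := shiftSeq n m v i) (hb i)
        exact mul_le_mul_of_nonneg_left (by linarith) hL
    _ = L * ((n * ∑ i ∈ Finset.range n, u i ^ 2 + n * ∑ i ∈ Finset.range n, v i ^ 2) / 2) := by
        rw [← Finset.mul_sum, ← Finset.sum_div, Finset.sum_add_distrib, sum_sum_shiftSeq_sq,
          sum_sum_shiftSeq_sq]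
    _ ≤ L * ((n * 1 + n * 1) / 2) := by gcongr
    _ = n * L := by ring

/-! ### The taper as a superposition of cosines -/

/-- An admissible kernel is a cosine transform of an integrable function. -/
theorem IsKernel.exists_cos_transform {K : ℝ → ℝ} (hK : IsKernel K) :
    ∃ κ : ℝ → ℝ, Integrable κ ∧ ∀ u, K u = ∫ ξ, κ ξ * Real.cos (2 * Real.pi * (u * ξ)) := by
  have hcont : Continuous fun u : ℝ => (K u : ℂ) := Complex.continuous_ofReal.comp hK.continuous
  have h_int : Integrable fun u : ℝ => (K u : ℂ) :=
    (hK.continuous.integrable_of_hasCompactSupport hK.hasCompactSupport).ofReal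
  have hinv := hcont.fourierInv_fourier_eq h_int hK.integrable_fourier
  set g := 𝓕 fun u : ℝ => (K u : ℂ) with hg
  refine ⟨fun ξ => (g ξ).re, hK.integrable_fourier.re, fun u => ?_⟩
  have h1 : ∀ u : ℝ, (K u : ℂ) = ∫ ξ, Complex.exp (↑(2 * Real.pi * (ξ * u)) * Complex.I) * g ξ := by
    intro u
    have := congrFun hinv u
    rw [← this, Real.fourierInv_eq']
    simp [mul_comm]
  have hI : ∀ u : ℝ, Integrable fun ξ : ℝ =>
      Complex.exp (↑(2 * Real.pi * (ξ * u)) * Complex.I) * g ξ := by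
    intro u
    refine hK.integrable_fourier.bdd_mul (c := 1) ?_ ?_
    · exact Continuous.aestronglyMeasurable (by fun_prop)
    · filter_upwards with ξ
      rw [Complex.norm_exp_ofReal_mul_I]
  -- Evenness of `K` allows averaging the inversion formulas at `u` and `-u`, which leaves a cosine;
  -- real parts are taken afterwards.
  have h2 : (K u : ℂ) = ∫ ξ, (Real.cos (2 * Real.pi * (u * ξ)) : ℂ) * g ξ := by
    have h3 : (K u : ℂ) = ((K u : ℂ) + (K (-u) : ℂ)) / 2 := by rw [hK.symm]; ring
    rw [h3, h1 u, h1 (-u), ← integral_add (hI u) (hI (-u)), ← integral_div]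
    refine integral_congr_ae (Eventually.of_forall fun ξ => ?_)
    simp only [Complex.ofReal_cos, Complex.cos]
    have e1 : (2 * Real.pi * (ξ * u) : ℝ) = 2 * Real.pi * (u * ξ) := by ring
    have e2 : (2 * Real.pi * (ξ * -u) : ℝ) = -(2 * Real.pi * (u * ξ)) := by ring
    rw [e1, e2]
    push_cast
    ring
  have hI2 : Integrable fun ξ : ℝ => (Real.cos (2 * Real.pi * (u * ξ)) : ℂ) * g ξ := by
    refine hK.integrable_fourier.bdd_mul (c := 1) ?_ ?_
    · exact Continuous.aestronglyMeasurable (by fun_prop)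
    · filter_upwards with ξ
      rw [Complex.norm_real]
      exact Real.abs_cos_le_one _
  have h4 := congrArg Complex.re h2
  rw [Complex.ofReal_re] at h4
  rw [h4]
  rw [← Complex.reCLM_apply, ← Complex.reCLM.integral_comp_comm hI2]
  refine integral_congr_ae (Eventually.of_forall fun ξ => ?_)
  simp only [Complex.reCLM_apply, Complex.re_ofReal_mul]
  ring

/-- Tapered lag sums with a kernel that is a cosine transform. -/
theorem BilinBounded.abs_sum_cos_transform_le {n : ℕ} {c : ℕ → ℕ → ℝ} {L : ℝ}
    (hc : BilinBounded n c L) (hL : 0 ≤ L) {u v : ℕ → ℝ}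
    (hu : ∑ i ∈ Finset.range n, u i ^ 2 ≤ 1) (hv : ∑ i ∈ Finset.range n, v i ^ 2 ≤ 1)
    {K κ : ℝ → ℝ} (hκ : Integrable κ)
    (hK : ∀ u, K u = ∫ ξ, κ ξ * Real.cos (2 * Real.pi * (u * ξ))) (h : ℝ) :
    |∑ i ∈ Finset.range n, ∑ j ∈ Finset.range n,
      K ((((i : ℤ) - j : ℤ) : ℝ) / h) * lagSum n u v ((i : ℤ) - j) * c i j|
        ≤ 2 * (∫ ξ, |κ ξ|) * (n * L) := by
  have hI : ∀ i j : ℕ, Integrable fun ξ =>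
      κ ξ * Real.cos (2 * Real.pi * ((((i : ℤ) - j : ℤ) : ℝ) / h * ξ))
        * (lagSum n u v ((i : ℤ) - j) * c i j) := by
    intro i j
    refine Integrable.mul_const ?_ _
    refine hκ.mul_bdd (c := 1) ?_ ?_
    · exact Continuous.aestronglyMeasurable (by fun_prop)
    · filter_upwards with ξ
      exact Real.abs_cos_le_one _
  have h1 : ∑ i ∈ Finset.range n, ∑ j ∈ Finset.range n,
      K ((((i : ℤ) - j : ℤ) : ℝ) / h) * lagSum n u v ((i : ℤ) - j) * c i j
      = ∫ ξ, ∑ i ∈ Finset.range n, ∑ j ∈ Finset.range n,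
        κ ξ * Real.cos (2 * Real.pi * ((((i : ℤ) - j : ℤ) : ℝ) / h * ξ))
        * (lagSum n u v ((i : ℤ) - j) * c i j) := by
    rw [integral_finsetSum _ fun i _ => integrable_finsetSum _ fun j _ => hI i j]
    refine Finset.sum_congr rfl fun i _ => ?_
    rw [integral_finsetSum _ fun j _ => hI i j]
    refine Finset.sum_congr rfl fun j _ => ?_
    rw [integral_mul_const, ← hK]
    ring
  rw [h1]
  have hb : ∀ ξ, ‖∑ i ∈ Finset.range n, ∑ j ∈ Finset.range n,
        κ ξ * Real.cos (2 * Real.pi * ((((i : ℤ) - j : ℤ) : ℝ) / h * ξ))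
        * (lagSum n u v ((i : ℤ) - j) * c i j)‖ ≤ |κ ξ| * (2 * (n * L)) := by
    intro ξ
    -- The addition formula for the cosine separates `i` from `j`. Each frequency contributes two
    -- sums with multipliers bounded by `1`, hence the factor `2`.
    have h2 : ∑ i ∈ Finset.range n, ∑ j ∈ Finset.range n,
        κ ξ * Real.cos (2 * Real.pi * ((((i : ℤ) - j : ℤ) : ℝ) / h * ξ))
        * (lagSum n u v ((i : ℤ) - j) * c i j)
        = κ ξ * ((∑ i ∈ Finset.range n, ∑ j ∈ Finset.range n,
            Real.cos (2 * Real.pi * (i / h * ξ)) * Real.cos (2 * Real.pi * (j / h * ξ))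
              * lagSum n u v ((i : ℤ) - j) * c i j)
          + ∑ i ∈ Finset.range n, ∑ j ∈ Finset.range n,
            Real.sin (2 * Real.pi * (i / h * ξ)) * Real.sin (2 * Real.pi * (j / h * ξ))
              * lagSum n u v ((i : ℤ) - j) * c i j) := by
      rw [← Finset.sum_add_distrib, Finset.mul_sum]
      refine Finset.sum_congr rfl fun i _ => ?_
      rw [← Finset.sum_add_distrib, Finset.mul_sum]
      refine Finset.sum_congr rfl fun j _ => ?_
      have : 2 * Real.pi * ((((i : ℤ) - j : ℤ) : ℝ) / h * ξ)
          = 2 * Real.pi * (i / h * ξ) - 2 * Real.pi * (j / h * ξ) := by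
        push_cast
        ring
      rw [this, Real.cos_sub]
      ring
    rw [h2, Real.norm_eq_abs, abs_mul]
    gcongr
    refine (abs_add_le _ _).trans ?_
    have e1 := hc.abs_sum_lagSum_le hL hu hv (a := fun i => Real.cos (2 * Real.pi * (i / h * ξ)))
        (b := fun i => Real.cos (2 * Real.pi * (i / h * ξ)))
        (fun _ => Real.abs_cos_le_one _) (fun _ => Real.abs_cos_le_one _)
    have e2 := hc.abs_sum_lagSum_le hL hu hv (a := fun i => Real.sin (2 * Real.pi * (i / h * ξ)))
        (b := fun i => Real.sin (2 * Real.pi * (i / h * ξ)))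
        (fun _ => Real.abs_sin_le_one _) (fun _ => Real.abs_sin_le_one _)
    beta_reduce at e1 e2
    linarith
  refine (norm_integral_le_of_norm_le (hκ.abs.mul_const _) (Eventually.of_forall hb)).trans ?_
  rw [integral_mul_const]
  exact le_of_eq (by ring)

/-! ### The real `L²` seminorm -/

section L2

variable {Ω : Type*} [mΩ : MeasurableSpace Ω] {P : Measure Ω}

theorem lpNorm_two_sq {f : Ω → ℝ} (hf : AEStronglyMeasurable f P) :
    lpNorm f 2 P ^ 2 = ∫ ω, f ω ^ 2 ∂P := by
  rw [lpNorm_eq_integral_norm_rpow_toReal (by norm_num) (by norm_num) hf]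
  have h0 : 0 ≤ ∫ ω, ‖f ω‖ ^ (2 : ℝ≥0∞).toReal ∂P := integral_nonneg fun _ => by positivity
  rw [← Real.rpow_natCast, ← Real.rpow_mul h0]
  norm_num

theorem lpNorm_two_eq_sqrt {f : Ω → ℝ} (hf : AEStronglyMeasurable f P) :
    lpNorm f 2 P = √(∫ ω, f ω ^ 2 ∂P) := by
  rw [← lpNorm_two_sq hf, Real.sqrt_sq lpNorm_nonneg]

theorem integral_abs_mul_le {f g : Ω → ℝ} (hf : MemLp f 2 P) (hg : MemLp g 2 P) :
    ∫ ω, |f ω * g ω| ∂P ≤ lpNorm f 2 P * lpNorm g 2 P := by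
  have h2 : ENNReal.ofReal 2 = 2 := by norm_num
  have := integral_mul_norm_le_Lp_mul_Lq (μ := P) (f := f) (g := g) (p := 2) (q := 2)
    (Real.HolderConjugate.two_two) (by rwa [h2]) (by rwa [h2])
  rw [lpNorm_eq_integral_norm_rpow_toReal (by norm_num) (by norm_num) hf.1,
    lpNorm_eq_integral_norm_rpow_toReal (by norm_num) (by norm_num) hg.1]
  simp only [abs_mul]
  simpa [Real.norm_eq_abs] using this

theorem abs_integral_mul_le {f g : Ω → ℝ} (hf : MemLp f 2 P) (hg : MemLp g 2 P) :
    |∫ ω, f ω * g ω ∂P| ≤ lpNorm f 2 P * lpNorm g 2 P :=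
  (abs_integral_le_integral_abs).trans (integral_abs_mul_le hf hg)

theorem abs_integral_mul_sub_le {f f' g g' : Ω → ℝ} (hf : MemLp f 2 P) (hf' : MemLp f' 2 P)
    (hg : MemLp g 2 P) (hg' : MemLp g' 2 P) :
    |∫ ω, f ω * g ω ∂P - ∫ ω, f' ω * g' ω ∂P| ≤
      lpNorm (fun ω => f ω - f' ω) 2 P * lpNorm g 2 P
        + lpNorm f' 2 P * lpNorm (fun ω => g ω - g' ω) 2 P := by
  have hd : MemLp (fun ω => f ω - f' ω) 2 P := hf.sub hf'
  have hd' : MemLp (fun ω => g ω - g' ω) 2 P := hg.sub hg'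
  have h1 : ∫ ω, f ω * g ω ∂P - ∫ ω, f' ω * g' ω ∂P
      = ∫ ω, (f ω - f' ω) * g ω ∂P + ∫ ω, f' ω * (g ω - g' ω) ∂P := by
    rw [← integral_sub (f := fun ω => f ω * g ω) (g := fun ω => f' ω * g' ω)
      (hf.integrable_mul hg) (hf'.integrable_mul hg'),
      ← integral_add (f := fun ω => (f ω - f' ω) * g ω) (g := fun ω => f' ω * (g ω - g' ω))
      (hd.integrable_mul hg) (hf'.integrable_mul hd')]
    congr 1
    ext ω
    ring
  rw [h1]
  exact (abs_add_le _ _).trans (add_le_add (abs_integral_mul_le hd hg) (abs_integral_mul_le hf' hd'))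

theorem integral_abs_le_lpNorm_two [IsProbabilityMeasure P] {f : Ω → ℝ} (hf : MemLp f 2 P) :
    ∫ ω, |f ω| ∂P ≤ lpNorm f 2 P := by
  have h1 : MemLp (fun _ : Ω => (1 : ℝ)) 2 P := memLp_const 1
  have := integral_abs_mul_le hf h1
  have h2 : lpNorm (fun _ : Ω => (1 : ℝ)) 2 P = 1 := by
    rw [lpNorm_two_eq_sqrt h1.1]
    simp
  simpa [h2] using this

theorem integral_sum_sq_of_orthogonal {ι : Type*} (s : Finset ι) {X : ι → Ω → ℝ}
    (hX : ∀ i ∈ s, MemLp (X i) 2 P)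
    (h0 : ∀ i ∈ s, ∀ j ∈ s, i ≠ j → ∫ ω, X i ω * X j ω ∂P = 0) :
    ∫ ω, (∑ i ∈ s, X i ω) ^ 2 ∂P = ∑ i ∈ s, ∫ ω, X i ω ^ 2 ∂P := by
  have hI : ∀ i ∈ s, ∀ j ∈ s, Integrable (fun ω => X i ω * X j ω) P := fun i hi j hj =>
    (hX i hi).integrable_mul (hX j hj)
  simp only [sq (∑ i ∈ s, X i _), Finset.sum_mul_sum]
  rw [integral_finsetSum _ fun i hi => integrable_finsetSum _ fun j hj => hI i hi j hj]
  refine Finset.sum_congr rfl fun i hi => ?_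
  rw [integral_finsetSum _ fun j hj => hI i hi j hj, Finset.sum_eq_single i]
  · simp only [sq]
  · exact fun j hj hij => h0 i hi j hj hij.symm
  · exact fun h => absurd hi h

theorem memLp_two_of_bound [IsProbabilityMeasure P] {f : Ω → ℝ} (hf : AEStronglyMeasurable f P)
    {C : ℝ} (hC : ∀ ω, |f ω| ≤ C) : MemLp f 2 P :=
  MemLp.of_bound hf C (Eventually.of_forall hC)

theorem lpNorm_comp_measurePreserving {f : Ω → ℝ} {S : Ω → Ω} (hS : MeasurePreserving S P P)
    (hf : AEStronglyMeasurable f P) : lpNorm (fun ω => f (S ω)) 2 P = lpNorm f 2 P := by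
  have h1 : AEStronglyMeasurable (fun ω => f (S ω)) P := hf.comp_measurePreserving hS
  rw [← toReal_eLpNorm h1, ← toReal_eLpNorm hf]
  congr 1
  exact eLpNorm_comp_measurePreserving hf hS

end L2

/-! ### The shift and its filtration -/

section Shift

variable {Ω : Type*} {F₀ : MeasurableSpace Ω} [mΩ : MeasurableSpace Ω] {P : Measure Ω}
  {T : Ω ≃ᵐ Ω}

theorem iter_zero : iter T 0 = id := by
  ext ω
  simp [iter]

theorem iter_one : iter T 1 = T := by
  ext ω
  simp [iter]

theorem iter_neg_one : iter T (-1) = T.symm := by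
  ext ω
  simp [iter]

theorem iter_add (i j : ℤ) (ω : Ω) : iter T (i + j) ω = iter T i (iter T j ω) := by
  simp [iter, _root_.zpow_add]

theorem iter_add_eq_comp (i j : ℤ) : iter T (i + j) = iter T i ∘ iter T j :=
  funext fun ω => iter_add i j ω

theorem measurePreserving_iter (hT : MeasurePreserving T P P) (i : ℤ) :
    MeasurePreserving (iter T i) P P := by
  induction i using Int.induction_on with
  | zero => rw [iter_zero]; exact MeasurePreserving.id P
  | succ i ih => rw [iter_add_eq_comp, iter_one]; exact ih.comp hT
  | pred i ih =>
    rw [sub_eq_add_neg, iter_add_eq_comp, iter_neg_one]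
    exact ih.comp (MeasurePreserving.symm T hT)

theorem measurable_iter (i : ℤ) : Measurable (iter T i) := by
  induction i using Int.induction_on with
  | zero => rw [iter_zero]; exact measurable_id
  | succ i ih => rw [iter_add_eq_comp, iter_one]; exact ih.comp T.measurable
  | pred i ih =>
    rw [sub_eq_add_neg, iter_add_eq_comp, iter_neg_one]
    exact ih.comp T.symm.measurable

theorem measurableEmbedding_iter (i : ℤ) : MeasurableEmbedding (iter T i) := by
  refine MeasurableEquiv.measurableEmbedding
    { toEquiv := (T.toEquiv : Equiv.Perm Ω) ^ i
      measurable_toFun := measurable_iter i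
      measurable_invFun := ?_ }
  have : ⇑((T.toEquiv : Equiv.Perm Ω) ^ i).symm = iter T (-i) := by
    rw [iter, _root_.zpow_neg]
    rfl
  rw [this]
  exact measurable_iter (-i)

theorem integral_comp_iter (hT : MeasurePreserving T P P) (i : ℤ) (f : Ω → ℝ) :
    ∫ ω, f (iter T i ω) ∂P = ∫ ω, f ω ∂P :=
  (measurePreserving_iter hT i).integral_comp (measurableEmbedding_iter i) f

theorem filt_zero : filt F₀ T 0 = F₀ := by
  rw [filt, iter_zero]
  exact MeasurableSpace.comap_id

theorem comap_filt (i j : ℤ) : (filt F₀ T i).comap (iter T j) = filt F₀ T (i + j) := by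
  rw [filt, filt, MeasurableSpace.comap_comp, iter_add_eq_comp]

theorem measurable_iter_filt (i j : ℤ) :
    @Measurable Ω Ω (filt F₀ T (i + j)) (filt F₀ T i) (iter T j) := by
  rw [← comap_filt]
  exact comap_measurable _

theorem filt_mono (hF : F₀ ≤ F₀.comap T) : Monotone (filt F₀ T) := by
  refine monotone_int_of_le_succ fun i => ?_
  rw [add_comm, ← comap_filt]
  refine MeasurableSpace.comap_mono ?_
  rw [filt, iter_one]
  exact hF

theorem filt_le (hF₀ : F₀ ≤ mΩ) (i : ℤ) : filt F₀ T i ≤ mΩ :=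
  (MeasurableSpace.comap_mono hF₀).trans (measurable_iter i).comap_le

/-! ### Innovations and their quadratic forms -/

variable (F₀ P T) in
/-- A square integrable innovation: an `𝓕₀`-measurable function orthogonal to `L²(𝓕₋₁)`. -/
structure IsInnovation (f : Ω → ℝ) : Prop where
  measurable : @Measurable Ω ℝ F₀ _ f
  memLp : MemLp f 2 P
  orthogonal : ∀ Y : Ω → ℝ, @Measurable Ω ℝ (filt F₀ T (-1)) _ Y → MemLp Y 2 P →
    ∫ ω, Y ω * f ω ∂P = 0

namespace IsInnovation

variable {f g : Ω → ℝ}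

theorem memLp_comp (hT : MeasurePreserving T P P) (hf : IsInnovation F₀ P T f) (i : ℤ) :
    MemLp (fun ω => f (iter T i ω)) 2 P :=
  hf.memLp.comp_measurePreserving (measurePreserving_iter hT i)

theorem measurable_comp (hf : @Measurable Ω ℝ F₀ _ f) (i : ℤ) :
    @Measurable Ω ℝ (filt F₀ T i) _ (fun ω => f (iter T i ω)) :=
  @Measurable.comp _ _ _ (filt F₀ T i) F₀ _ _ _ hf (comap_measurable _)

/-- Composing with `𝕋⁻ᵗ` preserves the integral and brings `Y` back to `𝓕₋₁`, where the defining
orthogonality applies. -/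
theorem integral_mul_comp_eq_zero (hT : MeasurePreserving T P P) (hf : IsInnovation F₀ P T f)
    {t : ℤ} {Y : Ω → ℝ} (hY : @Measurable Ω ℝ (filt F₀ T (t - 1)) _ Y) (hY2 : MemLp Y 2 P) :
    ∫ ω, Y ω * f (iter T t ω) ∂P = 0 := by
  have h1 := hf.orthogonal (fun ω => Y (iter T (-t) ω)) ?_
    (hY2.comp_measurePreserving (measurePreserving_iter hT (-t)))
  · rw [← integral_comp_iter hT (t)] at h1
    simp only [← iter_add] at h1
    simpa [iter_zero] using h1
  · have := measurable_iter_filt (F₀ := F₀) (T := T) (t - 1) (-t)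
    rw [show t - 1 + -t = -1 by ring] at this
    exact @Measurable.comp _ _ _ (filt F₀ T (-1)) (filt F₀ T (t - 1)) _ _ _ hY this

theorem integral_comp_mul_comp_eq_zero (hT : MeasurePreserving T P P) (hF : F₀ ≤ F₀.comap T)
    (hf : IsInnovation F₀ P T f) (hg : IsInnovation F₀ P T g) {s t : ℤ} (hst : s ≠ t) :
    ∫ ω, f (iter T s ω) * g (iter T t ω) ∂P = 0 := by
  rcases lt_or_gt_of_ne hst with h | h
  · refine hg.integral_mul_comp_eq_zero hT ?_ (hf.memLp_comp hT s)
    exact (measurable_comp hf.measurable s).mono (filt_mono hF (by omega)) le_rfl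
  · simp only [mul_comm (f _)]
    refine hf.integral_mul_comp_eq_zero hT ?_ (hg.memLp_comp hT t)
    exact (measurable_comp hg.measurable t).mono (filt_mono hF (by omega)) le_rfl

theorem memLp_sum (hT : MeasurePreserving T P P) (hf : IsInnovation F₀ P T f) (n : ℕ) (α : ℕ → ℝ)
    (a : ℤ) : MemLp (fun ω => ∑ i ∈ Finset.range n, α i * f (iter T (i + a) ω)) 2 P :=
  memLp_finsetSum _ fun _ _ => (hf.memLp_comp hT _).const_mul _

theorem integral_sum_sq (hT : MeasurePreserving T P P) (hF : F₀ ≤ F₀.comap T)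
    (hf : IsInnovation F₀ P T f) (n : ℕ) (α : ℕ → ℝ) (a : ℤ) :
    ∫ ω, (∑ i ∈ Finset.range n, α i * f (iter T (i + a) ω)) ^ 2 ∂P
      = (∑ i ∈ Finset.range n, α i ^ 2) * lpNorm f 2 P ^ 2 := by
  rw [integral_sum_sq_of_orthogonal _ fun i _ => (hf.memLp_comp hT _).const_mul _, Finset.sum_mul]
  · refine Finset.sum_congr rfl fun i _ => ?_
    rw [lpNorm_two_sq hf.memLp.1, ← integral_comp_iter hT (i + a) (fun ω => f ω ^ 2),
      ← integral_const_mul]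
    simp only [mul_pow]
  · intro i _ j _ hij
    have h1 := integral_comp_mul_comp_eq_zero hT hF hf hf (s := i + a) (t := j + a) (by omega)
    calc _ = ∫ ω, α i * α j * (f (iter T (i + a) ω) * f (iter T (j + a) ω)) ∂P := by
          congr 1
          ext ω
          ring
      _ = 0 := by rw [integral_const_mul, h1, mul_zero]

/-- Distinct shifts of an innovation are orthogonal with equal norms, so Pythagoras is exact. This
identity is what makes covariances of innovations bounded bilinear forms. -/
theorem lpNorm_sum (hT : MeasurePreserving T P P) (hF : F₀ ≤ F₀.comap T)
    (hf : IsInnovation F₀ P T f) (n : ℕ) (α : ℕ → ℝ) (a : ℤ) :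
    lpNorm (fun ω => ∑ i ∈ Finset.range n, α i * f (iter T (i + a) ω)) 2 P
      = √(∑ i ∈ Finset.range n, α i ^ 2) * lpNorm f 2 P := by
  rw [lpNorm_two_eq_sqrt (hf.memLp_sum hT n α a).1, hf.integral_sum_sq hT hF, Real.sqrt_mul
    (Finset.sum_nonneg fun _ _ => sq_nonneg _), Real.sqrt_sq lpNorm_nonneg]

theorem sub (hf : IsInnovation F₀ P T f) (hg : IsInnovation F₀ P T g) :
    IsInnovation F₀ P T (fun ω => f ω - g ω) where
  measurable := hf.measurable.sub hg.measurable
  memLp := hf.memLp.sub hg.memLp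
  orthogonal Y hY hY2 := by
    simp only [mul_sub]
    rw [integral_sub (f := fun ω => Y ω * f ω) (g := fun ω => Y ω * g ω)
      (hY2.integrable_mul hf.memLp) (hY2.integrable_mul hg.memLp),
      hf.orthogonal Y hY hY2, hg.orthogonal Y hY hY2, sub_zero]

theorem integrable_toeplitzForm (hT : MeasurePreserving T P P) (hf : MemLp f 2 P)
    (hg : MemLp g 2 P) (n : ℕ) (w : ℤ → ℝ) (a b : ℤ) :
    Integrable (fun ω => toeplitzForm n w (fun i => f (iter T (i + a) ω))
      (fun j => g (iter T (j + b) ω))) P :=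
  integrable_finsetSum _ fun _ _ => integrable_finsetSum _ fun _ _ => Integrable.const_mul
    ((hf.comp_measurePreserving (measurePreserving_iter hT _)).integrable_mul
      (hg.comp_measurePreserving (measurePreserving_iter hT _))) _

/-- Uniform `L¹` bound for tapered quadratic forms in innovations. -/
theorem integral_abs_toeplitzForm_le (hT : MeasurePreserving T P P) (hF₀ : F₀ ≤ mΩ)
    (hF : F₀ ≤ F₀.comap T) (hf : IsInnovation F₀ P T f) (hg : IsInnovation F₀ P T g)
    {n : ℕ} {u v : ℕ → ℝ}
    (hu : ∑ i ∈ Finset.range n, u i ^ 2 ≤ 1) (hv : ∑ i ∈ Finset.range n, v i ^ 2 ≤ 1)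
    {K κ : ℝ → ℝ} (hκ : Integrable κ)
    (hK : ∀ u, K u = ∫ ξ, κ ξ * Real.cos (2 * Real.pi * (u * ξ))) (h : ℝ) (a b : ℤ) :
    ∫ ω, |toeplitzForm n (fun k => K (k / h) * lagSum n u v k) (fun i => f (iter T (i + a) ω))
      (fun j => g (iter T (j + b) ω))| ∂P
        ≤ 2 * (∫ ξ, |κ ξ|) * (n * (lpNorm f 2 P * lpNorm g 2 P)) := by
  set Q : Ω → ℝ := fun ω => toeplitzForm n (fun k => K (k / h) * lagSum n u v k)
    (fun i => f (iter T (i + a) ω)) (fun j => g (iter T (j + b) ω)) with hQ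
  have hfm : ∀ i : ℤ, Measurable fun ω => f (iter T i ω) := fun i =>
    (hf.measurable.mono hF₀ le_rfl).comp (measurable_iter i)
  have hgm : ∀ i : ℤ, Measurable fun ω => g (iter T i ω) := fun i =>
    (hg.measurable.mono hF₀ le_rfl).comp (measurable_iter i)
  have hQm : Measurable Q := by
    refine Finset.measurable_fun_sum _ fun i _ => Finset.measurable_fun_sum _ fun j _ => ?_
    exact ((hfm _).mul (hgm _)).const_mul _
  -- The sign of `Q` linearises `|Q|`: the `L¹` norm becomes a weighted sum of the numbers `c i j`
  -- below.
  set s : Ω → ℝ := fun ω => if 0 ≤ Q ω then 1 else -1 with hs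
  have hsm : Measurable s :=
    Measurable.ite (measurableSet_le measurable_const hQm) measurable_const measurable_const
  have hs1 : ∀ ω, |s ω| ≤ 1 := by
    intro ω
    simp only [hs]
    split_ifs <;> simp
  have habs : ∀ ω, |Q ω| = s ω * Q ω := by
    intro ω
    simp only [hs]
    split_ifs with h0
    · rw [abs_of_nonneg h0, one_mul]
    · rw [abs_of_neg (not_le.1 h0), neg_one_mul]
  have hI : ∀ i j : ℕ, Integrable (fun ω => s ω * (f (iter T (i + a) ω) * g (iter T (j + b) ω)))
      P := fun i j => ((hf.memLp_comp hT _).integrable_mul (hg.memLp_comp hT _)).bdd_mul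
        hsm.aestronglyMeasurable (Eventually.of_forall hs1)
  set c : ℕ → ℕ → ℝ := fun i j => ∫ ω, s ω * (f (iter T (i + a) ω) * g (iter T (j + b) ω)) ∂P
    with hc
  -- Since `|s| ≤ 1`, Cauchy–Schwarz removes the sign, and orthogonality of the shifts evaluates the
  -- two remaining norms.
  have hcB : BilinBounded n c (lpNorm f 2 P * lpNorm g 2 P) := by
    intro α β
    have h1 : ∑ i ∈ Finset.range n, ∑ j ∈ Finset.range n, α i * β j * c i j
        = ∫ ω, s ω * ((∑ i ∈ Finset.range n, α i * f (iter T (i + a) ω))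
          * ∑ j ∈ Finset.range n, β j * g (iter T (j + b) ω)) ∂P := by
      simp only [Finset.sum_mul_sum]
      simp only [Finset.mul_sum]
      rw [integral_finsetSum]
      · refine Finset.sum_congr rfl fun i _ => ?_
        rw [integral_finsetSum]
        · refine Finset.sum_congr rfl fun j _ => ?_
          rw [hc, ← integral_const_mul]
          congr 1
          ext ω
          ring
        · intro j _
          convert (hI i j).const_mul (α i * β j) using 2
          ring
      · intro i _
        refine integrable_finsetSum _ fun j _ => ((hI i j).const_mul (α i * β j)).congr
          (Eventually.of_forall fun ω => ?_)
        ring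
    rw [h1]
    have hA := hf.memLp_sum hT n α a
    have hB := hg.memLp_sum hT n β b
    calc _ ≤ ∫ ω, |s ω * ((∑ i ∈ Finset.range n, α i * f (iter T (i + a) ω))
          * ∑ j ∈ Finset.range n, β j * g (iter T (j + b) ω))| ∂P := abs_integral_le_integral_abs
      _ ≤ ∫ ω, |(∑ i ∈ Finset.range n, α i * f (iter T (i + a) ω))
          * ∑ j ∈ Finset.range n, β j * g (iter T (j + b) ω)| ∂P := by
          refine integral_mono_of_nonneg (Eventually.of_forall fun _ => abs_nonneg _)
            (hA.integrable_mul hB).abs (Eventually.of_forall fun ω => ?_)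
          dsimp only
          rw [abs_mul]
          exact mul_le_of_le_one_left (abs_nonneg _) (hs1 ω)
      _ ≤ _ := integral_abs_mul_le hA hB
      _ = (√(∑ i ∈ Finset.range n, α i ^ 2) * √(∑ i ∈ Finset.range n, β i ^ 2))
            * (lpNorm f 2 P * lpNorm g 2 P) := by
          rw [hf.lpNorm_sum hT hF, hg.lpNorm_sum hT hF]
          ring
      _ ≤ _ := by
          rw [mul_comm]
          refine mul_le_mul_of_nonneg_left ?_ (mul_nonneg lpNorm_nonneg lpNorm_nonneg)
          have e1 := Real.sq_sqrt (Finset.sum_nonneg fun i (_ : i ∈ Finset.range n) =>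
            sq_nonneg (α i))
          have e2 := Real.sq_sqrt (Finset.sum_nonneg fun i (_ : i ∈ Finset.range n) =>
            sq_nonneg (β i))
          nlinarith [sq_nonneg (√(∑ i ∈ Finset.range n, α i ^ 2) - √(∑ i ∈ Finset.range n, β i ^ 2))]
  have h2 : ∫ ω, |Q ω| ∂P = ∑ i ∈ Finset.range n, ∑ j ∈ Finset.range n,
      K ((((i : ℤ) - j : ℤ) : ℝ) / h) * lagSum n u v ((i : ℤ) - j) * c i j := by
    simp only [habs]
    simp only [hQ, toeplitzForm, Finset.mul_sum]
    rw [integral_finsetSum]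
    · refine Finset.sum_congr rfl fun i _ => ?_
      rw [integral_finsetSum]
      · refine Finset.sum_congr rfl fun j _ => ?_
        rw [hc, ← integral_const_mul]
        congr 1
        ext ω
        ring
      · intro j _
        convert (hI i j).const_mul
          (K ((((i : ℤ) - j : ℤ) : ℝ) / h) * lagSum n u v ((i : ℤ) - j)) using 2
        ring
    · intro i _
      refine integrable_finsetSum _ fun j _ => ((hI i j).const_mul
        (K ((((i : ℤ) - j : ℤ) : ℝ) / h) * lagSum n u v ((i : ℤ) - j))).congr
          (Eventually.of_forall fun ω => ?_)
      ring
  rw [h2]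
  exact (le_abs_self _).trans (hcB.abs_sum_cos_transform_le
    (mul_nonneg lpNorm_nonneg lpNorm_nonneg) hu hv hκ hK h)

end IsInnovation

end Shift

/-! ### Downward convergence and decorrelation -/

section Downward

variable {Ω : Type*} {F₀ : MeasurableSpace Ω} [mΩ : MeasurableSpace Ω] {P : Measure Ω}
  [IsProbabilityMeasure P] {T : Ω ≃ᵐ Ω}

/-- A function measurable, up to null sets, for every `𝓕₋ₖ` is almost surely constant when the
tail `σ`-algebra is trivial. -/
theorem ae_eq_const_of_forall_filt (hF₀ : F₀ ≤ mΩ) (hF : F₀ ≤ F₀.comap T)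
    (hbot : ∀ A : Set Ω, MeasurableSet[⨅ i : ℤ, filt F₀ T i] A → P A = 0 ∨ P A = 1)
    {y : Ω → ℝ} (hy : ∀ k : ℕ, AEStronglyMeasurable[filt F₀ T (-k)] y P) :
    ∃ c : ℝ, y =ᵐ[P] fun _ => c := by
  choose y' hy'm hy'e using hy
  -- The versions `y' k` agree with `y` only almost everywhere. Their limsup ignores finitely many
  -- terms, hence is measurable for every `𝓕ᵢ` and so for the tail σ-algebra.
  set Y : Ω → ℝ := fun ω => limsup (fun k => y' k ω) atTop with hY
  have hYe : y =ᵐ[P] Y := by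
    filter_upwards [ae_all_iff.2 hy'e] with ω hω
    simp only [hY, ← hω]
    rw [limsup_const]
  have hYm : ∀ i : ℤ, @Measurable Ω ℝ (filt F₀ T i) _ Y := by
    intro i
    have h1 : Y = fun ω => limsup (fun k => y' (k + i.natAbs) ω) atTop := by
      ext ω
      exact (limsup_nat_add (fun k => y' k ω) i.natAbs).symm
    rw [h1]
    refine Measurable.limsup fun k => ?_
    exact (hy'm _).measurable.mono (filt_mono hF (by omega)) le_rfl
  have hYinf : @Measurable Ω ℝ (⨅ i : ℤ, filt F₀ T i) _ Y := by
    intro A hA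
    rw [MeasurableSpace.measurableSet_iInf]
    exact fun i => hYm i hA
  obtain ⟨c, hc⟩ := Filter.exists_eventuallyEq_const_of_forall_separating (l := ae P) (f := Y)
    MeasurableSet (fun U hU => by
      have hm : MeasurableSet (Y ⁻¹' U) := filt_le hF₀ 0 _ (hYm 0 hU)
      rcases hbot _ (hYinf hU) with h | h
      · right
        exact measure_eq_zero_iff_ae_notMem.1 h
      · left
        exact (mem_ae_iff_prob_eq_one hm).2 h)
  exact ⟨c, hYe.trans hc⟩

/-- Reverse martingale convergence in Hilbert space: the spaces `L²(𝓕₋ₖ)` decrease, so their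
orthogonal complements increase and the projections converge. The limit lies in every `L²(𝓕₋ₖ)`,
hence is constant, and having mean zero it vanishes. -/
theorem tendsto_lpNorm_condExp_filt_neg (hF₀ : F₀ ≤ mΩ) (hF : F₀ ≤ F₀.comap T)
    (hbot : ∀ A : Set Ω, MeasurableSet[⨅ i : ℤ, filt F₀ T i] A → P A = 0 ∨ P A = 1)
    {ψ : Ω → ℝ} (hψ : MemLp ψ 2 P) (h0 : ∫ ω, ψ ω ∂P = 0) :
    Tendsto (fun k : ℕ => lpNorm (P[ψ | filt F₀ T (-k)]) 2 P) atTop (𝓝 0) := by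
  have hle : ∀ k : ℕ, filt F₀ T (-k) ≤ mΩ := fun k => filt_le hF₀ _
  have : ∀ k : ℕ, Fact (filt F₀ T (-k) ≤ mΩ) := fun k => ⟨hle k⟩
  set x : Lp ℝ 2 P := hψ.toLp ψ with hx
  set V : ℕ → Submodule ℝ (Lp ℝ 2 P) := fun k => lpMeas ℝ ℝ (filt F₀ T (-k)) 2 P with hV
  have : ∀ k, CompleteSpace (V k) := fun k =>
    inferInstanceAs (CompleteSpace (lpMeas ℝ ℝ (filt F₀ T (-k)) 2 P))
  have hVanti : ∀ k l, k ≤ l → V l ≤ V k := by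
    intro k l hkl g hg
    rw [hV, mem_lpMeas_iff_aestronglyMeasurable] at hg ⊢
    exact hg.mono (filt_mono hF (by omega))
  have hmono : Monotone fun k => (V k)ᗮ := fun k l hkl => Submodule.orthogonal_le (hVanti k l hkl)
  have hlim := Submodule.starProjection_tendsto_closure_iSup (fun k => (V k)ᗮ) hmono x
  set W := (⨆ k, (V k)ᗮ).topologicalClosure with hW
  set y := x - W.starProjection x with hy
  have hproj : ∀ k, (V k).starProjection x = x - (V k)ᗮ.starProjection x := by
    intro k
    rw [Submodule.starProjection_orthogonal']
    simp
  have hlim2 : Tendsto (fun k => (V k).starProjection x) atTop (𝓝 y) := by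
    simp only [hproj]
    exact tendsto_const_nhds.sub hlim
  have hce : ∀ k : ℕ, ((V k).starProjection x : Lp ℝ 2 P) =ᵐ[P] P[ψ | filt F₀ T (-k)] :=
    fun k => hψ.condExpL2_ae_eq_condExp (𝕜 := ℝ) (hle k)
  have hyV : ∀ k, y ∈ V k := by
    intro k
    have h1 : y ∈ Wᗮ := W.sub_starProjection_mem_orthogonal x
    have h2 : (V k)ᗮ ≤ W := (le_iSup (fun k => (V k)ᗮ) k).trans (Submodule.le_topologicalClosure _)
    have h3 := Submodule.orthogonal_le h2 h1
    rwa [Submodule.orthogonal_orthogonal] at h3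
  obtain ⟨c, hc⟩ := ae_eq_const_of_forall_filt hF₀ hF hbot (y := y) fun k => by
    have := hyV k
    rwa [hV, mem_lpMeas_iff_aestronglyMeasurable] at this
  have hone : ∀ k, inner ℝ (memLp_const (1 : ℝ) |>.toLp (fun _ : Ω => (1 : ℝ)) : Lp ℝ 2 P)
      ((V k).starProjection x) = 0 := by
    intro k
    rw [L2.inner_def]
    have : ∫ ω, P[ψ | filt F₀ T (-k)] ω ∂P = 0 := by rw [integral_condExp (hle k), h0]
    rw [← this]
    refine integral_congr_ae ?_
    filter_upwards [hce k, (memLp_const (1 : ℝ)).coeFn_toLp (μ := P) (p := 2)] with ω h1 h2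
    rw [h1, h2]
    simp
  -- The inner product with the constant `1` is the mean; it is zero along the sequence, hence at
  -- the limit.
  have hyc : c = 0 := by
    have h1 := (tendsto_const_nhds (x := ((memLp_const (1 : ℝ)).toLp (fun _ : Ω => (1 : ℝ))
      : Lp ℝ 2 P))).inner (𝕜 := ℝ) hlim2
    simp only [hone] at h1
    have h2 := tendsto_nhds_unique h1 tendsto_const_nhds
    rw [L2.inner_def] at h2
    rw [← h2]
    have : c = ∫ _ : Ω, c ∂P := by simp
    rw [this]
    refine integral_congr_ae ?_
    filter_upwards [hc, (memLp_const (1 : ℝ)).coeFn_toLp (μ := P) (p := 2)] with ω h1 h2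
    rw [h1, h2]
    simp
  have hy0 : y = 0 := by
    rw [Lp.eq_zero_iff_ae_eq_zero]
    rw [hyc] at hc
    exact hc
  rw [hy0] at hlim2
  refine (tendsto_norm_zero.comp hlim2).congr fun k => ?_
  rw [Function.comp_apply, Lp.norm_def, toReal_eLpNorm (Lp.aestronglyMeasurable _)]
  rw [← toReal_eLpNorm (Lp.aestronglyMeasurable _), eLpNorm_congr_ae (hce k),
    toReal_eLpNorm integrable_condExp.1]

/-- Decorrelation along the shift. -/
theorem tendsto_integral_mul_comp_iter (hT : MeasurePreserving T P P) (hF₀ : F₀ ≤ mΩ)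
    (hF : F₀ ≤ F₀.comap T)
    (hbot : ∀ A : Set Ω, MeasurableSet[⨅ i : ℤ, filt F₀ T i] A → P A = 0 ∨ P A = 1)
    {ψ : Ω → ℝ} (hψm : @Measurable Ω ℝ F₀ _ ψ) (hψ : MemLp ψ 2 P) (h0 : ∫ ω, ψ ω ∂P = 0) :
    Tendsto (fun k : ℕ => ∫ ω, ψ ω * ψ (iter T k ω) ∂P) atTop (𝓝 0) := by
  have hle : ∀ k : ℕ, filt F₀ T (-k) ≤ mΩ := fun k => filt_le hF₀ _
  -- Shifting by `-k` puts one factor in `𝓕₋ₖ`; the other may then be replaced by its conditional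
  -- expectation, whose norm tends to zero.
  have h1 : ∀ k : ℕ, ∫ ω, ψ ω * ψ (iter T k ω) ∂P
      = ∫ ω, ψ (iter T (-k) ω) * P[ψ | filt F₀ T (-k)] ω ∂P := by
    intro k
    have hm : @Measurable Ω ℝ (filt F₀ T (-k)) _ fun ω => ψ (iter T (-k) ω) :=
      IsInnovation.measurable_comp hψm _
    have hm2 : MemLp (fun ω => ψ (iter T (-k) ω)) 2 P :=
      hψ.comp_measurePreserving (measurePreserving_iter hT _)
    have h2 := condExp_mul_of_stronglyMeasurable_left (μ := P) (m := filt F₀ T (-k))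
      (f := fun ω => ψ (iter T (-k) ω)) (g := ψ) hm.stronglyMeasurable (hm2.integrable_mul hψ) (hψ.integrable one_le_two)
    calc _ = ∫ ω, ψ (iter T (-k) ω) * ψ ω ∂P := by
          rw [← integral_comp_iter hT (-k)]
          simp only [← iter_add]
          simp [iter_zero]
      _ = ∫ ω, P[(fun ω => ψ (iter T (-k) ω)) * ψ | filt F₀ T (-k)] ω ∂P := by
          rw [integral_condExp (hle k)]
          rfl
      _ = _ := integral_congr_ae h2
  simp only [h1]
  have h3 := (tendsto_lpNorm_condExp_filt_neg hF₀ hF hbot hψ h0).const_mul (lpNorm ψ 2 P)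
  rw [mul_zero] at h3
  refine squeeze_zero_norm (fun k => ?_) h3
  have hm2 : MemLp (fun ω => ψ (iter T (-k) ω)) 2 P :=
    hψ.comp_measurePreserving (measurePreserving_iter hT _)
  refine (abs_integral_mul_le hm2 (hψ.condExp one_le_two)).trans (le_of_eq ?_)
  rw [lpNorm_comp_measurePreserving (measurePreserving_iter hT _) hψ.1]

/-- Each distance from `i` is attained at most once on either side of `i`. -/
theorem sum_natAbs_sub_le {g : ℕ → ℝ} (hg : ∀ k, 0 ≤ g k) {n i : ℕ} (hi : i < n) :
    ∑ j ∈ Finset.range n, g ((i : ℤ) - j).natAbs ≤ 2 * ∑ k ∈ Finset.range n, g k := by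
  have h1 : ∀ j ∈ Finset.range n, g ((i : ℤ) - j).natAbs ≤ ∑ k ∈ Finset.range n,
      ((if j + k = i then g k else 0) + if i + k = j then g k else 0) := by
    intro j hj
    rw [Finset.mem_range] at hj
    have h2 := Finset.single_le_sum (s := Finset.range n) (f := fun k =>
      ((if j + k = i then g k else 0) + if i + k = j then g k else 0)) (fun k _ => by
        have := hg k
        split_ifs <;> simp [this]) (a := ((i : ℤ) - j).natAbs) (by simp; omega)
    refine le_trans ?_ h2
    have := hg ((i : ℤ) - j).natAbs
    rcases le_total j i with h | h
    · rw [if_pos (by omega)]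
      split_ifs <;> simp [this]
    · rw [if_pos (show i + ((i : ℤ) - j).natAbs = j by omega)]
      split_ifs <;> simp [this]
  refine (Finset.sum_le_sum h1).trans ?_
  rw [Finset.sum_comm, Finset.mul_sum]
  refine Finset.sum_le_sum fun k _ => ?_
  rw [Finset.sum_add_distrib, two_mul]
  have hcard : ∀ p : ℕ → Prop, [DecidablePred p] → (∀ x y, p x → p y → x = y) →
      (∑ j ∈ Finset.range n, if p j then g k else 0) ≤ g k := by
    intro p _ hp
    rw [← Finset.sum_filter, Finset.sum_const, nsmul_eq_mul]
    have : (Finset.filter p (Finset.range n)).card ≤ 1 := by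
      rw [Finset.card_le_one]
      intro x hx y hy
      exact hp x y (Finset.mem_filter.1 hx).2 (Finset.mem_filter.1 hy).2
    have h1 : ((Finset.filter p (Finset.range n)).card : ℝ) ≤ 1 := by exact_mod_cast this
    nlinarith [hg k]
  exact add_le_add (hcard (fun j => j + k = i) fun x y hx hy => by omega)
    (hcard (fun j => i + k = j) fun x y hx hy => by omega)

/-- Mean ergodic theorem for bounded `𝓕₀`-measurable functions. -/
theorem tendsto_integral_abs_average_sub (hT : MeasurePreserving T P P) (hF₀ : F₀ ≤ mΩ)
    (hF : F₀ ≤ F₀.comap T)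
    (hbot : ∀ A : Set Ω, MeasurableSet[⨅ i : ℤ, filt F₀ T i] A → P A = 0 ∨ P A = 1)
    {φ : Ω → ℝ} (hφm : @Measurable Ω ℝ F₀ _ φ) {C : ℝ} (hC : ∀ ω, |φ ω| ≤ C) (a : ℤ) :
    Tendsto (fun n : ℕ => ∫ ω, |(1 / (n : ℝ)) * (∑ i ∈ Finset.range n, φ (iter T (i + a) ω))
      - ∫ ω, φ ω ∂P| ∂P) atTop (𝓝 0) := by
  set e := ∫ ω, φ ω ∂P with he
  set ψ : Ω → ℝ := fun ω => φ ω - e with hψ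
  have hφ2 : MemLp φ 2 P := memLp_two_of_bound (hφm.mono hF₀ le_rfl).aestronglyMeasurable hC
  have hψ2 : MemLp ψ 2 P := hφ2.sub (memLp_const e)
  have hψm : @Measurable Ω ℝ F₀ _ ψ := hφm.sub_const e
  have hψ0 : ∫ ω, ψ ω ∂P = 0 := by
    rw [hψ, integral_sub (hφ2.integrable one_le_two) (integrable_const e)]
    simp [he]
  set r : ℕ → ℝ := fun k => ∫ ω, ψ ω * ψ (iter T k ω) ∂P with hr
  have hr0 : Tendsto r atTop (𝓝 0) := tendsto_integral_mul_comp_iter hT hF₀ hF hbot hψm hψ2 hψ0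
  have hψi : ∀ i : ℤ, MemLp (fun ω => ψ (iter T i ω)) 2 P := fun i =>
    hψ2.comp_measurePreserving (measurePreserving_iter hT i)
  have hrij : ∀ i j : ℕ, ∫ ω, ψ (iter T (i + a) ω) * ψ (iter T (j + a) ω) ∂P
      = r ((i : ℤ) - j).natAbs := by
    have h1 : ∀ i k : ℕ, ∫ ω, ψ (iter T (i + a) ω) * ψ (iter T (k + i + a) ω) ∂P = r k := by
      intro i k
      simp only [hr]
      rw [← integral_comp_iter hT (i + a) (fun ω => ψ ω * ψ (iter T k ω))]
      simp only [← iter_add, add_assoc]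
    intro i j
    rcases le_total i j with h | h
    · obtain ⟨k, rfl⟩ := Nat.exists_eq_add_of_le' h
      rw [show ((i : ℤ) - ((k + i : ℕ) : ℤ)).natAbs = k by omega, ← h1 i k]
      push_cast
      rfl
    · obtain ⟨k, rfl⟩ := Nat.exists_eq_add_of_le' h
      rw [show (((k + j : ℕ) : ℤ) - (j : ℤ)).natAbs = k by omega, ← h1 j k]
      push_cast
      simp only [mul_comm]
  -- The variance of the average is at most twice the Cesàro mean of the `|r k|`, which tends to
  -- zero with `r`.
  have hbound : ∀ n : ℕ, 0 < n → ∫ ω, |(1 / (n : ℝ)) * (∑ i ∈ Finset.range n, φ (iter T (i + a) ω))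
      - e| ∂P ≤ √(2 * ((n : ℝ)⁻¹ * ∑ k ∈ Finset.range n, |r k|)) := by
    intro n hn
    have hn' : (0 : ℝ) < n := by exact_mod_cast hn
    have h1 : ∀ ω, (1 / (n : ℝ)) * (∑ i ∈ Finset.range n, φ (iter T (i + a) ω)) - e
        = (1 / (n : ℝ)) * ∑ i ∈ Finset.range n, ψ (iter T (i + a) ω) := by
      intro ω
      simp only [hψ, Finset.sum_sub_distrib, Finset.sum_const, Finset.card_range, nsmul_eq_mul]
      field_simp
    simp only [h1]
    have h2 : MemLp (fun ω => (1 / (n : ℝ)) * ∑ i ∈ Finset.range n, ψ (iter T (i + a) ω)) 2 P :=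
      (memLp_finsetSum _ fun i _ => hψi _).const_mul _
    refine (integral_abs_le_lpNorm_two h2).trans ?_
    rw [lpNorm_two_eq_sqrt h2.1]
    refine Real.sqrt_le_sqrt ?_
    simp only [mul_pow]
    rw [integral_const_mul]
    have h3 : ∫ ω, (∑ i ∈ Finset.range n, ψ (iter T (i + a) ω)) ^ 2 ∂P
        = ∑ i ∈ Finset.range n, ∑ j ∈ Finset.range n, r ((i : ℤ) - j).natAbs := by
      simp only [sq, Finset.sum_mul_sum]
      have hI : ∀ i j : ℕ, Integrable (fun ω => ψ (iter T (i + a) ω) * ψ (iter T (j + a) ω)) P :=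
        fun i j => (hψi _).integrable_mul (hψi _)
      rw [integral_finsetSum _ fun i _ => integrable_finsetSum _ fun j _ => hI i j]
      refine Finset.sum_congr rfl fun i _ => ?_
      rw [integral_finsetSum _ fun j _ => hI i j]
      exact Finset.sum_congr rfl fun j _ => hrij i j
    have h4 : ∑ i ∈ Finset.range n, ∑ j ∈ Finset.range n, r ((i : ℤ) - j).natAbs
        ≤ n * (2 * ∑ k ∈ Finset.range n, |r k|) := by
      calc _ ≤ ∑ i ∈ Finset.range n, ∑ j ∈ Finset.range n, |r ((i : ℤ) - j).natAbs| :=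
            Finset.sum_le_sum fun i _ => Finset.sum_le_sum fun j _ => le_abs_self _
        _ ≤ ∑ i ∈ Finset.range n, 2 * ∑ k ∈ Finset.range n, |r k| :=
            Finset.sum_le_sum fun i hi => sum_natAbs_sub_le (g := fun k => |r k|)
              (fun k => abs_nonneg _) (Finset.mem_range.1 hi)
        _ = _ := by simp
    rw [h3]
    calc _ ≤ (1 / (n : ℝ)) ^ 2 * (n * (2 * ∑ k ∈ Finset.range n, |r k|)) := by gcongr
      _ = _ := by field_simp
  have hces : Tendsto (fun n : ℕ => √(2 * ((n : ℝ)⁻¹ * ∑ k ∈ Finset.range n, |r k|))) atTop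
      (𝓝 0) := by
    have h1 : Tendsto (fun k => |r k|) atTop (𝓝 0) := by simpa using hr0.abs
    have h2 := (h1.cesaro.const_mul 2).sqrt
    simpa using h2
  refine squeeze_zero' (Eventually.of_forall fun n => integral_nonneg fun _ => abs_nonneg _) ?_ hces
  filter_upwards [eventually_gt_atTop 0] with n hn using hbound n hn

end Downward

/-! ### Quadratic forms in bounded innovations -/

section Bounded

variable {Ω : Type*} {F₀ : MeasurableSpace Ω} [mΩ : MeasurableSpace Ω] {P : Measure Ω}
  [IsProbabilityMeasure P] {T : Ω ≃ᵐ Ω}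

namespace IsInnovation

variable {f g : Ω → ℝ}

/-- Variance bound for the part of the quadratic form where the `f`-index is the larger one. -/
theorem integral_sq_upper_le (hT : MeasurePreserving T P P) (hF₀ : F₀ ≤ mΩ)
    (hF : F₀ ≤ F₀.comap T) (hf : IsInnovation F₀ P T f) (hg : IsInnovation F₀ P T g)
    {Cf Cg : ℝ} (hCf : ∀ ω, |f ω| ≤ Cf) (hCg : ∀ ω, |g ω| ≤ Cg) (n : ℕ) (w : ℤ → ℝ) {S : ℝ}
    (hS : ∀ i ∈ Finset.range n, ∑ j ∈ Finset.range n, w ((i : ℤ) - j) ^ 2 ≤ S) (a b : ℤ) :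
    MemLp (fun ω => ∑ i ∈ Finset.range n, f (iter T (i + a) ω) * ∑ j ∈ Finset.range n,
      (if (j : ℤ) + b < i + a then w ((i : ℤ) - j) else 0) * g (iter T (j + b) ω)) 2 P ∧
    ∫ ω, (∑ i ∈ Finset.range n, f (iter T (i + a) ω) * ∑ j ∈ Finset.range n,
      (if (j : ℤ) + b < i + a then w ((i : ℤ) - j) else 0) * g (iter T (j + b) ω)) ^ 2 ∂P
      ≤ n * (Cf ^ 2 * (S * lpNorm g 2 P ^ 2)) := by
  set α : ℕ → ℕ → ℝ := fun i j => if (j : ℤ) + b < i + a then w ((i : ℤ) - j) else 0 with hα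
  set W : ℕ → Ω → ℝ := fun i ω => ∑ j ∈ Finset.range n, α i j * g (iter T (j + b) ω) with hW
  set X : ℕ → Ω → ℝ := fun i ω => f (iter T (i + a) ω) * W i ω with hX
  -- Only `g`-times strictly before `i + a` are retained, so `W i` is known one step earlier and the
  -- products `X i` are martingale differences.
  have hWm : ∀ i : ℕ, @Measurable Ω ℝ (filt F₀ T (i + a - 1)) _ (W i) := by
    intro i
    refine Finset.measurable_fun_sum _ fun j _ => ?_
    by_cases h : (j : ℤ) + b < i + a
    · exact ((measurable_comp hg.measurable (j + b)).mono (filt_mono hF (by omega)) le_rfl).const_mul _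
    · simp only [hα, if_neg h, zero_mul]
      exact measurable_const
  have hCf0 : ∀ _ : Ω, 0 ≤ Cf := fun ω => (abs_nonneg _).trans (hCf ω)
  have hWb : ∀ i, ∀ ω, |W i ω| ≤ ∑ j ∈ Finset.range n, |α i j| * Cg := by
    intro i ω
    refine (Finset.abs_sum_le_sum_abs _ _).trans (Finset.sum_le_sum fun j _ => ?_)
    rw [abs_mul]
    exact mul_le_mul_of_nonneg_left (hCg _) (abs_nonneg _)
  have hXm : ∀ i : ℕ, @Measurable Ω ℝ (filt F₀ T (i + a)) _ (X i) := fun i =>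
    (measurable_comp hf.measurable (i + a)).mul
      ((hWm i).mono (filt_mono hF (by omega)) le_rfl)
  have hXb : ∀ i, ∀ ω, |X i ω| ≤ Cf * ∑ j ∈ Finset.range n, |α i j| * Cg := by
    intro i ω
    rw [hX, abs_mul]
    exact mul_le_mul (hCf _) (hWb i ω) (abs_nonneg _) (hCf0 ω)
  have hX2 : ∀ i, MemLp (X i) 2 P := fun i =>
    memLp_two_of_bound ((hXm i).mono (filt_le hF₀ _) le_rfl).aestronglyMeasurable (hXb i)
  have horth : ∀ i j : ℕ, i < j → ∫ ω, X i ω * X j ω ∂P = 0 := by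
    intro i j hij
    have hm : @Measurable Ω ℝ (filt F₀ T ((j + a : ℤ) - 1)) _ (fun ω => X i ω * W j ω) :=
      ((hXm i).mono (filt_mono hF (by omega)) le_rfl).mul (hWm j)
    have h1 := hf.integral_mul_comp_eq_zero hT hm
      (memLp_two_of_bound (C := (Cf * ∑ l ∈ Finset.range n, |α i l| * Cg)
          * ∑ l ∈ Finset.range n, |α j l| * Cg)
        (hm.mono (filt_le hF₀ _) le_rfl).aestronglyMeasurable (fun ω => by
          rw [abs_mul]
          exact mul_le_mul (hXb i ω) (hWb j ω) (abs_nonneg _)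
            ((abs_nonneg _).trans (hXb i ω))))
    rw [← h1]
    congr 1
    ext ω
    simp only [hX]
    ring
  have hsq := integral_sum_sq_of_orthogonal (P := P) (Finset.range n) (X := X) (fun i _ => hX2 i)
    (fun i _ j _ hij => by
      rcases lt_or_gt_of_ne hij with h | h
      · exact horth i j h
      · simp only [mul_comm (X i _)]
        exact horth j i h)
  refine ⟨memLp_finsetSum _ fun i _ => hX2 i, ?_⟩
  rw [hsq]
  calc _ ≤ ∑ i ∈ Finset.range n, Cf ^ 2 * (S * lpNorm g 2 P ^ 2) := by
        refine Finset.sum_le_sum fun i hi => ?_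
        calc _ ≤ ∫ ω, Cf ^ 2 * W i ω ^ 2 ∂P := by
              refine integral_mono_of_nonneg (Eventually.of_forall fun _ => sq_nonneg _) ?_
                (Eventually.of_forall fun ω => ?_)
              · exact (hg.memLp_sum hT n (α i) b).integrable_sq.const_mul _
              · simp only [hX, mul_pow]
                refine mul_le_mul_of_nonneg_right ?_ (sq_nonneg _)
                rw [← sq_abs]
                exact pow_le_pow_left₀ (abs_nonneg _) (hCf _) 2
          _ = Cf ^ 2 * ((∑ j ∈ Finset.range n, α i j ^ 2) * lpNorm g 2 P ^ 2) := by
              rw [integral_const_mul, hg.integral_sum_sq hT hF n (α i) b]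
          _ ≤ _ := by
              gcongr
              refine le_trans (Finset.sum_le_sum fun j _ => ?_) (hS i hi)
              simp only [hα]
              split_ifs
              · exact le_rfl
              · simpa using sq_nonneg _
    _ = _ := by simp

end IsInnovation

end Bounded

/-! ### Banded forms and their diagonal decomposition -/

/-- Row sums of a banded Toeplitz matrix. -/
theorem sum_banded_le {g : ℤ → ℝ} {c : ℝ} {m : ℕ} (hc : ∀ k, g k ≤ c) (hc0 : 0 ≤ c)
    (hg : ∀ k : ℤ, m < k.natAbs → g k = 0) (n : ℕ) (i : ℤ) :
    ∑ j ∈ Finset.range n, g (i - j) ≤ (2 * m + 1) * c := by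
  have h1 : ∑ j ∈ Finset.range n, g (i - j)
      = ∑ j ∈ (Finset.range n).filter (fun j : ℕ => (i - (j : ℤ)).natAbs ≤ m), g (i - j) := by
    rw [Finset.sum_filter]
    refine Finset.sum_congr rfl fun j _ => ?_
    split_ifs with h
    · rfl
    · exact hg _ (not_le.1 h)
  rw [h1]
  refine (Finset.sum_le_card_nsmul _ _ c fun j _ => hc _).trans ?_
  rw [nsmul_eq_mul]
  refine mul_le_mul_of_nonneg_right ?_ hc0
  have h2 : (Finset.filter (fun j : ℕ => (i - (j : ℤ)).natAbs ≤ m) (Finset.range n)).card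
      ≤ (Finset.Icc (-(m : ℤ)) m).card := by
    refine Finset.card_le_card_of_injOn (fun j : ℕ => i - (j : ℤ)) ?_ ?_
    · intro j hj
      simp only [Finset.coe_filter, Set.mem_ofPred_eq] at hj
      simp only [Finset.coe_Icc, Set.mem_Icc]
      omega
    · intro x _ y _ hxy
      simp only at hxy
      omega
  rw [Int.card_Icc] at h2
  have h3 : (Finset.filter (fun j : ℕ => (i - (j : ℤ)).natAbs ≤ m) (Finset.range n)).card
      ≤ 2 * m + 1 := by omega
  exact_mod_cast h3

/-- Splitting a Toeplitz form in two shifted sequences along the diagonal. -/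
theorem toeplitzForm_split (n : ℕ) (w : ℤ → ℝ) (p q : ℕ → ℝ) (a b : ℤ) :
    toeplitzForm n w p q
      = (∑ i ∈ Finset.range n, p i * ∑ j ∈ Finset.range n,
          (if (j : ℤ) + b < i + a then w ((i : ℤ) - j) else 0) * q j)
        + (∑ j ∈ Finset.range n, q j * ∑ i ∈ Finset.range n,
          (if (i : ℤ) + a < j + b then w (-((j : ℤ) - i)) else 0) * p i)
        + ∑ i ∈ Finset.range n, ∑ j ∈ Finset.range n,
          if (i : ℤ) + a = j + b then w (b - a) * (p i * q j) else 0 := by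
  simp only [Finset.mul_sum]
  rw [Finset.sum_comm (f := fun (j i : ℕ) => q j *
    ((if (i : ℤ) + a < j + b then w (-((j : ℤ) - i)) else 0) * p i))]
  unfold toeplitzForm
  simp only [← Finset.sum_add_distrib]
  refine Finset.sum_congr rfl fun i _ => Finset.sum_congr rfl fun j _ => ?_
  rcases lt_trichotomy ((i : ℤ) + a) (j + b) with h | h | h
  · rw [if_neg (by omega), if_pos h, if_neg (by omega), show -((j : ℤ) - i) = i - j by ring]
    ring
  · rw [if_neg (by omega), if_neg (by omega), if_pos h, show b - a = (i : ℤ) - j by omega]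
    ring
  · rw [if_pos h, if_neg (by omega), if_neg (by omega)]
    ring

/-- The diagonal part, up to a boundary term. -/
theorem abs_diagonal_sub_le (n : ℕ) (F : ℤ → ℝ) {C : ℝ} (hC : ∀ k, |F k| ≤ C) (a b : ℤ) :
    |(∑ i ∈ Finset.range n, ∑ j ∈ Finset.range n, if (i : ℤ) + a = j + b then F (i + a) else 0)
      - ∑ i ∈ Finset.range n, F (i + a)| ≤ (a - b).natAbs * C := by
  have hC0 : 0 ≤ C := (abs_nonneg _).trans (hC 0)
  have h1 : ∀ i ∈ Finset.range n, (∑ j ∈ Finset.range n,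
      if (i : ℤ) + a = j + b then F (i + a) else 0)
      = if 0 ≤ (i : ℤ) + a - b ∧ (i : ℤ) + a - b < n then F (i + a) else 0 := by
    intro i _
    split_ifs with h
    · rw [Finset.sum_eq_single ((i : ℤ) + a - b).toNat]
      · rw [if_pos (by omega)]
      · intro j _ hj
        rw [if_neg (by omega)]
      · intro hj
        simp only [Finset.mem_range] at hj
        omega
    · refine Finset.sum_eq_zero fun j hj => ?_
      rw [Finset.mem_range] at hj
      rw [if_neg (by omega)]
  rw [Finset.sum_congr rfl h1, ← Finset.sum_sub_distrib]
  have h2 : ∑ i ∈ Finset.range n, ((if 0 ≤ (i : ℤ) + a - b ∧ (i : ℤ) + a - b < n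
      then F (i + a) else 0) - F (i + a))
      = ∑ i ∈ Finset.range n with ¬ (0 ≤ ((i : ℕ) : ℤ) + a - b ∧ ((i : ℕ) : ℤ) + a - b < n),
        -F (i + a) := by
    rw [Finset.sum_filter]
    refine Finset.sum_congr rfl fun i _ => ?_
    by_cases h : 0 ≤ (i : ℤ) + a - b ∧ (i : ℤ) + a - b < n
    · rw [if_pos h, if_neg (not_not.2 h), sub_self]
    · rw [if_neg h, if_pos h, zero_sub]
  rw [h2]
  refine (Finset.abs_sum_le_sum_abs _ _).trans ?_
  refine (Finset.sum_le_card_nsmul _ _ C fun i _ => by rw [abs_neg]; exact hC _).trans ?_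
  rw [nsmul_eq_mul]
  refine mul_le_mul_of_nonneg_right ?_ hC0
  norm_cast
  -- The indices lost at the boundary are the last `|a - b|` ones if `a ≥ b` and the first ones
  -- otherwise.
  rcases le_total 0 (a - b) with h | h
  · refine (Finset.card_le_card (t := Finset.Ico (n - (a - b).natAbs) n) fun i hi => ?_).trans ?_
    · simp only [Finset.mem_filter, Finset.mem_range] at hi
      simp only [Finset.mem_Ico]
      omega
    · rw [Nat.card_Ico]
      omega
  · refine (Finset.card_le_card (t := Finset.range (a - b).natAbs) fun i hi => ?_).trans ?_
    · simp only [Finset.mem_filter, Finset.mem_range] at hi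
      simp only [Finset.mem_range]
      omega
    · rw [Finset.card_range]

section Innovations

variable {Ω : Type*} {F₀ : MeasurableSpace Ω} [mΩ : MeasurableSpace Ω] {P : Measure Ω}
  [IsProbabilityMeasure P] {T : Ω ≃ᵐ Ω}

namespace IsInnovation

variable {f g : Ω → ℝ}

/-- The form splits at equal times `i + a = j + b`. The two off-diagonal parts have second moments
`O(n (2m+1))`, which is `o(n²)` because `m/n → 0`. At equal times the lag is `b - a`, so the
diagonal carries one weight only and is an ergodic average of `f g` up to boundary terms. -/
theorem tendsto_toeplitzForm_of_bounded (hT : MeasurePreserving T P P) (hF₀ : F₀ ≤ mΩ)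
    (hF : F₀ ≤ F₀.comap T)
    (hbot : ∀ A : Set Ω, MeasurableSet[⨅ i : ℤ, filt F₀ T i] A → P A = 0 ∨ P A = 1)
    (hf : IsInnovation F₀ P T f) (hg : IsInnovation F₀ P T g)
    {Cf Cg : ℝ} (hCf : ∀ ω, |f ω| ≤ Cf) (hCg : ∀ ω, |g ω| ≤ Cg)
    {w : ℕ → ℤ → ℝ} {B : ℝ} (hB : ∀ n k, |w n k| ≤ B) {m : ℕ → ℕ}
    (hm : ∀ n (k : ℤ), m n < k.natAbs → w n k = 0)
    (hmn : Tendsto (fun n : ℕ => (m n : ℝ) / n) atTop (𝓝 0)) (a b : ℤ) {ρ : ℝ}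
    (hρ : Tendsto (fun n => w n (b - a)) atTop (𝓝 ρ)) :
    Tendsto (fun n : ℕ => ∫ ω, |(1 / (n : ℝ)) * toeplitzForm n (w n)
      (fun i => f (iter T (i + a) ω)) (fun j => g (iter T (j + b) ω))
        - ρ * ∫ ω, f ω * g ω ∂P| ∂P) atTop (𝓝 0) := by
  set φ : Ω → ℝ := fun ω => f ω * g ω with hφ
  set e := ∫ ω, φ ω ∂P with he
  have hφm : @Measurable Ω ℝ F₀ _ φ := hf.measurable.mul hg.measurable
  have hφb : ∀ ω, |φ ω| ≤ Cf * Cg := fun ω => by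
    rw [hφ, abs_mul]
    exact mul_le_mul (hCf ω) (hCg ω) (abs_nonneg _) ((abs_nonneg _).trans (hCf ω))
  have hφint : Integrable φ P := hf.memLp.integrable_mul hg.memLp
  have hB0 : 0 ≤ B := (abs_nonneg _).trans (hB 0 0)
  have hrow : ∀ n, ∀ i : ℤ, ∑ j ∈ Finset.range n, w n (i - j) ^ 2 ≤ (2 * m n + 1) * B ^ 2 := by
    intro n i
    refine sum_banded_le (g := fun k => w n k ^ 2) (fun k => ?_) (sq_nonneg _) (fun k hk => ?_) n i
    · rw [← sq_abs]
      exact pow_le_pow_left₀ (abs_nonneg _) (hB n k) 2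
    · simp [hm n k hk]
  have hrow' : ∀ n, ∀ i : ℤ, ∑ j ∈ Finset.range n, w n (-(i - j)) ^ 2 ≤ (2 * m n + 1) * B ^ 2 := by
    intro n i
    refine sum_banded_le (g := fun k => w n (-k) ^ 2) (fun k => ?_) (sq_nonneg _)
      (fun k hk => ?_) n i
    · rw [← sq_abs]
      exact pow_le_pow_left₀ (abs_nonneg _) (hB n _) 2
    · simp [hm n (-k) (by simpa using hk)]
  set avg : ℕ → ℝ := fun n => ∫ ω, |(1 / (n : ℝ)) * (∑ i ∈ Finset.range n, φ (iter T (i + a) ω))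
      - e| ∂P with havg
  have havg0 : Tendsto avg atTop (𝓝 0) :=
    tendsto_integral_abs_average_sub hT hF₀ hF hbot hφm hφb a
  set b1 : ℕ → ℝ := fun n => √((2 * (m n / n : ℝ) + 1 / n) * (Cf ^ 2 * (B ^ 2 * lpNorm g 2 P ^ 2)))
    with hb1
  set b2 : ℕ → ℝ := fun n => √((2 * (m n / n : ℝ) + 1 / n) * (Cg ^ 2 * (B ^ 2 * lpNorm f 2 P ^ 2)))
    with hb2
  set b3 : ℕ → ℝ := fun n => 1 / (n : ℝ) * (B * ((a - b).natAbs * (Cf * Cg))) + B * avg n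
    + |w n (b - a) - ρ| * |e| with hb3
  have hlim : Tendsto (fun n => b1 n + b2 n + b3 n) atTop (𝓝 0) := by
    have h1n : Tendsto (fun n : ℕ => 1 / (n : ℝ)) atTop (𝓝 0) := tendsto_one_div_atTop_nhds_zero_nat
    have h0 : Tendsto (fun n : ℕ => 2 * (m n / n : ℝ) + 1 / n) atTop (𝓝 0) := by
      simpa using (hmn.const_mul 2).add h1n
    have e1 : Tendsto b1 atTop (𝓝 0) := by
      have := (h0.mul_const (Cf ^ 2 * (B ^ 2 * lpNorm g 2 P ^ 2))).sqrt
      rwa [zero_mul, Real.sqrt_zero] at this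
    have e2 : Tendsto b2 atTop (𝓝 0) := by
      have := (h0.mul_const (Cg ^ 2 * (B ^ 2 * lpNorm f 2 P ^ 2))).sqrt
      rwa [zero_mul, Real.sqrt_zero] at this
    have e3 : Tendsto b3 atTop (𝓝 0) := by
      have h2 : Tendsto (fun n => |w n (b - a) - ρ|) atTop (𝓝 0) := by
        simpa using (hρ.sub_const ρ).abs
      have := ((h1n.mul_const (B * ((a - b).natAbs * (Cf * Cg)))).add
        (havg0.const_mul B)).add (h2.mul_const |e|)
      rwa [zero_mul, mul_zero, zero_mul, add_zero, add_zero] at this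
    simpa using (e1.add e2).add e3
  refine squeeze_zero' (Eventually.of_forall fun n => integral_nonneg fun _ => abs_nonneg _) ?_ hlim
  filter_upwards [eventually_gt_atTop 0] with n hn
  have hn' : (0 : ℝ) < n := by exact_mod_cast hn
  obtain ⟨hU2, hUi⟩ := integral_sq_upper_le hT hF₀ hF hf hg hCf hCg n (w n)
    (fun i _ => hrow n i) a b
  -- The lower part is an upper part with `f` and `g` exchanged and the lag reflected.
  obtain ⟨hL2, hLi⟩ := integral_sq_upper_le hT hF₀ hF hg hf hCg hCf n (fun k => w n (-k))
    (fun i _ => hrow' n i) b a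
  set U : Ω → ℝ := fun ω => ∑ i ∈ Finset.range n, f (iter T (i + a) ω) * ∑ j ∈ Finset.range n,
      (if (j : ℤ) + b < i + a then w n ((i : ℤ) - j) else 0) * g (iter T (j + b) ω) with hU
  set L : Ω → ℝ := fun ω => ∑ j ∈ Finset.range n, g (iter T (j + b) ω) * ∑ i ∈ Finset.range n,
      (if (i : ℤ) + a < j + b then w n (-((j : ℤ) - i)) else 0) * f (iter T (i + a) ω) with hL
  set A : Ω → ℝ := fun ω => |(1 / (n : ℝ)) * (∑ i ∈ Finset.range n, φ (iter T (i + a) ω)) - e|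
    with hA
  have hAint : Integrable A P := by
    refine Integrable.abs (Integrable.sub (Integrable.const_mul ?_ _) (integrable_const _))
    exact integrable_finsetSum _ fun i _ =>
      (measurePreserving_iter hT _).integrable_comp_of_integrable hφint
  have hpt : ∀ ω, |(1 / (n : ℝ)) * toeplitzForm n (w n)
      (fun i => f (iter T (i + a) ω)) (fun j => g (iter T (j + b) ω)) - ρ * e|
      ≤ 1 / n * |U ω| + 1 / n * |L ω| + (1 / (n : ℝ) * (B * ((a - b).natAbs * (Cf * Cg))) + B * A ω
    + |w n (b - a) - ρ| * |e|) := by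
    intro ω
    rw [toeplitzForm_split n (w n) _ _ a b]
    change |1 / (n : ℝ) * (U ω + L ω + _) - _| ≤ _
    have hD := abs_diagonal_sub_le n (fun k => φ (iter T k ω)) (fun k => hφb _) a b
    have hDeq : (∑ i ∈ Finset.range n, ∑ j ∈ Finset.range n,
          if (i : ℤ) + a = j + b then w n (b - a) * (f (iter T (i + a) ω) * g (iter T (j + b) ω))
            else 0)
        = w n (b - a) * ∑ i ∈ Finset.range n, ∑ j ∈ Finset.range n,
          if (i : ℤ) + a = j + b then φ (iter T (i + a) ω) else 0 := by
      simp only [Finset.mul_sum]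
      refine Finset.sum_congr rfl fun i _ => Finset.sum_congr rfl fun j _ => ?_
      split_ifs with h
      · simp only [hφ, h]
      · simp
    rw [hDeq]
    beta_reduce at hD
    set D := ∑ i ∈ Finset.range n, ∑ j ∈ Finset.range n,
          if (i : ℤ) + a = j + b then φ (iter T (i + a) ω) else 0
    set S := ∑ i ∈ Finset.range n, φ (iter T (i + a) ω)
    have hdec : 1 / (n : ℝ) * (U ω + L ω + w n (b - a) * D) - ρ * e
        = 1 / n * U ω + 1 / n * L ω + (1 / n * (w n (b - a) * (D - S))
          + w n (b - a) * (1 / n * S - e) + (w n (b - a) - ρ) * e) := by ring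
    rw [hdec]
    have hn1 : (0 : ℝ) ≤ 1 / n := by positivity
    refine (abs_add_le _ _).trans (add_le_add ((abs_add_le _ _).trans (add_le_add ?_ ?_))
      ((abs_add_le _ _).trans (add_le_add ((abs_add_le _ _).trans (add_le_add ?_ ?_)) ?_)))
    · rw [abs_mul, abs_of_nonneg hn1]
    · rw [abs_mul, abs_of_nonneg hn1]
    · rw [abs_mul, abs_of_nonneg hn1, abs_mul]
      exact mul_le_mul_of_nonneg_left (mul_le_mul (hB _ _) hD (abs_nonneg _) hB0) hn1
    · rw [abs_mul]
      exact mul_le_mul_of_nonneg_right (hB _ _) (abs_nonneg _)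
    · rw [abs_mul]
  have hUI : Integrable U P := hU2.integrable one_le_two
  have hLI : Integrable L P := hL2.integrable one_le_two
  have h1 : 1 / n * ∫ ω, |U ω| ∂P ≤ b1 n := by
    have := (integral_abs_le_lpNorm_two hU2).trans (le_of_eq (lpNorm_two_eq_sqrt hU2.1))
    rw [hb1]
    calc _ ≤ 1 / n * √(n * (Cf ^ 2 * ((2 * m n + 1) * B ^ 2 * lpNorm g 2 P ^ 2))) := by
          gcongr
          exact this.trans (Real.sqrt_le_sqrt hUi)
      _ = √((1 / n) ^ 2 * (n * (Cf ^ 2 * ((2 * m n + 1) * B ^ 2 * lpNorm g 2 P ^ 2)))) := by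
          rw [Real.sqrt_mul (sq_nonneg _), Real.sqrt_sq (by positivity)]
      _ = _ := by
          congr 1
          field_simp
  have h2 : 1 / n * ∫ ω, |L ω| ∂P ≤ b2 n := by
    have := (integral_abs_le_lpNorm_two hL2).trans (le_of_eq (lpNorm_two_eq_sqrt hL2.1))
    rw [hb2]
    calc _ ≤ 1 / n * √(n * (Cg ^ 2 * ((2 * m n + 1) * B ^ 2 * lpNorm f 2 P ^ 2))) := by
          gcongr
          exact this.trans (Real.sqrt_le_sqrt hLi)
      _ = √((1 / n) ^ 2 * (n * (Cg ^ 2 * ((2 * m n + 1) * B ^ 2 * lpNorm f 2 P ^ 2)))) := by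
          rw [Real.sqrt_mul (sq_nonneg _), Real.sqrt_sq (by positivity)]
      _ = _ := by
          congr 1
          field_simp
  have hR1 : Integrable (fun ω => 1 / (n : ℝ) * |U ω| + 1 / n * |L ω|) P :=
    (hUI.abs.const_mul _).add (hLI.abs.const_mul _)
  have hR2 : Integrable (fun ω => 1 / (n : ℝ) * (B * ((a - b).natAbs * (Cf * Cg))) + B * A ω
    + |w n (b - a) - ρ| * |e|) P :=
    ((integrable_const _).add (hAint.const_mul _)).add (integrable_const _)
  calc _ ≤ ∫ ω, (1 / n * |U ω| + 1 / n * |L ω| + (1 / (n : ℝ) * (B * ((a - b).natAbs * (Cf * Cg)))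
        + B * A ω + |w n (b - a) - ρ| * |e|)) ∂P :=
        integral_mono_of_nonneg (Eventually.of_forall fun _ => abs_nonneg _) (hR1.add hR2)
          (Eventually.of_forall hpt)
    _ = 1 / n * ∫ ω, |U ω| ∂P + 1 / n * ∫ ω, |L ω| ∂P + b3 n := by
        rw [integral_add hR1 hR2, integral_add (hUI.abs.const_mul _) (hLI.abs.const_mul _),
          integral_const_mul, integral_const_mul,
          integral_add (f := fun ω => 1 / (n : ℝ) * (B * ((a - b).natAbs * (Cf * Cg))) + B * A ω)
            ((integrable_const _).add (hAint.const_mul _)) (integrable_const _),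
          integral_add (integrable_const _) (hAint.const_mul _), integral_const_mul]
        simp [hb3, havg, hA, integral_const_mul]
    _ ≤ _ := by linarith

/-- Truncation: bounded innovations are dense. -/
theorem exists_bounded (hF₀ : F₀ ≤ mΩ) (hF : F₀ ≤ F₀.comap T) (hf : IsInnovation F₀ P T f)
    {δ : ℝ} (hδ : 0 < δ) : ∃ f' : Ω → ℝ, IsInnovation F₀ P T f' ∧ (∃ C, ∀ ω, |f' ω| ≤ C) ∧
      lpNorm (fun ω => f ω - f' ω) 2 P ≤ δ := by
  have hfm : Measurable f := hf.measurable.mono hF₀ le_rfl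
  have hlim : Tendsto (fun M : ℕ => ∫ ω, (f ω - if |f ω| ≤ M then f ω else 0) ^ 2 ∂P) atTop
      (𝓝 0) := by
    have h0 : (0 : ℝ) = ∫ _ : Ω, (0 : ℝ) ∂P := by simp
    rw [h0]
    refine tendsto_integral_of_dominated_convergence (fun ω => f ω ^ 2) (fun M => ?_)
      hf.memLp.integrable_sq (fun M => Eventually.of_forall fun ω => ?_)
      (Eventually.of_forall fun ω => ?_)
    · exact ((hfm.sub (Measurable.ite (measurableSet_le hfm.abs measurable_const) hfm
        measurable_const)).pow_const 2).aestronglyMeasurable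
    · split_ifs
      · simpa using sq_nonneg (f ω)
      · simp
    · refine tendsto_const_nhds.congr' ?_
      filter_upwards [eventually_ge_atTop ⌈|f ω|⌉₊] with M hM
      rw [if_pos ((Nat.le_ceil _).trans (by exact_mod_cast hM))]
      simp
  obtain ⟨M, hM⟩ := ((tendsto_order.1 hlim).2 ((δ / 2) ^ 2) (by positivity)).exists
  set g : Ω → ℝ := fun ω => if |f ω| ≤ M then f ω else 0 with hg
  have hgm : @Measurable Ω ℝ F₀ _ g :=
    (Measurable.ite (measurableSet_le measurable_abs measurable_const) measurable_id
      measurable_const : Measurable fun t : ℝ => if |t| ≤ M then t else 0).comp hf.measurable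
  have hgb : ∀ ω, |g ω| ≤ M := by
    intro ω
    simp only [hg]
    split_ifs with h
    · exact h
    · simp
  have hg2 : MemLp g 2 P := memLp_two_of_bound (hgm.mono hF₀ le_rfl).aestronglyMeasurable hgb
  have hle : filt F₀ T (-1) ≤ mΩ := filt_le hF₀ _
  -- Truncation destroys orthogonality to the past, so the conditional mean must be subtracted;
  -- clamping gives a version bounded everywhere.
  set h : Ω → ℝ := fun ω => max (-M) (min M (P[g | filt F₀ T (-1)] ω)) with hh
  have hhm : @Measurable Ω ℝ (filt F₀ T (-1)) _ h :=
    measurable_const.max (measurable_const.min stronglyMeasurable_condExp.measurable)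
  have hhb : ∀ ω, |h ω| ≤ M := by
    intro ω
    have : (0 : ℝ) ≤ M := Nat.cast_nonneg M
    rw [abs_le]
    exact ⟨le_max_left _ _, max_le (by linarith) (min_le_left _ _)⟩
  have hhe : h =ᵐ[P] P[g | filt F₀ T (-1)] := by
    filter_upwards [ae_bdd_norm_condExp_of_ae_bdd_norm (m := filt F₀ T (-1)) (R := (M : ℝ))
      (f := g) (μ := P) (Eventually.of_forall hgb)] with ω hω
    rw [Real.norm_eq_abs, abs_le] at hω
    simp only [hh]
    rw [min_eq_right hω.2, max_eq_right hω.1]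
  have hh2 : MemLp h 2 P := memLp_two_of_bound (hhm.mono hle le_rfl).aestronglyMeasurable hhb
  have hYg : ∀ Y : Ω → ℝ, @Measurable Ω ℝ (filt F₀ T (-1)) _ Y → MemLp Y 2 P →
      ∫ ω, Y ω * g ω ∂P = ∫ ω, Y ω * h ω ∂P := by
    intro Y hY hY2
    have h2 := condExp_mul_of_stronglyMeasurable_left (μ := P) (m := filt F₀ T (-1))
      (f := Y) (g := g) hY.stronglyMeasurable (hY2.integrable_mul hg2) (hg2.integrable one_le_two)
    calc _ = ∫ ω, P[Y * g | filt F₀ T (-1)] ω ∂P := by rw [integral_condExp hle]; rfl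
      _ = ∫ ω, Y ω * h ω ∂P := by
          refine integral_congr_ae ?_
          filter_upwards [h2, hhe] with ω e1 e2
          rw [e1, Pi.mul_apply, e2]
  have hF₀' : filt F₀ T (-1) ≤ F₀ := by
    have := filt_mono (T := T) hF (show (-1 : ℤ) ≤ 0 by norm_num)
    rwa [filt_zero] at this
  refine ⟨fun ω => g ω - h ω, ⟨hgm.sub (hhm.mono hF₀' le_rfl), hg2.sub hh2, ?_⟩,
    ⟨M + M, fun ω => ?_⟩, ?_⟩
  · intro Y hY hY2
    simp only [mul_sub]
    rw [integral_sub (f := fun ω => Y ω * g ω) (g := fun ω => Y ω * h ω)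
      (hY2.integrable_mul hg2) (hY2.integrable_mul hh2), hYg Y hY hY2, sub_self]
  · exact (abs_sub _ _).trans (add_le_add (hgb ω) (hhb ω))
  · have hfg2 : MemLp (fun ω => f ω - g ω) 2 P := hf.memLp.sub hg2
    have hfg : lpNorm (fun ω => f ω - g ω) 2 P ≤ δ / 2 := by
      rw [lpNorm_two_eq_sqrt hfg2.1]
      exact Real.sqrt_le_iff.2 ⟨by positivity, hM.le⟩
    -- As `f` has no component in `L²(𝓕₋₁)`, `h` is the projection of `g - f`, and projections
    -- contract.
    have hhn : lpNorm h 2 P ≤ lpNorm (fun ω => f ω - g ω) 2 P := by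
      have h1 : lpNorm h 2 P ^ 2 ≤ lpNorm h 2 P * lpNorm (fun ω => f ω - g ω) 2 P := by
        rw [lpNorm_two_sq hh2.1]
        have e1 : ∫ ω, h ω ^ 2 ∂P = - ∫ ω, h ω * (f ω - g ω) ∂P := by
          simp only [mul_sub]
          rw [integral_sub (f := fun ω => h ω * f ω) (g := fun ω => h ω * g ω)
            (hh2.integrable_mul hf.memLp) (hh2.integrable_mul hg2), hf.orthogonal h hhm hh2,
            hYg h hhm hh2]
          simp [sq]
        rw [e1]
        exact (neg_le_abs _).trans (abs_integral_mul_le hh2 hfg2)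
      rcases eq_or_lt_of_le (lpNorm_nonneg (f := h) (p := 2) (μ := P)) with h0 | h0
      · rw [← h0]
        exact lpNorm_nonneg
      · rw [sq] at h1
        exact le_of_mul_le_mul_left h1 h0
    have h3 : (fun ω => f ω - (g ω - h ω)) = (fun ω => f ω - g ω) + h := by
      ext ω
      simp only [Pi.add_apply]
      ring
    rw [h3]
    refine (lpNorm_add_le hfg2 one_le_two).trans ?_
    linarith

end IsInnovation

end Innovations

/-! ### Tapered quadratic forms in innovations -/

theorem toeplitzForm_sub_left (n : ℕ) (w : ℤ → ℝ) (a a' b : ℕ → ℝ) :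
    toeplitzForm n w (fun i => a i - a' i) b = toeplitzForm n w a b - toeplitzForm n w a' b := by
  simp only [toeplitzForm, ← Finset.sum_sub_distrib]
  exact Finset.sum_congr rfl fun i _ => Finset.sum_congr rfl fun j _ => by ring

theorem toeplitzForm_sub_right (n : ℕ) (w : ℤ → ℝ) (a b b' : ℕ → ℝ) :
    toeplitzForm n w a (fun j => b j - b' j) = toeplitzForm n w a b - toeplitzForm n w a b' := by
  simp only [toeplitzForm, ← Finset.sum_sub_distrib]
  exact Finset.sum_congr rfl fun i _ => Finset.sum_congr rfl fun j _ => by ring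

theorem IsKernel.exists_bound {K : ℝ → ℝ} (hK : IsKernel K) :
    ∃ B A : ℝ, 0 ≤ A ∧ (∀ u, |K u| ≤ B) ∧ ∀ u, A < |u| → K u = 0 := by
  obtain ⟨B, hB⟩ := hK.hasCompactSupport.exists_bound_of_continuous hK.continuous
  obtain ⟨A, hA⟩ := hK.hasCompactSupport.isCompact.isBounded.subset_closedBall 0
  refine ⟨B, max A 0, le_max_right _ _, hB, fun u hu => ?_⟩
  by_contra h
  have := hA (subset_tsupport K h)
  rw [mem_closedBall_zero_iff, Real.norm_eq_abs] at this
  exact absurd this (not_le.2 ((le_max_left _ _).trans_lt hu))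

/-- The weights `K(k/h) ∑ uₛ vₜ` (`s - t = k`). -/
noncomputable def taperWeight (K : ℝ → ℝ) (h : ℝ) (n : ℕ) (u v : ℕ → ℝ) (k : ℤ) : ℝ :=
  K (k / h) * lagSum n u v k

/-- Sequences of pairs of vectors in the unit balls of `ℝⁿ` whose lag sums converge to `ρ`. -/
structure LagConvergent (u v : ℕ → ℕ → ℝ) (ρ : ℤ → ℝ) : Prop where
  left : ∀ n, ∑ i ∈ Finset.range n, u n i ^ 2 ≤ 1
  right : ∀ n, ∑ i ∈ Finset.range n, v n i ^ 2 ≤ 1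
  tendsto : ∀ k, Tendsto (fun n => lagSum n (u n) (v n) k) atTop (𝓝 (ρ k))

theorem LagConvergent.abs_le_one {u v : ℕ → ℕ → ℝ} {ρ : ℤ → ℝ} (H : LagConvergent u v ρ) (k : ℤ) :
    |ρ k| ≤ 1 :=
  le_of_tendsto (H.tendsto k).abs
    (Eventually.of_forall fun n => abs_lagSum_le (H.left n) (H.right n) k)

/-- Compact support of `K` makes the weights banded with width of order `h`; lag sums of unit-ball
vectors are at most `1`, so `B` does not depend on `n`, `u`, `v` or `h`. -/
theorem IsKernel.exists_band {K : ℝ → ℝ} (hK : IsKernel K) :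
    ∃ B A : ℝ, 0 ≤ B ∧ 0 ≤ A ∧ ∀ h : ℝ, 0 < h → ∀ (n : ℕ) (u v : ℕ → ℝ),
      ∑ i ∈ Finset.range n, u i ^ 2 ≤ 1 → ∑ i ∈ Finset.range n, v i ^ 2 ≤ 1 →
      (∀ k, |taperWeight K h n u v k| ≤ B) ∧
      ∀ k : ℤ, ⌊A * h⌋₊ < k.natAbs → taperWeight K h n u v k = 0 := by
  obtain ⟨B, A, hA, hB, h0⟩ := hK.exists_bound
  refine ⟨B, A, (abs_nonneg _).trans (hB 0), hA, fun h hh n u v hu hv => ⟨fun k => ?_, fun k hk => ?_⟩⟩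
  · rw [taperWeight, abs_mul]
    calc _ ≤ B * 1 := mul_le_mul (hB _) (abs_lagSum_le hu hv k) (abs_nonneg _)
          ((abs_nonneg _).trans (hB 0))
      _ = B := mul_one B
  · rw [taperWeight, h0, zero_mul]
    rw [abs_div, abs_of_pos hh, lt_div_iff₀ hh]
    have h1 := (Nat.floor_lt (by positivity)).1 hk
    rwa [Nat.cast_natAbs, Int.cast_abs] at h1

theorem LagConvergent.tendsto_taperWeight {K : ℝ → ℝ} (hK : IsKernel K) {u v : ℕ → ℕ → ℝ}
    {ρ : ℤ → ℝ} (H : LagConvergent u v ρ) {h : ℕ → ℝ} (hh : Tendsto h atTop atTop) (k : ℤ) :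
    Tendsto (fun n => taperWeight K (h n) n (u n) (v n) k) atTop (𝓝 (ρ k)) := by
  have h1 : Tendsto (fun n => (k : ℝ) / h n) atTop (𝓝 0) := hh.const_div_atTop _
  have h2 : Tendsto (fun n => K ((k : ℝ) / h n)) atTop (𝓝 1) := by
    have := (hK.continuous.tendsto 0).comp h1
    rwa [hK.apply_zero] at this
  simpa [taperWeight] using h2.mul (H.tendsto k)

theorem tendsto_floor_div {A : ℝ} (hA : 0 ≤ A) {h : ℕ → ℝ} (hpos : ∀ n, 0 < h n)
    (hhn : Tendsto (fun n : ℕ => h n / n) atTop (𝓝 0)) :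
    Tendsto (fun n : ℕ => (⌊A * h n⌋₊ : ℝ) / n) atTop (𝓝 0) := by
  have h1 := hhn.const_mul A
  rw [mul_zero] at h1
  refine squeeze_zero (fun n => by positivity) (fun n => ?_) h1
  rw [← mul_div_assoc]
  exact div_le_div_of_nonneg_right (Nat.floor_le (mul_nonneg hA (hpos n).le)) (Nat.cast_nonneg n)

section Innovations

variable {Ω : Type*} {F₀ : MeasurableSpace Ω} [mΩ : MeasurableSpace Ω] {P : Measure Ω}
  [IsProbabilityMeasure P] {T : Ω ≃ᵐ Ω}

namespace IsInnovation

variable {f g : Ω → ℝ}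

/-- Convergence of tapered quadratic forms in two innovations. -/
theorem tendsto_toeplitzForm (hT : MeasurePreserving T P P) (hF₀ : F₀ ≤ mΩ)
    (hF : F₀ ≤ F₀.comap T)
    (hbot : ∀ A : Set Ω, MeasurableSet[⨅ i : ℤ, filt F₀ T i] A → P A = 0 ∨ P A = 1)
    (hf : IsInnovation F₀ P T f) (hg : IsInnovation F₀ P T g)
    {K : ℝ → ℝ} (hK : IsKernel K) {u v : ℕ → ℕ → ℝ} {ρ : ℤ → ℝ} (H : LagConvergent u v ρ)
    {h : ℕ → ℝ} (hpos : ∀ n, 0 < h n) (hh : Tendsto h atTop atTop)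
    (hhn : Tendsto (fun n : ℕ => h n / n) atTop (𝓝 0)) (a b : ℤ) :
    Tendsto (fun n : ℕ => ∫ ω, |(1 / (n : ℝ)) * toeplitzForm n (taperWeight K (h n) n (u n) (v n))
      (fun i => f (iter T (i + a) ω)) (fun j => g (iter T (j + b) ω))
        - ρ (b - a) * ∫ ω, f ω * g ω ∂P| ∂P) atTop (𝓝 0) := by
  obtain ⟨κ, hκ, hKκ⟩ := hK.exists_cos_transform
  obtain ⟨B, A, hB0, hA, hband⟩ := hK.exists_band
  set c := 2 * (∫ ξ, |κ ξ|) + 1 with hc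
  have hc0 : 0 < c := by
    have : 0 ≤ ∫ ξ, |κ ξ| := integral_nonneg fun _ => abs_nonneg _
    linarith
  rw [tendsto_order]
  refine ⟨fun η hη => Eventually.of_forall fun n =>
    hη.trans_le (integral_nonneg fun _ => abs_nonneg _), fun η hη => ?_⟩
  set N := lpNorm f 2 P + lpNorm g 2 P + 1 with hN
  have hf0 : 0 ≤ lpNorm f 2 P := lpNorm_nonneg
  have hg0 : 0 ≤ lpNorm g 2 P := lpNorm_nonneg
  have hN0 : 0 < N := by positivity
  -- The bound `δ ≤ 1` keeps `‖f'‖ ≤ ‖f‖ + 1`, and the other bound makes the total approximation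
  -- error `c * t` at most `η / 4`. The summand `1` in `c` pays for the change of the limit from `e`
  -- to `e'`.
  set δ := min 1 (η / (4 * c * N)) with hδ
  have hδ0 : 0 < δ := lt_min one_pos (by positivity)
  obtain ⟨f', hf', ⟨Cf, hCf⟩, hff'⟩ := hf.exists_bounded hF₀ hF hδ0
  obtain ⟨g', hg', ⟨Cg, hCg⟩, hgg'⟩ := hg.exists_bounded hF₀ hF hδ0
  have hlim := tendsto_toeplitzForm_of_bounded hT hF₀ hF hbot hf' hg' hCf hCg
    (w := fun n => taperWeight K (h n) n (u n) (v n)) (B := B) (m := fun n => ⌊A * h n⌋₊)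
    (fun n k => (hband (h n) (hpos n) n _ _ (H.left n) (H.right n)).1 k)
    (fun n k hk => (hband (h n) (hpos n) n _ _ (H.left n) (H.right n)).2 k hk)
    (tendsto_floor_div hA hpos hhn) a b (H.tendsto_taperWeight hK hh (b - a))
  filter_upwards [(tendsto_order.1 hlim).2 (η / 2) (by positivity), eventually_gt_atTop 0]
    with n hn hn0
  have hn' : (0 : ℝ) < n := by exact_mod_cast hn0
  have hf'n : lpNorm f' 2 P ≤ lpNorm f 2 P + 1 := by
    have h1 : f' = f - (fun ω => f ω - f' ω) := by
      ext ω
      simp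
    have h2 : lpNorm f' 2 P ≤ lpNorm f 2 P + lpNorm (fun ω => f ω - f' ω) 2 P := by
      conv_lhs => rw [h1]
      exact lpNorm_sub_le hf.memLp one_le_two
    exact h2.trans (by gcongr; exact hff'.trans (min_le_left _ _))
  set w := taperWeight K (h n) n (u n) (v n) with hw
  set q : (Ω → ℝ) → (Ω → ℝ) → Ω → ℝ := fun f g ω => toeplitzForm n w
      (fun i => f (iter T (i + a) ω)) (fun j => g (iter T (j + b) ω)) with hq
  have hqint : ∀ f g : Ω → ℝ, MemLp f 2 P → MemLp g 2 P → Integrable (q f g) P :=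
    fun f g hf hg => integrable_toeplitzForm hT hf hg n w a b
  have hqle : ∀ f g : Ω → ℝ, IsInnovation F₀ P T f → IsInnovation F₀ P T g →
      1 / (n : ℝ) * ∫ ω, |q f g ω| ∂P ≤ 2 * (∫ ξ, |κ ξ|) * (lpNorm f 2 P * lpNorm g 2 P) := by
    intro f g hf hg
    have := hf.integral_abs_toeplitzForm_le hT hF₀ hF hg (H.left n) (H.right n) hκ hKκ (h n) a b
    calc _ ≤ 1 / (n : ℝ) * (2 * (∫ ξ, |κ ξ|) * (n * (lpNorm f 2 P * lpNorm g 2 P))) :=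
          mul_le_mul_of_nonneg_left this (by positivity)
      _ = _ := by field_simp
  set fd : Ω → ℝ := fun ω => f ω - f' ω with hfd
  set gd : Ω → ℝ := fun ω => g ω - g' ω with hgd
  have hfd' : IsInnovation F₀ P T fd := hf.sub hf'
  have hgd' : IsInnovation F₀ P T gd := hg.sub hg'
  set e := ∫ ω, f ω * g ω ∂P with he
  set e' := ∫ ω, f' ω * g' ω ∂P with he'
  set t := lpNorm fd 2 P * lpNorm g 2 P + lpNorm f' 2 P * lpNorm gd 2 P with ht
  have hee' : |e - e'| ≤ t := abs_integral_mul_sub_le hf.memLp hf'.memLp hg.memLp hg'.memLp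
  have htle : c * t ≤ η / 4 := by
    have h1 : t ≤ δ * N := by
      have e1 : lpNorm fd 2 P * lpNorm g 2 P ≤ δ * lpNorm g 2 P :=
        mul_le_mul_of_nonneg_right hff' hg0
      have e2 : lpNorm f' 2 P * lpNorm gd 2 P ≤ (lpNorm f 2 P + 1) * δ :=
        mul_le_mul hf'n hgg' lpNorm_nonneg (by positivity)
      rw [ht, hN]
      linarith
    have h2 : δ ≤ η / (4 * c * N) := min_le_right _ _
    calc c * t ≤ c * (η / (4 * c * N) * N) := by
          refine mul_le_mul_of_nonneg_left (h1.trans ?_) hc0.le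
          exact mul_le_mul_of_nonneg_right h2 hN0.le
      _ = η / 4 := by field_simp
  have hpt : ∀ ω, |1 / (n : ℝ) * q f g ω - ρ (b - a) * e| ≤ 1 / (n : ℝ) * |q fd g ω|
      + 1 / (n : ℝ) * |q f' gd ω| + (|1 / (n : ℝ) * q f' g' ω - ρ (b - a) * e'| + |e - e'|) := by
    intro ω
    have h1 : q fd g ω = q f g ω - q f' g ω := toeplitzForm_sub_left ..
    have h2 : q f' gd ω = q f' g ω - q f' g' ω := toeplitzForm_sub_right ..
    have h3 : 1 / (n : ℝ) * q f g ω - ρ (b - a) * e = 1 / (n : ℝ) * q fd g ω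
        + 1 / (n : ℝ) * q f' gd ω + ((1 / (n : ℝ) * q f' g' ω - ρ (b - a) * e')
          + -(ρ (b - a) * (e - e'))) := by
      rw [h1, h2]
      ring
    rw [h3]
    have hn1 : (0 : ℝ) ≤ 1 / n := by positivity
    refine (abs_add_le _ _).trans (add_le_add ((abs_add_le _ _).trans (add_le_add ?_ ?_))
      ((abs_add_le _ _).trans (add_le_add le_rfl ?_)))
    · rw [abs_mul, abs_of_nonneg hn1]
    · rw [abs_mul, abs_of_nonneg hn1]
    · rw [abs_neg, abs_mul]
      exact mul_le_of_le_one_left (abs_nonneg _) (H.abs_le_one _)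
  have hI1 : Integrable (fun ω => 1 / (n : ℝ) * |q fd g ω|) P :=
    (hqint _ _ hfd'.memLp hg.memLp).abs.const_mul _
  have hI2 : Integrable (fun ω => 1 / (n : ℝ) * |q f' gd ω|) P :=
    (hqint _ _ hf'.memLp hgd'.memLp).abs.const_mul _
  have hI3 : Integrable (fun ω => |1 / (n : ℝ) * q f' g' ω - ρ (b - a) * e'|) P :=
    (((hqint _ _ hf'.memLp hg'.memLp).const_mul _).sub (integrable_const _)).abs
  have hI12 : Integrable (fun ω => 1 / (n : ℝ) * |q fd g ω| + 1 / (n : ℝ) * |q f' gd ω|) P :=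
    hI1.add hI2
  have hI34 : Integrable (fun ω => |1 / (n : ℝ) * q f' g' ω - ρ (b - a) * e'| + |e - e'|) P :=
    hI3.add (integrable_const _)
  have hle : ∫ ω, |1 / (n : ℝ) * q f g ω - ρ (b - a) * e| ∂P
      ≤ 1 / (n : ℝ) * ∫ ω, |q fd g ω| ∂P + 1 / (n : ℝ) * ∫ ω, |q f' gd ω| ∂P
        + (∫ ω, |1 / (n : ℝ) * q f' g' ω - ρ (b - a) * e'| ∂P + |e - e'|) := by
    refine (integral_mono_of_nonneg (Eventually.of_forall fun _ => abs_nonneg _)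
      (hI12.add hI34) (Eventually.of_forall hpt)).trans (le_of_eq ?_)
    simp only [Pi.add_apply]
    rw [integral_add hI12 hI34, integral_add hI1 hI2, integral_add hI3 (integrable_const _),
      integral_const_mul, integral_const_mul]
    simp
  have e1 := hqle _ _ hfd' hg
  have e2 := hqle _ _ hf' hgd'
  have hn2 : ∫ ω, |1 / (n : ℝ) * q f' g' ω - ρ (b - a) * e'| ∂P < η / 2 := hn
  have hct : c * t = 2 * (∫ ξ, |κ ξ|) * (lpNorm fd 2 P * lpNorm g 2 P)
      + 2 * (∫ ξ, |κ ξ|) * (lpNorm f' 2 P * lpNorm gd 2 P) + t := by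
    rw [hc, ht]
    ring
  change ∫ ω, |1 / (n : ℝ) * q f g ω - ρ (b - a) * e| ∂P < η
  linarith

end IsInnovation

end Innovations

/-! ### The martingale decomposition of the error process -/

theorem memLp_err {Ω : Type*} [mΩ : MeasurableSpace Ω] {P : Measure Ω} {T : Ω ≃ᵐ Ω} {ε₀ : Ω → ℝ}
    (hT : MeasurePreserving T P P) (hε : MemLp ε₀ 2 P) (i : ℤ) : MemLp (err T ε₀ i) 2 P :=
  hε.comp_measurePreserving (measurePreserving_iter hT i)

section Decomposition

variable {Ω : Type*} {F₀ : MeasurableSpace Ω} [mΩ : MeasurableSpace Ω] {P : Measure Ω}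
  [IsProbabilityMeasure P] {T : Ω ≃ᵐ Ω} {ε₀ : Ω → ℝ}

/-- Every set of `𝓕ᵢ₊ₛ` is the preimage under `𝕋ˢ` of a set of `𝓕ᵢ`, so the defining integrals match
by change of variables. -/
theorem condExp_comp_iter (hT : MeasurePreserving T P P) (hF₀ : F₀ ≤ mΩ) {Z : Ω → ℝ}
    (hZ : Integrable Z P) (i s : ℤ) :
    (fun ω => P[Z | filt F₀ T i] (iter T s ω))
      =ᵐ[P] P[fun ω => Z (iter T s ω) | filt F₀ T (i + s)] := by
  have hmp := measurePreserving_iter hT s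
  refine ae_eq_condExp_of_forall_setIntegral_eq (filt_le hF₀ _)
    (hmp.integrable_comp_of_integrable hZ) (fun A _ _ => ?_) (fun A hA _ => ?_) ?_
  · exact (hmp.integrable_comp_of_integrable integrable_condExp).integrableOn
  · rw [← comap_filt] at hA
    obtain ⟨B, hB, rfl⟩ := hA
    rw [hmp.setIntegral_preimage_emb (measurableEmbedding_iter s) (P[Z | filt F₀ T i]) B,
      hmp.setIntegral_preimage_emb (measurableEmbedding_iter s) Z B,
      setIntegral_condExp (filt_le hF₀ _) hZ hB]
  · refine StronglyMeasurable.aestronglyMeasurable ?_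
    exact stronglyMeasurable_condExp.comp_measurable (measurable_iter_filt i s)

/-- Increments of conditional expectations are innovations. -/
theorem isInnovation_proj (hF₀ : F₀ ≤ mΩ) (hF : F₀ ≤ F₀.comap T)
    {Z : Ω → ℝ} (hZ : MemLp Z 2 P) : IsInnovation F₀ P T (proj F₀ P T 0 Z) where
  measurable := by
    have h1 := filt_mono (T := T) hF (show (0 - 1 : ℤ) ≤ 0 by norm_num)
    have h2 : @Measurable Ω ℝ (filt F₀ T 0) _ (proj F₀ P T 0 Z) :=
      stronglyMeasurable_condExp.measurable.sub
        (stronglyMeasurable_condExp.measurable.mono h1 le_rfl)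
    rwa [filt_zero] at h2
  memLp := (hZ.condExp one_le_two).sub (hZ.condExp one_le_two)
  orthogonal Y hY hY2 := by
    have key : ∀ i : ℤ, -1 ≤ i → ∫ ω, Y ω * P[Z | filt F₀ T i] ω ∂P = ∫ ω, Y ω * Z ω ∂P := by
      intro i hi
      have h2 := condExp_mul_of_stronglyMeasurable_left (μ := P) (m := filt F₀ T i)
        (f := Y) (g := Z) (hY.mono (filt_mono hF hi) le_rfl).stronglyMeasurable
        (hY2.integrable_mul hZ) (hZ.integrable one_le_two)
      calc _ = ∫ ω, P[Y * Z | filt F₀ T i] ω ∂P := (integral_congr_ae h2).symm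
        _ = _ := by rw [integral_condExp (filt_le hF₀ _)]; rfl
    have hI : ∀ i : ℤ, Integrable (fun ω => Y ω * P[Z | filt F₀ T i] ω) P := fun i =>
      hY2.integrable_mul (hZ.condExp one_le_two)
    simp only [proj, Pi.sub_apply, mul_sub]
    rw [integral_sub (hI _) (hI _), key _ (by norm_num), key _ (by norm_num), sub_self]

variable (F₀ P T ε₀) in
/-- The innovation `P₀(ε_r)`. -/
noncomputable def innov (r : ℤ) : Ω → ℝ := proj F₀ P T 0 (err T ε₀ r)

theorem isInnovation_innov (hT : MeasurePreserving T P P) (hF₀ : F₀ ≤ mΩ) (hF : F₀ ≤ F₀.comap T)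
    (hε : MemLp ε₀ 2 P) (r : ℤ) : IsInnovation F₀ P T (innov F₀ P T ε₀ r) :=
  isInnovation_proj hF₀ hF (memLp_err hT hε r)

/-- By stationarity the shifted innovation is the martingale increment of `ε₀` at time `-r`; this
makes `partialErr` telescope. -/
theorem innov_comp_iter (hT : MeasurePreserving T P P) (hF₀ : F₀ ≤ mΩ) (hε : MemLp ε₀ 2 P)
    (r : ℤ) : (fun ω => innov F₀ P T ε₀ r (iter T (-r) ω))
      =ᵐ[P] P[ε₀ | filt F₀ T (-r)] - P[ε₀ | filt F₀ T (-r - 1)] := by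
  have hI : Integrable (err T ε₀ r) P := (memLp_err hT hε r).integrable one_le_two
  have h1 := condExp_comp_iter hT hF₀ hI 0 (-r)
  have h2 := condExp_comp_iter hT hF₀ hI (0 - 1) (-r)
  have h3 : (fun ω => err T ε₀ r (iter T (-r) ω)) = ε₀ := by
    ext ω
    rw [err, ← iter_add]
    simp [iter_zero]
  rw [h3] at h1 h2
  rw [show (0 : ℤ) + -r = -r by ring] at h1
  rw [show (0 - 1 : ℤ) + -r = -r - 1 by ring] at h2
  filter_upwards [h1, h2] with ω e1 e2
  simp only [innov, proj, Pi.sub_apply, e1, e2]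

variable (F₀ P T ε₀) in
/-- Partial sums of the martingale decomposition of `ε₀`. -/
noncomputable def partialErr (M : ℕ) (ω : Ω) : ℝ :=
  ∑ r ∈ Finset.Icc (-(M : ℤ)) M, innov F₀ P T ε₀ r (iter T (-r) ω)

theorem partialErr_ae_eq (hT : MeasurePreserving T P P) (hF₀ : F₀ ≤ mΩ) (hε : MemLp ε₀ 2 P)
    (M : ℕ) : partialErr F₀ P T ε₀ M
      =ᵐ[P] P[ε₀ | filt F₀ T M] - P[ε₀ | filt F₀ T (-((M + 1 : ℕ) : ℤ))] := by
  have h1 : ∀ᵐ ω ∂P, ∀ r : ℤ, innov F₀ P T ε₀ r (iter T (-r) ω)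
      = P[ε₀ | filt F₀ T (-r)] ω - P[ε₀ | filt F₀ T (-r - 1)] ω :=
    ae_all_iff.2 fun r => innov_comp_iter hT hF₀ hε r
  filter_upwards [h1] with ω hω
  simp only [partialErr, hω, Pi.sub_apply]
  set G : ℤ → ℝ := fun i => P[ε₀ | filt F₀ T i] ω with hG
  change ∑ r ∈ Finset.Icc (-(M : ℤ)) M, (G (-r) - G (-r - 1)) = G M - G (-((M + 1 : ℕ) : ℤ))
  clear_value G
  induction M with
  | zero => simp
  | succ M ih =>
    have h2 : Finset.Icc (-((M + 1 : ℕ) : ℤ)) ((M + 1 : ℕ) : ℤ)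
        = insert (-((M + 1 : ℕ) : ℤ)) (insert ((M + 1 : ℕ) : ℤ) (Finset.Icc (-(M : ℤ)) M)) := by
      ext r
      simp only [Finset.mem_insert, Finset.mem_Icc]
      omega
    rw [h2, Finset.sum_insert, Finset.sum_insert, ih]
    · push_cast
      rw [show (- -((M : ℤ) + 1)) = M + 1 by ring, show ((M : ℤ) + 1 - 1) = M by ring,
        show (-((M : ℤ) + 1) - 1) = -((M : ℤ) + 1 + 1) by ring]
      ring
    · simp
    · simp only [Finset.mem_insert, Finset.mem_Icc]
      omega

theorem memLp_partialErr (hT : MeasurePreserving T P P) (hF₀ : F₀ ≤ mΩ) (hF : F₀ ≤ F₀.comap T)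
    (hε : MemLp ε₀ 2 P) (M : ℕ) : MemLp (partialErr F₀ P T ε₀ M) 2 P :=
  memLp_finsetSum _ fun r _ => (isInnovation_innov hT hF₀ hF hε r).memLp_comp hT (-r)

/-- `L²` convergence of a closed martingale. -/
theorem tendsto_lpNorm_condExp_filt (hF₀ : F₀ ≤ mΩ) (hF : F₀ ≤ F₀.comap T)
    (hε_meas : Measurable[⨆ i : ℤ, filt F₀ T i] ε₀) (hε : MemLp ε₀ 2 P) :
    Tendsto (fun k : ℕ => lpNorm (fun ω => P[ε₀ | filt F₀ T k] ω - ε₀ ω) 2 P) atTop (𝓝 0) := by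
  have hle : ∀ k : ℕ, filt F₀ T k ≤ mΩ := fun k => filt_le hF₀ _
  have : ∀ k : ℕ, Fact (filt F₀ T k ≤ mΩ) := fun k => ⟨hle k⟩
  set x : Lp ℝ 2 P := hε.toLp ε₀ with hx
  set V : ℕ → Submodule ℝ (Lp ℝ 2 P) := fun k => lpMeas ℝ ℝ (filt F₀ T k) 2 P with hV
  have : ∀ k, CompleteSpace (V k) := fun k =>
    inferInstanceAs (CompleteSpace (lpMeas ℝ ℝ (filt F₀ T k) 2 P))
  have hVmono : Monotone V := by
    intro k l hkl g hg
    rw [hV, mem_lpMeas_iff_aestronglyMeasurable] at hg ⊢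
    exact hg.mono (filt_mono hF (by omega))
  have hlim := Submodule.starProjection_tendsto_closure_iSup V hVmono x
  set z := (⨆ k, V k).topologicalClosure.starProjection x with hz
  have hce : ∀ k : ℕ, ((V k).starProjection x : Lp ℝ 2 P) =ᵐ[P] P[ε₀ | filt F₀ T k] :=
    fun k => hε.condExpL2_ae_eq_condExp (𝕜 := ℝ) (hle k)
  have hlimz : Tendsto (fun k : ℕ => eLpNorm (P[ε₀ | filt F₀ T k] - (z : Ω → ℝ)) 2 P) atTop (𝓝 0) := by
    have h1 := (Lp.tendsto_Lp_iff_tendsto_eLpNorm' _ _).1 hlim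
    refine h1.congr fun k => eLpNorm_congr_ae ?_
    filter_upwards [hce k] with ω hω
    simp only [Pi.sub_apply, hω]
  let ℱ : Filtration ℕ mΩ := ⟨fun k => filt F₀ T k, fun k l hkl => filt_mono hF (by omega), hle⟩
  have hsup : (⨆ i : ℤ, filt F₀ T i) ≤ ⨆ k : ℕ, ℱ k :=
    iSup_le fun i => (filt_mono hF (Int.self_le_toNat i)).trans (le_iSup (fun k => ℱ k) i.toNat)
  -- The Hilbert space argument gives an `L²` limit `z` without naming it; Lévy's upward theorem in
  -- `L¹` identifies it with `ε₀`.
  have h1 : Tendsto (fun k : ℕ => eLpNorm (P[ε₀ | filt F₀ T k] - ε₀) 1 P) atTop (𝓝 0) :=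
    (hε.integrable one_le_two).tendsto_eLpNorm_condExp (ℱ := ℱ)
      (hε_meas.mono hsup le_rfl).stronglyMeasurable
  have h2 : Tendsto (fun k : ℕ => eLpNorm (P[ε₀ | filt F₀ T k] - (z : Ω → ℝ)) 1 P) atTop (𝓝 0) := by
    refine tendsto_of_tendsto_of_tendsto_of_le_of_le tendsto_const_nhds hlimz
      (fun _ => zero_le) (fun k => ?_)
    exact eLpNorm_le_eLpNorm_of_exponent_le one_le_two
      (integrable_condExp.1.sub (Lp.aestronglyMeasurable _))
  have hze : z =ᵐ[P] ε₀ := by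
    have h3 : eLpNorm ((z : Ω → ℝ) - ε₀) 1 P ≤ 0 := by
      have h4 : Tendsto (fun k : ℕ => eLpNorm (P[ε₀ | filt F₀ T k] - (z : Ω → ℝ)) 1 P
          + eLpNorm (P[ε₀ | filt F₀ T k] - ε₀) 1 P) atTop (𝓝 0) := by simpa using h2.add h1
      refine ge_of_tendsto h4 (Eventually.of_forall fun k => ?_)
      have h5 : (z : Ω → ℝ) - ε₀ = (P[ε₀ | filt F₀ T k] - ε₀) - (P[ε₀ | filt F₀ T k] - (z : Ω → ℝ)) := by
        ext ω
        simp
      rw [h5, add_comm]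
      exact eLpNorm_sub_le (integrable_condExp.1.sub hε.1)
        (integrable_condExp.1.sub (Lp.aestronglyMeasurable _)) le_rfl
    have h4 := (eLpNorm_eq_zero_iff ((Lp.aestronglyMeasurable z).sub hε.1) one_ne_zero).1
      (le_antisymm h3 zero_le)
    filter_upwards [h4] with ω hω
    exact sub_eq_zero.1 hω
  have h3 : Tendsto (fun k : ℕ => (eLpNorm (P[ε₀ | filt F₀ T k] - (z : Ω → ℝ)) 2 P).toReal) atTop (𝓝 0) := by
    have := (ENNReal.tendsto_toReal ENNReal.zero_ne_top).comp hlimz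
    rw [ENNReal.toReal_zero] at this
    exact this
  refine h3.congr fun k => ?_
  rw [← toReal_eLpNorm (f := fun ω => P[ε₀ | filt F₀ T k] ω - ε₀ ω)
    (integrable_condExp.1.sub hε.1)]
  congr 1
  refine eLpNorm_congr_ae ?_
  filter_upwards [hze] with ω hω
  simp [hω]

/-- After telescoping, the future end converges to `ε₀` because `ε₀` is `𝓕_∞`-measurable, and the
past end to `0` because the tail is trivial and `ε₀` is centred. -/
theorem tendsto_lpNorm_sub_partialErr (hT : MeasurePreserving T P P) (hF₀ : F₀ ≤ mΩ)
    (hF : F₀ ≤ F₀.comap T)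
    (hbot : ∀ A : Set Ω, MeasurableSet[⨅ i : ℤ, filt F₀ T i] A → P A = 0 ∨ P A = 1)
    (hε_meas : Measurable[⨆ i : ℤ, filt F₀ T i] ε₀) (hε : MemLp ε₀ 2 P)
    (hε0 : ∫ ω, ε₀ ω ∂P = 0) :
    Tendsto (fun M : ℕ => lpNorm (fun ω => ε₀ ω - partialErr F₀ P T ε₀ M ω) 2 P) atTop (𝓝 0) := by
  have h1 := tendsto_lpNorm_condExp_filt hF₀ hF hε_meas hε
  have h2 := (tendsto_add_atTop_iff_nat 1).2
    (tendsto_lpNorm_condExp_filt_neg hF₀ hF hbot hε hε0)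
  have h3 := h2.add h1
  rw [add_zero] at h3
  refine squeeze_zero (fun _ => lpNorm_nonneg) (fun M => ?_) h3
  have hM := partialErr_ae_eq hT hF₀ hε M
  have h4 : MemLp (fun ω => P[ε₀ | filt F₀ T M] ω - ε₀ ω) 2 P := (hε.condExp one_le_two).sub hε
  have h5 : MemLp (P[ε₀ | filt F₀ T (-((M + 1 : ℕ) : ℤ))]) 2 P := hε.condExp one_le_two
  refine le_trans (le_of_eq ?_) (lpNorm_sub_le h5 one_le_two (g := fun ω =>
    P[ε₀ | filt F₀ T M] ω - ε₀ ω))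
  rw [← toReal_eLpNorm (h5.sub h4).1,
    ← toReal_eLpNorm (f := fun ω => ε₀ ω - partialErr F₀ P T ε₀ M ω)
      (hε.1.sub (memLp_partialErr hT hF₀ hF hε M).1)]
  congr 1
  refine eLpNorm_congr_ae ?_
  filter_upwards [hM] with ω hω
  simp only [Pi.sub_apply] at hω ⊢
  rw [hω]
  ring

theorem summable_lpNorm_innov (hT : MeasurePreserving T P P) (hF₀ : F₀ ≤ mΩ) (hF : F₀ ≤ F₀.comap T)
    (hε : MemLp ε₀ 2 P) (hC1 : HannanCondition F₀ P T ε₀) :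
    Summable fun r => lpNorm (innov F₀ P T ε₀ r) 2 P := by
  have h1 := ENNReal.summable_toReal hC1.ne
  refine h1.congr fun r => ?_
  exact toReal_eLpNorm (isInnovation_innov hT hF₀ hF hε r).memLp.1

end Decomposition

/-! ### Autocovariances and tapered quadratic forms of the error process -/

theorem toeplitzForm_sum_sum (n : ℕ) (w : ℤ → ℝ) {ι : Type*} (s : Finset ι) (a b : ι → ℕ → ℝ) :
    toeplitzForm n w (fun i => ∑ r ∈ s, a r i) (fun j => ∑ r ∈ s, b r j)
      = ∑ q ∈ s ×ˢ s, toeplitzForm n w (a q.1) (b q.2) := by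
  simp only [toeplitzForm]
  rw [Finset.sum_comm' (t' := Finset.range n) (s' := fun _ => s ×ˢ s) (by tauto)]
  refine Finset.sum_congr rfl fun i _ => ?_
  rw [Finset.sum_comm' (t' := Finset.range n) (s' := fun _ => s ×ˢ s) (by tauto)]
  refine Finset.sum_congr rfl fun j _ => ?_
  rw [Finset.sum_mul_sum, Finset.sum_product, Finset.mul_sum]
  exact Finset.sum_congr rfl fun r _ => Finset.mul_sum _ _ _

theorem tendsto_Icc_prod_atTop :
    Tendsto (fun M : ℕ => Finset.Icc (-(M : ℤ)) M ×ˢ Finset.Icc (-(M : ℤ)) M) atTop atTop := by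
  refine tendsto_atTop_finset_of_monotone ?_ ?_
  · intro M N hMN
    exact Finset.product_subset_product (Finset.Icc_subset_Icc (by omega) (by omega))
      (Finset.Icc_subset_Icc (by omega) (by omega))
  · intro r
    refine ⟨max r.1.natAbs r.2.natAbs, Finset.mem_product.2 ⟨Finset.mem_Icc.2 ?_, Finset.mem_Icc.2 ?_⟩⟩ <;>
      omega

/-- The shear `(k, r) ↦ (r, r + k)`. -/
def shearEquiv : ℤ × ℤ ≃ ℤ × ℤ where
  toFun q := (q.2, q.2 + q.1)
  invFun q := (q.2 - q.1, q.1)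
  left_inv q := by ext <;> simp
  right_inv q := by ext <;> simp

section ErrorProcess

variable {Ω : Type*} {F₀ : MeasurableSpace Ω} [mΩ : MeasurableSpace Ω] {P : Measure Ω}
  {T : Ω ≃ᵐ Ω} {ε₀ : Ω → ℝ}

theorem integral_abs_mul_sub_mul_le {f f' g g' : Ω → ℝ} (hf : MemLp f 2 P) (hf' : MemLp f' 2 P)
    (hg : MemLp g 2 P) (hg' : MemLp g' 2 P) :
    ∫ ω, |f ω * g ω - f' ω * g' ω| ∂P ≤
      lpNorm (fun ω => f ω - f' ω) 2 P * lpNorm g 2 P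
        + lpNorm f' 2 P * lpNorm (fun ω => g ω - g' ω) 2 P := by
  have hd : MemLp (fun ω => f ω - f' ω) 2 P := hf.sub hf'
  have hd' : MemLp (fun ω => g ω - g' ω) 2 P := hg.sub hg'
  have h1 : Integrable (fun ω => |(f ω - f' ω) * g ω|) P := (hd.integrable_mul hg).abs
  have h2 : Integrable (fun ω => |f' ω * (g ω - g' ω)|) P := (hf'.integrable_mul hd').abs
  calc _ ≤ ∫ ω, |(f ω - f' ω) * g ω| + |f' ω * (g ω - g' ω)| ∂P := by
        refine integral_mono_of_nonneg (Eventually.of_forall fun _ => abs_nonneg _) (h1.add h2)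
          (Eventually.of_forall fun ω => ?_)
        refine le_trans (le_of_eq ?_) (abs_add_le _ _)
        dsimp only
        congr 1
        ring
    _ ≤ _ := by
        rw [integral_add h1 h2]
        exact add_le_add (integral_abs_mul_le hd hg) (integral_abs_mul_le hf' hd')

theorem partialErr_iter (M : ℕ) (i : ℤ) (ω : Ω) :
    partialErr F₀ P T ε₀ M (iter T i ω)
      = ∑ r ∈ Finset.Icc (-(M : ℤ)) M, innov F₀ P T ε₀ r (iter T (i + -r) ω) := by
  refine Finset.sum_congr rfl fun r _ => ?_
  rw [← iter_add, add_comm]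

variable [IsProbabilityMeasure P]

theorem tendsto_integral_abs_mul_sub_partialErr (hT : MeasurePreserving T P P) (hF₀ : F₀ ≤ mΩ)
    (hF : F₀ ≤ F₀.comap T)
    (hbot : ∀ A : Set Ω, MeasurableSet[⨅ i : ℤ, filt F₀ T i] A → P A = 0 ∨ P A = 1)
    (hε_meas : Measurable[⨆ i : ℤ, filt F₀ T i] ε₀) (hε : MemLp ε₀ 2 P)
    (hε0 : ∫ ω, ε₀ ω ∂P = 0) (s t : ℤ) :
    Tendsto (fun M : ℕ => ∫ ω, |err T ε₀ s ω * err T ε₀ t ω - partialErr F₀ P T ε₀ M (iter T s ω)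
      * partialErr F₀ P T ε₀ M (iter T t ω)| ∂P) atTop (𝓝 0) := by
  have hx := tendsto_lpNorm_sub_partialErr hT hF₀ hF hbot hε_meas hε hε0
  have hS := memLp_partialErr (P := P) (T := T) hT hF₀ hF hε
  have hd : ∀ M, MemLp (fun ω => ε₀ ω - partialErr F₀ P T ε₀ M ω) 2 P := fun M => hε.sub (hS M)
  set x := fun M : ℕ => lpNorm (fun ω => ε₀ ω - partialErr F₀ P T ε₀ M ω) 2 P with hxdef
  have h1 : ∀ i, MemLp (err T ε₀ i) 2 P := memLp_err hT hε
  have h2 : ∀ M i, MemLp (fun ω => partialErr F₀ P T ε₀ M (iter T i ω)) 2 P := fun M i =>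
    (hS M).comp_measurePreserving (measurePreserving_iter hT i)
  have h3 : ∀ M i, lpNorm (fun ω => err T ε₀ i ω - partialErr F₀ P T ε₀ M (iter T i ω)) 2 P
      = x M := fun M i =>
    lpNorm_comp_measurePreserving (f := fun ω => ε₀ ω - partialErr F₀ P T ε₀ M ω)
      (measurePreserving_iter hT i) (hd M).1
  have h4 : ∀ i, lpNorm (err T ε₀ i) 2 P = lpNorm ε₀ 2 P := fun i =>
    lpNorm_comp_measurePreserving (measurePreserving_iter hT i) hε.1
  have h5 : ∀ M i, lpNorm (fun ω => partialErr F₀ P T ε₀ M (iter T i ω)) 2 P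
      ≤ lpNorm ε₀ 2 P + x M := by
    intro M i
    rw [lpNorm_comp_measurePreserving (measurePreserving_iter hT i) (hS M).1]
    have := lpNorm_sub_le hε one_le_two (g := fun ω => ε₀ ω - partialErr F₀ P T ε₀ M ω)
    refine le_trans (le_of_eq ?_) this
    congr 1
    ext ω
    simp
  have h6 : Tendsto (fun M => x M * lpNorm ε₀ 2 P + (lpNorm ε₀ 2 P + x M) * x M) atTop (𝓝 0) := by
    have := (hx.mul_const (lpNorm ε₀ 2 P)).add ((hx.const_add (lpNorm ε₀ 2 P)).mul hx)
    simpa using this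
  refine squeeze_zero (fun _ => integral_nonneg fun _ => abs_nonneg _) (fun M => ?_) h6
  refine (integral_abs_mul_sub_mul_le (h1 s) (h2 M s) (h1 t) (h2 M t)).trans ?_
  rw [h3, h3, h4]
  exact add_le_add le_rfl (mul_le_mul_of_nonneg_right (h5 M s) lpNorm_nonneg)

variable (F₀ P T ε₀) in
/-- The covariances of the innovations. -/
noncomputable def innovCov (r r' : ℤ) : ℝ :=
  ∫ ω, innov F₀ P T ε₀ r ω * innov F₀ P T ε₀ r' ω ∂P

theorem abs_innovCov_le (hT : MeasurePreserving T P P) (hF₀ : F₀ ≤ mΩ) (hF : F₀ ≤ F₀.comap T)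
    (hε : MemLp ε₀ 2 P) (r r' : ℤ) : |innovCov F₀ P T ε₀ r r'|
      ≤ lpNorm (innov F₀ P T ε₀ r) 2 P * lpNorm (innov F₀ P T ε₀ r') 2 P :=
  abs_integral_mul_le (isInnovation_innov hT hF₀ hF hε r).memLp
    (isInnovation_innov hT hF₀ hF hε r').memLp

theorem summable_lpNorm_innov_mul (hT : MeasurePreserving T P P) (hF₀ : F₀ ≤ mΩ)
    (hF : F₀ ≤ F₀.comap T) (hε : MemLp ε₀ 2 P) (hC1 : HannanCondition F₀ P T ε₀) :
    Summable fun q : ℤ × ℤ =>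
      lpNorm (innov F₀ P T ε₀ q.1) 2 P * lpNorm (innov F₀ P T ε₀ q.2) 2 P :=
  (summable_lpNorm_innov hT hF₀ hF hε hC1).mul_of_nonneg (summable_lpNorm_innov hT hF₀ hF hε hC1)
    (fun _ => lpNorm_nonneg) (fun _ => lpNorm_nonneg)

/-- Cauchy–Schwarz bounds the terms by products of two summable sequences, and the shear only
reindexes the pairs by lag. -/
theorem summable_innovCov_shear (hT : MeasurePreserving T P P) (hF₀ : F₀ ≤ mΩ)
    (hF : F₀ ≤ F₀.comap T) (hε : MemLp ε₀ 2 P) (hC1 : HannanCondition F₀ P T ε₀) :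
    Summable fun q : ℤ × ℤ => |innovCov F₀ P T ε₀ q.2 (q.2 + q.1)| := by
  have h1 := shearEquiv.summable_iff.2 (summable_lpNorm_innov_mul hT hF₀ hF hε hC1)
  exact Summable.of_nonneg_of_le (fun _ => abs_nonneg _)
    (fun q => abs_innovCov_le hT hF₀ hF hε _ _) h1

/-- The innovations of indices `r` and `r'` sit at times `-r` and `k - r'`; orthogonality leaves
only `r' = r + k`, and the filter records that both indices lie within the truncation. -/
theorem integral_partialErr_mul (hT : MeasurePreserving T P P) (hF₀ : F₀ ≤ mΩ)
    (hF : F₀ ≤ F₀.comap T) (hε : MemLp ε₀ 2 P) (k : ℤ) (M : ℕ) :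
    ∫ ω, partialErr F₀ P T ε₀ M (iter T 0 ω) * partialErr F₀ P T ε₀ M (iter T k ω) ∂P
      = ∑ r ∈ (Finset.Icc (-(M : ℤ)) M).filter (fun r => r + k ∈ Finset.Icc (-(M : ℤ)) M),
          innovCov F₀ P T ε₀ r (r + k) := by
  have hI := fun r => isInnovation_innov (T := T) (P := P) hT hF₀ hF hε r
  have h_int : ∀ r r' : ℤ, Integrable (fun ω => innov F₀ P T ε₀ r (iter T (0 + -r) ω)
      * innov F₀ P T ε₀ r' (iter T (k + -r') ω)) P := fun r r' =>
    ((hI r).memLp_comp hT _).integrable_mul ((hI r').memLp_comp hT _)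
  simp only [partialErr_iter, Finset.sum_mul_sum]
  rw [integral_finsetSum _ fun r _ => integrable_finsetSum _ fun r' _ => h_int r r',
    Finset.sum_filter]
  refine Finset.sum_congr rfl fun r _ => ?_
  rw [integral_finsetSum _ fun r' _ => h_int r r']
  have h1 : ∀ r', ∫ ω, innov F₀ P T ε₀ r (iter T (0 + -r) ω)
      * innov F₀ P T ε₀ r' (iter T (k + -r') ω) ∂P
      = if r + k = r' then innovCov F₀ P T ε₀ r (r + k) else 0 := by
    intro r'
    split_ifs with h
    · subst h
      rw [show k + -(r + k) = 0 + -r by ring]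
      exact integral_comp_iter hT (0 + -r)
        (fun ω => innov F₀ P T ε₀ r ω * innov F₀ P T ε₀ (r + k) ω)
    · exact IsInnovation.integral_comp_mul_comp_eq_zero hT hF (hI r) (hI r') (by omega)
  simp only [h1]
  rw [Finset.sum_ite_eq]

/-- The covariance of the truncated processes is a partial sum of this absolutely convergent series;
it also converges to `γ(k)`, the truncations being close in `L²`. -/
theorem hasSum_autocov (hT : MeasurePreserving T P P) (hF₀ : F₀ ≤ mΩ)
    (hF : F₀ ≤ F₀.comap T)
    (hbot : ∀ A : Set Ω, MeasurableSet[⨅ i : ℤ, filt F₀ T i] A → P A = 0 ∨ P A = 1)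
    (hε_meas : Measurable[⨆ i : ℤ, filt F₀ T i] ε₀) (hε : MemLp ε₀ 2 P)
    (hε0 : ∫ ω, ε₀ ω ∂P = 0) (hC1 : HannanCondition F₀ P T ε₀) (k : ℤ) :
    HasSum (fun r => innovCov F₀ P T ε₀ r (r + k)) (autocov P T ε₀ k) := by
  have hs : Summable fun r => innovCov F₀ P T ε₀ r (r + k) :=
    ((summable_innovCov_shear hT hF₀ hF hε hC1).prod_factor k).of_abs
  have h1 : Tendsto (fun M : ℕ => (Finset.Icc (-(M : ℤ)) M).filter
      (fun r => r + k ∈ Finset.Icc (-(M : ℤ)) M)) atTop atTop := by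
    refine tendsto_atTop_finset_of_monotone ?_ ?_
    · intro M N hMN r
      simp only [Finset.mem_filter, Finset.mem_Icc]
      omega
    · intro r
      refine ⟨max r.natAbs (r + k).natAbs, ?_⟩
      simp only [Finset.mem_filter, Finset.mem_Icc]
      omega
  have h2 := hs.hasSum.comp h1
  have h3 : Tendsto (fun M : ℕ => ∑ r ∈ (Finset.Icc (-(M : ℤ)) M).filter
      (fun r => r + k ∈ Finset.Icc (-(M : ℤ)) M), innovCov F₀ P T ε₀ r (r + k)) atTop
      (𝓝 (autocov P T ε₀ k)) := by
    rw [tendsto_iff_dist_tendsto_zero]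
    refine squeeze_zero (fun _ => dist_nonneg) (fun M => ?_)
      (tendsto_integral_abs_mul_sub_partialErr hT hF₀ hF hbot hε_meas hε hε0 0 k)
    rw [← integral_partialErr_mul hT hF₀ hF hε, dist_comm, Real.dist_eq, autocov]
    have hS : ∀ i, MemLp (fun ω => partialErr F₀ P T ε₀ M (iter T i ω)) 2 P := fun i =>
      (memLp_partialErr hT hF₀ hF hε M).comp_measurePreserving (measurePreserving_iter hT i)
    rw [← integral_sub (f := fun ω => err T ε₀ 0 ω * err T ε₀ k ω) (g := fun ω =>
      partialErr F₀ P T ε₀ M (iter T 0 ω) * partialErr F₀ P T ε₀ M (iter T k ω))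
      ((memLp_err hT hε 0).integrable_mul (memLp_err hT hε k)) ((hS 0).integrable_mul (hS k))]
    exact abs_integral_le_integral_abs
  rw [← tendsto_nhds_unique h2 h3]
  exact hs.hasSum

theorem summable_abs_autocov (hT : MeasurePreserving T P P) (hF₀ : F₀ ≤ mΩ)
    (hF : F₀ ≤ F₀.comap T)
    (hbot : ∀ A : Set Ω, MeasurableSet[⨅ i : ℤ, filt F₀ T i] A → P A = 0 ∨ P A = 1)
    (hε_meas : Measurable[⨆ i : ℤ, filt F₀ T i] ε₀) (hε : MemLp ε₀ 2 P)
    (hε0 : ∫ ω, ε₀ ω ∂P = 0) (hC1 : HannanCondition F₀ P T ε₀) :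
    Summable fun k : ℤ => |autocov P T ε₀ k| := by
  have h1 := summable_innovCov_shear hT hF₀ hF hε hC1
  refine Summable.of_nonneg_of_le (fun _ => abs_nonneg _) (fun k => ?_) h1.prod
  rw [← (hasSum_autocov hT hF₀ hF hbot hε_meas hε hε0 hC1 k).tsum_eq]
  have h2 : Summable fun r => ‖innovCov F₀ P T ε₀ r (r + k)‖ := h1.prod_factor k
  exact norm_tsum_le_tsum_norm h2

/-- The pair limits of the innovation forms are collected by lag: absolute summability permits
summing first over the pairs with a given difference. -/
theorem hasSum_innovCov_mul (hT : MeasurePreserving T P P) (hF₀ : F₀ ≤ mΩ)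
    (hF : F₀ ≤ F₀.comap T)
    (hbot : ∀ A : Set Ω, MeasurableSet[⨅ i : ℤ, filt F₀ T i] A → P A = 0 ∨ P A = 1)
    (hε_meas : Measurable[⨆ i : ℤ, filt F₀ T i] ε₀) (hε : MemLp ε₀ 2 P)
    (hε0 : ∫ ω, ε₀ ω ∂P = 0) (hC1 : HannanCondition F₀ P T ε₀) {ρ : ℤ → ℝ} (hρ : ∀ k, |ρ k| ≤ 1) :
    HasSum (fun q : ℤ × ℤ => ρ (q.1 - q.2) * innovCov F₀ P T ε₀ q.1 q.2)
      (∑' k : ℤ, autocov P T ε₀ k * ρ (-k)) := by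
  rw [← shearEquiv.hasSum_iff]
  have h0 : ((fun q : ℤ × ℤ => ρ (q.1 - q.2) * innovCov F₀ P T ε₀ q.1 q.2) ∘ shearEquiv)
      = fun q : ℤ × ℤ => innovCov F₀ P T ε₀ q.2 (q.2 + q.1) * ρ (-q.1) := by
    ext q
    simp only [Function.comp_apply, shearEquiv, Equiv.coe_fn_mk]
    rw [mul_comm]
    congr 2
    ring
  rw [h0]
  have hs : Summable fun q : ℤ × ℤ => innovCov F₀ P T ε₀ q.2 (q.2 + q.1) * ρ (-q.1) := by
    refine Summable.of_norm_bounded (summable_innovCov_shear hT hF₀ hF hε hC1) fun q => ?_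
    rw [norm_mul]
    exact mul_le_of_le_one_right (abs_nonneg _) (hρ _)
  have h1 := hs.hasSum.prod_fiberwise fun k =>
    (hasSum_autocov hT hF₀ hF hbot hε_meas hε hε0 hC1 k).mul_right (ρ (-k))
  rw [h1.tsum_eq]
  exact hs.hasSum

/-- The tapered quadratic form of the errors converges in `L¹`. -/
theorem tendsto_toeplitzForm_err (hT : MeasurePreserving T P P) (hF₀ : F₀ ≤ mΩ)
    (hF : F₀ ≤ F₀.comap T)
    (hbot : ∀ A : Set Ω, MeasurableSet[⨅ i : ℤ, filt F₀ T i] A → P A = 0 ∨ P A = 1)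
    (hε_meas : Measurable[⨆ i : ℤ, filt F₀ T i] ε₀) (hε : MemLp ε₀ 2 P)
    (hε0 : ∫ ω, ε₀ ω ∂P = 0) (hC1 : HannanCondition F₀ P T ε₀)
    {K : ℝ → ℝ} (hK : IsKernel K) {u v : ℕ → ℕ → ℝ} {ρ : ℤ → ℝ} (H : LagConvergent u v ρ)
    {h : ℕ → ℝ} (hpos : ∀ n, 0 < h n) (hh : Tendsto h atTop atTop)
    (hhn : Tendsto (fun n : ℕ => h n / n) atTop (𝓝 0)) :
    Tendsto (fun n : ℕ => ∫ ω, |(1 / (n : ℝ)) * toeplitzForm n (taperWeight K (h n) n (u n) (v n))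
      (fun i => err T ε₀ (i + 1) ω) (fun j => err T ε₀ (j + 1) ω)
        - ∑' k : ℤ, autocov P T ε₀ k * ρ (-k)| ∂P) atTop (𝓝 0) := by
  obtain ⟨κ, hκ, hKκ⟩ := hK.exists_cos_transform
  have hI := fun r => isInnovation_innov (T := T) (P := P) hT hF₀ hF hε r
  have hL := hasSum_innovCov_mul hT hF₀ hF hbot hε_meas hε hε0 hC1 H.abs_le_one
  set L := ∑' k : ℤ, autocov P T ε₀ k * ρ (-k) with hLdef
  set w : ℕ → ℤ → ℝ := fun n => taperWeight K (h n) n (u n) (v n) with hw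
  set q : ℕ → ℤ × ℤ → Ω → ℝ := fun n p ω => (1 / (n : ℝ)) * toeplitzForm n (w n)
      (fun i => innov F₀ P T ε₀ p.1 (iter T (i + (1 + -p.1)) ω))
      (fun j => innov F₀ P T ε₀ p.2 (iter T (j + (1 + -p.2)) ω)) with hq
  set e : ℕ → ℤ × ℤ → ℝ := fun n p =>
    ∫ ω, |q n p ω - ρ (p.1 - p.2) * innovCov F₀ P T ε₀ p.1 p.2| ∂P with he
  set d : ℤ × ℤ → ℝ := fun p =>
    lpNorm (innov F₀ P T ε₀ p.1) 2 P * lpNorm (innov F₀ P T ε₀ p.2) 2 P with hd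
  have hds : Summable d := summable_lpNorm_innov_mul hT hF₀ hF hε hC1
  have hqint : ∀ n p, Integrable (q n p) P := fun n p =>
    (IsInnovation.integrable_toeplitzForm hT (hI p.1).memLp (hI p.2).memLp n (w n)
      (1 + -p.1) (1 + -p.2)).const_mul _
  have heint : ∀ n p, Integrable (fun ω => |q n p ω - ρ (p.1 - p.2) * innovCov F₀ P T ε₀ p.1 p.2|) P :=
    fun n p => ((hqint n p).sub (integrable_const _)).abs
  have he0 : ∀ n p, 0 ≤ e n p := fun n p => integral_nonneg fun _ => abs_nonneg _
  have hlim : ∀ p, Tendsto (fun n => e n p) atTop (𝓝 0) := by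
    intro p
    have := IsInnovation.tendsto_toeplitzForm hT hF₀ hF hbot (hI p.1) (hI p.2) hK H hpos hh hhn
      (1 + -p.1) (1 + -p.2)
    rw [show (1 + -p.2) - (1 + -p.1) = p.1 - p.2 by ring] at this
    exact this
  have hκ0 : 0 ≤ ∫ ξ, |κ ξ| := integral_nonneg fun _ => abs_nonneg _
  -- The bound is independent of `n` and summable over pairs by Hannan's condition; it dominates the
  -- exchange of limit and sum.
  have hbd : ∀ n p, e n p ≤ (2 * (∫ ξ, |κ ξ|) + 1) * d p := by
    intro n p
    have hd0 : 0 ≤ d p := mul_nonneg lpNorm_nonneg lpNorm_nonneg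
    have h1 : ∫ ω, |q n p ω| ∂P ≤ 2 * (∫ ξ, |κ ξ|) * d p := by
      have := IsInnovation.integral_abs_toeplitzForm_le hT hF₀ hF (hI p.1) (hI p.2)
        (H.left n) (H.right n) hκ hKκ (h n) (1 + -p.1) (1 + -p.2)
      have hn0 : (0 : ℝ) ≤ 1 / n := by positivity
      have h2 : ∀ ω, |q n p ω| = (1 / (n : ℝ)) * |toeplitzForm n (w n)
          (fun i => innov F₀ P T ε₀ p.1 (iter T (i + (1 + -p.1)) ω))
          (fun j => innov F₀ P T ε₀ p.2 (iter T (j + (1 + -p.2)) ω))| := fun ω => by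
        rw [hq, abs_mul, abs_of_nonneg hn0]
      simp only [h2]
      rw [integral_const_mul]
      refine (mul_le_mul_of_nonneg_left this hn0).trans ?_
      have h3 : (1 / (n : ℝ)) * n ≤ 1 := by
        rw [one_div]
        exact inv_mul_le_one
      calc _ = (1 / (n : ℝ) * n) * (2 * (∫ ξ, |κ ξ|) * d p) := by ring
        _ ≤ 1 * (2 * (∫ ξ, |κ ξ|) * d p) := mul_le_mul_of_nonneg_right h3 (by positivity)
        _ = _ := one_mul _
    have h2 : |ρ (p.1 - p.2) * innovCov F₀ P T ε₀ p.1 p.2| ≤ d p := by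
      rw [abs_mul]
      calc _ ≤ 1 * d p := mul_le_mul (H.abs_le_one _) (abs_innovCov_le hT hF₀ hF hε _ _)
            (abs_nonneg _) zero_le_one
        _ = _ := one_mul _
    calc e n p ≤ ∫ ω, (|q n p ω| + d p) ∂P := by
          refine integral_mono (heint n p) ((hqint n p).abs.add (integrable_const _)) fun ω => ?_
          exact (abs_sub _ _).trans (add_le_add le_rfl h2)
      _ ≤ _ := by
          rw [integral_add (hqint n p).abs (integrable_const _), integral_const]
          simp only [probReal_univ, one_smul]
          linarith
  have hes : ∀ n, Summable (e n) := fun n =>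
    Summable.of_nonneg_of_le (he0 n) (hbd n) (hds.mul_left _)
  have htan : Tendsto (fun n => ∑' p, e n p) atTop (𝓝 0) := by
    have := tendsto_tsum_of_dominated_convergence (f := e) (g := fun _ => (0 : ℝ))
      (hds.mul_left (2 * (∫ ξ, |κ ξ|) + 1)) hlim
      (Eventually.of_forall fun n p => by
        rw [Real.norm_eq_abs, abs_of_nonneg (he0 n p)]
        exact hbd n p)
    simpa using this
  -- With `n` fixed, the errors are replaced by their truncated decompositions and the level `M`
  -- tends to infinity; the form has finitely many terms, so `L¹` convergence of products suffices.
  refine squeeze_zero (fun _ => integral_nonneg fun _ => abs_nonneg _) (fun n => ?_) htan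
  set Q : (ℤ → Ω → ℝ) → Ω → ℝ := fun g ω => (1 / (n : ℝ)) * toeplitzForm n (w n)
    (fun i => g (i + 1) ω) (fun j => g (j + 1) ω) with hQ
  set S : ℕ → ℤ → Ω → ℝ := fun M i ω => partialErr F₀ P T ε₀ M (iter T i ω) with hS
  have hSm : ∀ M i, MemLp (S M i) 2 P := fun M i =>
    (memLp_partialErr hT hF₀ hF hε M).comp_measurePreserving (measurePreserving_iter hT i)
  have hQint : ∀ g : ℤ → Ω → ℝ, (∀ i, MemLp (g i) 2 P) → Integrable (Q g) P := fun g hg =>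
    Integrable.const_mul (integrable_finsetSum _ fun i _ => integrable_finsetSum _ fun j _ =>
      Integrable.const_mul ((hg _).integrable_mul (hg _)) _) _
  have hQε := hQint (err T ε₀) (memLp_err hT hε)
  have hterm : ∀ M i j, Integrable (fun ω => |err T ε₀ i ω * err T ε₀ j ω - S M i ω * S M j ω|) P :=
    fun M i j => (((memLp_err hT hε i).integrable_mul (memLp_err hT hε j)).sub
      ((hSm M i).integrable_mul (hSm M j))).abs
  have hQS : ∀ M ω, Q (S M) ω
      = ∑ p ∈ Finset.Icc (-(M : ℤ)) M ×ˢ Finset.Icc (-(M : ℤ)) M, q n p ω := by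
    intro M ω
    simp only [hQ, hS, hq, partialErr_iter]
    rw [toeplitzForm_sum_sum n (w n) (Finset.Icc (-(M : ℤ)) M)
      (fun r i => innov F₀ P T ε₀ r (iter T ((i : ℤ) + 1 + -r) ω))
      (fun r i => innov F₀ P T ε₀ r (iter T ((i : ℤ) + 1 + -r) ω)), Finset.mul_sum]
    simp only [add_assoc]
  have hb1 : Tendsto (fun M => (1 / (n : ℝ)) * ∑ i ∈ Finset.range n, ∑ j ∈ Finset.range n,
      |w n ((i : ℤ) - j)| * ∫ ω, |err T ε₀ (i + 1) ω * err T ε₀ (j + 1) ω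
        - S M (i + 1) ω * S M (j + 1) ω| ∂P) atTop (𝓝 0) := by
    have : Tendsto (fun M => (1 / (n : ℝ)) * ∑ i ∈ Finset.range n, ∑ j ∈ Finset.range n,
      |w n ((i : ℤ) - j)| * ∫ ω, |err T ε₀ (i + 1) ω * err T ε₀ (j + 1) ω
        - S M (i + 1) ω * S M (j + 1) ω| ∂P) atTop (𝓝 ((1 / (n : ℝ)) * ∑ i ∈ Finset.range n,
        ∑ j ∈ Finset.range n, |w n ((i : ℤ) - j)| * 0)) :=
      Tendsto.const_mul _ (tendsto_finsetSum _ fun i _ => tendsto_finsetSum _ fun j _ =>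
        Tendsto.const_mul _
          (tendsto_integral_abs_mul_sub_partialErr hT hF₀ hF hbot hε_meas hε hε0 _ _))
    simpa using this
  have hb2 : Tendsto (fun M : ℕ => ∑ p ∈ Finset.Icc (-(M : ℤ)) M ×ˢ Finset.Icc (-(M : ℤ)) M, e n p)
      atTop (𝓝 (∑' p, e n p)) := (hes n).hasSum.comp tendsto_Icc_prod_atTop
  have hb3 : Tendsto (fun M : ℕ => |∑ p ∈ Finset.Icc (-(M : ℤ)) M ×ˢ Finset.Icc (-(M : ℤ)) M,
      ρ (p.1 - p.2) * innovCov F₀ P T ε₀ p.1 p.2 - L|) atTop (𝓝 0) := by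
    have h1 : Tendsto (fun M : ℕ => ∑ p ∈ Finset.Icc (-(M : ℤ)) M ×ˢ Finset.Icc (-(M : ℤ)) M,
      ρ (p.1 - p.2) * innovCov F₀ P T ε₀ p.1 p.2) atTop (𝓝 L) := hL.comp tendsto_Icc_prod_atTop
    have := (h1.sub_const L).abs
    simpa using this
  have hb := (hb1.add hb2).add hb3
  rw [zero_add, add_zero] at hb
  refine ge_of_tendsto hb (Eventually.of_forall fun M => ?_)
  have hpt : ∀ ω, |Q (err T ε₀) ω - L| ≤ ((1 / (n : ℝ)) * ∑ i ∈ Finset.range n, ∑ j ∈ Finset.range n,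
      |w n ((i : ℤ) - j)| * |err T ε₀ (i + 1) ω * err T ε₀ (j + 1) ω
        - S M (i + 1) ω * S M (j + 1) ω|
      + ∑ p ∈ Finset.Icc (-(M : ℤ)) M ×ˢ Finset.Icc (-(M : ℤ)) M,
          |q n p ω - ρ (p.1 - p.2) * innovCov F₀ P T ε₀ p.1 p.2|)
      + |∑ p ∈ Finset.Icc (-(M : ℤ)) M ×ˢ Finset.Icc (-(M : ℤ)) M,
      ρ (p.1 - p.2) * innovCov F₀ P T ε₀ p.1 p.2 - L| := by
    intro ω
    have h1 : |Q (err T ε₀) ω - Q (S M) ω| ≤ (1 / (n : ℝ)) * ∑ i ∈ Finset.range n,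
        ∑ j ∈ Finset.range n, |w n ((i : ℤ) - j)| * |err T ε₀ (i + 1) ω * err T ε₀ (j + 1) ω
        - S M (i + 1) ω * S M (j + 1) ω| := by
      simp only [hQ, toeplitzForm]
      rw [← mul_sub, abs_mul, abs_of_nonneg (by positivity : (0 : ℝ) ≤ 1 / n),
        ← Finset.sum_sub_distrib]
      refine mul_le_mul_of_nonneg_left ?_ (by positivity)
      refine (Finset.abs_sum_le_sum_abs _ _).trans (Finset.sum_le_sum fun i _ => ?_)
      rw [← Finset.sum_sub_distrib]
      refine (Finset.abs_sum_le_sum_abs _ _).trans (Finset.sum_le_sum fun j _ => ?_)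
      rw [← mul_sub, abs_mul]
    have h2 : |Q (S M) ω - ∑ p ∈ Finset.Icc (-(M : ℤ)) M ×ˢ Finset.Icc (-(M : ℤ)) M,
        ρ (p.1 - p.2) * innovCov F₀ P T ε₀ p.1 p.2|
        ≤ ∑ p ∈ Finset.Icc (-(M : ℤ)) M ×ˢ Finset.Icc (-(M : ℤ)) M,
          |q n p ω - ρ (p.1 - p.2) * innovCov F₀ P T ε₀ p.1 p.2| := by
      rw [hQS, ← Finset.sum_sub_distrib]
      exact Finset.abs_sum_le_sum_abs _ _
    have h3 := abs_sub_le (Q (err T ε₀) ω) (Q (S M) ω) L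
    have h4 := abs_sub_le (Q (S M) ω) (∑ p ∈ Finset.Icc (-(M : ℤ)) M ×ˢ Finset.Icc (-(M : ℤ)) M,
        ρ (p.1 - p.2) * innovCov F₀ P T ε₀ p.1 p.2) L
    linarith
  have hi1 : Integrable (fun ω => (1 / (n : ℝ)) * ∑ i ∈ Finset.range n, ∑ j ∈ Finset.range n,
      |w n ((i : ℤ) - j)| * |err T ε₀ (i + 1) ω * err T ε₀ (j + 1) ω
        - S M (i + 1) ω * S M (j + 1) ω|) P :=
    Integrable.const_mul (integrable_finsetSum _ fun i _ => integrable_finsetSum _ fun j _ =>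
      (hterm M _ _).const_mul _) _
  have hi2 : Integrable (fun ω => ∑ p ∈ Finset.Icc (-(M : ℤ)) M ×ˢ Finset.Icc (-(M : ℤ)) M,
          |q n p ω - ρ (p.1 - p.2) * innovCov F₀ P T ε₀ p.1 p.2|) P :=
    integrable_finsetSum _ fun p _ => heint n p
  refine (integral_mono (hQε.sub (integrable_const L)).abs
    ((hi1.add hi2).add (integrable_const _)) hpt).trans (le_of_eq ?_)
  rw [integral_add' (hi1.add hi2) (integrable_const _), integral_add' hi1 hi2, integral_const,
    integral_const_mul, integral_finsetSum _ fun p _ => heint n p,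
    integral_finsetSum _ fun i _ => integrable_finsetSum _ fun j _ => (hterm M _ _).const_mul _]
  simp only [probReal_univ, one_smul]
  congr 3
  refine Finset.sum_congr rfl fun i _ => ?_
  rw [integral_finsetSum _ fun j _ => (hterm M _ _).const_mul _]
  exact Finset.sum_congr rfl fun j _ => integral_const_mul _ _

end ErrorProcess

/-! ### Schur bounds for Toeplitz forms -/

/-- Schur's test. The parameter `t` is kept free to balance two sequences of very different size. -/
theorem abs_toeplitzForm_le_of_rowSum {n : ℕ} {w : ℤ → ℝ} {S : ℝ}
    (hrow : ∀ i < n, ∑ j ∈ Finset.range n, |w ((i : ℤ) - j)| ≤ S)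
    (hcol : ∀ j < n, ∑ i ∈ Finset.range n, |w ((i : ℤ) - j)| ≤ S) {t : ℝ} (ht : 0 < t)
    (a b : ℕ → ℝ) :
    |toeplitzForm n w a b| ≤ S * (t⁻¹ * ∑ i ∈ Finset.range n, a i ^ 2
      + t * ∑ j ∈ Finset.range n, b j ^ 2) / 2 := by
  have h1 : |toeplitzForm n w a b| ≤ ∑ i ∈ Finset.range n, ∑ j ∈ Finset.range n,
      (t⁻¹ * a i ^ 2 * |w ((i : ℤ) - j)| + t * b j ^ 2 * |w ((i : ℤ) - j)|) / 2 := by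
    unfold toeplitzForm
    refine (Finset.abs_sum_le_sum_abs _ _).trans (Finset.sum_le_sum fun i _ => ?_)
    refine (Finset.abs_sum_le_sum_abs _ _).trans (Finset.sum_le_sum fun j _ => ?_)
    rw [abs_mul, abs_mul]
    have h2 : |a i| * |b j| ≤ (t⁻¹ * a i ^ 2 + t * b j ^ 2) / 2 := by
      have h3 : 0 ≤ t⁻¹ * (|a i| - t * |b j|) ^ 2 := by positivity
      have h4 : t⁻¹ * (|a i| - t * |b j|) ^ 2
          = t⁻¹ * a i ^ 2 + t * b j ^ 2 - 2 * (|a i| * |b j|) := by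
        rw [← sq_abs (a i), ← sq_abs (b j)]
        field_simp
        ring
      linarith
    nlinarith [mul_le_mul_of_nonneg_left h2 (abs_nonneg (w ((i : ℤ) - j)))]
  simp only [← Finset.sum_div, Finset.sum_add_distrib] at h1
  refine h1.trans ?_
  rw [mul_add]
  gcongr
  · simp only [← Finset.mul_sum]
    rw [Finset.mul_sum, Finset.mul_sum]
    refine Finset.sum_le_sum fun i hi => ?_
    rw [mul_comm]
    exact mul_le_mul_of_nonneg_right (hrow i (Finset.mem_range.1 hi)) (by positivity)
  · rw [Finset.sum_comm]
    simp only [← Finset.mul_sum]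
    rw [Finset.mul_sum, Finset.mul_sum]
    refine Finset.sum_le_sum fun j hj => ?_
    rw [mul_comm]
    exact mul_le_mul_of_nonneg_right (hcol j (Finset.mem_range.1 hj)) (by positivity)

theorem abs_toeplitzForm_le_of_banded {n m : ℕ} {w : ℤ → ℝ} {B : ℝ} (hB : ∀ k, |w k| ≤ B)
    (hm : ∀ k : ℤ, m < k.natAbs → w k = 0) {t : ℝ} (ht : 0 < t) (a b : ℕ → ℝ) :
    |toeplitzForm n w a b| ≤ (2 * m + 1) * B * (t⁻¹ * ∑ i ∈ Finset.range n, a i ^ 2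
      + t * ∑ j ∈ Finset.range n, b j ^ 2) / 2 := by
  have hB0 : 0 ≤ B := (abs_nonneg _).trans (hB 0)
  refine abs_toeplitzForm_le_of_rowSum (fun i _ => ?_) (fun j _ => ?_) ht a b
  · exact sum_banded_le (g := fun k => |w k|) hB hB0 (fun k hk => by simp [hm k hk]) n i
  · have := sum_banded_le (g := fun k => |w (-k)|) (m := m) (fun k => hB (-k)) hB0
      (fun k hk => by simp [hm (-k) (by omega)]) n j
    simpa using this

theorem abs_toeplitzForm_le_of_summable {n : ℕ} {w : ℤ → ℝ} (hw : Summable fun k => |w k|)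
    (a : ℕ → ℝ) :
    |toeplitzForm n w a a| ≤ (∑' k, |w k|) * ∑ i ∈ Finset.range n, a i ^ 2 := by
  have h := abs_toeplitzForm_le_of_rowSum (n := n) (w := w) (S := ∑' k, |w k|)
    (fun i _ => ?_) (fun j _ => ?_) zero_lt_one a a
  · refine h.trans (le_of_eq ?_)
    rw [inv_one]
    ring
  · have h1 : Set.InjOn (fun j : ℕ => (i : ℤ) - j) (Finset.range n : Set ℕ) := by
      intro x _ y _ hxy
      simp only at hxy
      omega
    rw [← Finset.sum_image (f := fun k => |w k|) h1]
    exact hw.sum_le_tsum _ fun _ _ => abs_nonneg _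
  · have h1 : Set.InjOn (fun i : ℕ => (i : ℤ) - j) (Finset.range n : Set ℕ) := by
      intro x _ y _ hxy
      simp only at hxy
      omega
    rw [← Finset.sum_image (f := fun k => |w k|) h1]
    exact hw.sum_le_tsum _ fun _ _ => abs_nonneg _

/-- Perturbation of the quadratic form of a banded Toeplitz matrix. -/
theorem abs_toeplitzForm_sub_le {n m : ℕ} {w : ℤ → ℝ} {B : ℝ} (hB : ∀ k, |w k| ≤ B)
    (hm : ∀ k : ℤ, m < k.natAbs → w k = 0) {t : ℝ} (ht : 0 < t) (a r : ℕ → ℝ) :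
    |toeplitzForm n w (fun i => a i - r i) (fun i => a i - r i) - toeplitzForm n w a a|
      ≤ (2 * m + 1) * B * (t⁻¹ * ∑ i ∈ Finset.range n, a i ^ 2
        + (t + 1) * ∑ j ∈ Finset.range n, r j ^ 2) := by
  have h1 := abs_toeplitzForm_le_of_banded (n := n) hB hm ht a r
  -- The parameter is inverted with the order of the factors, so both cross terms have the same
  -- weights; the term in `r` alone turns `t` into `t + 1`.
  have h2 := abs_toeplitzForm_le_of_banded (n := n) hB hm (inv_pos.2 ht) r a
  have h3 := abs_toeplitzForm_le_of_banded (n := n) hB hm one_pos r r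
  rw [inv_inv] at h2
  rw [inv_one] at h3
  rw [toeplitzForm_sub_left, toeplitzForm_sub_right, toeplitzForm_sub_right]
  rw [abs_le] at *
  constructor <;> linarith

/-! ### The normalised design -/

section NormalisedDesign

variable {p : ℕ}

/-- The normalised columns of the design. -/
noncomputable def normCol (x : ℕ → Fin p → ℝ) (n : ℕ) (j : Fin p) (i : ℕ) : ℝ :=
  x i j / colNorm x n j

/-- The normalised design matrix. -/
noncomputable def normDesign (x : ℕ → Fin p → ℝ) (n : ℕ) : Matrix (Fin n) (Fin p) ℝ :=
  Matrix.of fun i j => normCol x n j i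

/-- The Gram matrix of the normalised design. -/
noncomputable def gram (x : ℕ → Fin p → ℝ) (n : ℕ) : Matrix (Fin p) (Fin p) ℝ :=
  (normDesign x n)ᵀ * normDesign x n

theorem colNorm_sq (x : ℕ → Fin p → ℝ) (n : ℕ) (j : Fin p) :
    colNorm x n j ^ 2 = ∑ i ∈ Finset.range n, x i j ^ 2 :=
  Real.sq_sqrt (Finset.sum_nonneg fun _ _ => sq_nonneg _)

theorem sum_normCol_sq_le (x : ℕ → Fin p → ℝ) (n : ℕ) (j : Fin p) :
    ∑ i ∈ Finset.range n, normCol x n j i ^ 2 ≤ 1 := by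
  simp only [normCol, div_pow]
  rw [← Finset.sum_div, ← colNorm_sq]
  exact div_self_le_one _

theorem gram_apply (x : ℕ → Fin p → ℝ) (n : ℕ) (j l : Fin p) :
    gram x n j l = empCorr x n 0 j l := by
  simp only [gram, Matrix.mul_apply, Matrix.transpose_apply, normDesign, Matrix.of_apply, empCorr,
    tsub_zero, add_zero, normCol]
  rw [Finset.sum_range]
  exact Finset.sum_congr rfl fun i _ => by rw [div_mul_div_comm]

theorem lagSum_normCol (x : ℕ → Fin p → ℝ) (n k : ℕ) (j l : Fin p) :
    lagSum n (normCol x n j) (normCol x n l) k = empCorr x n k l j := by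
  rw [lagSum_natCast, empCorr]
  refine Finset.sum_congr rfl fun t _ => ?_
  rw [normCol, normCol, div_mul_div_comm, mul_comm (x (t + k) j), mul_comm (colNorm x n j)]

theorem designMatrix_eq {x : ℕ → Fin p → ℝ} {n : ℕ} (hx : ∀ j, colNorm x n j ≠ 0) :
    designMatrix x n = normDesign x n * normMatrix x n := by
  ext i j
  rw [normMatrix, Matrix.mul_diagonal]
  simp [designMatrix, normDesign, normCol, hx j]

theorem isUnit_det_normMatrix {x : ℕ → Fin p → ℝ} {n : ℕ} (hx : ∀ j, colNorm x n j ≠ 0) :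
    IsUnit (normMatrix x n).det := by
  rw [normMatrix, Matrix.det_diagonal]
  exact (Finset.prod_ne_zero_iff.2 fun j _ => hx j).isUnit

theorem gram_inv_eq {x : ℕ → Fin p → ℝ} {n : ℕ} (hx : ∀ j, colNorm x n j ≠ 0) :
    ((designMatrix x n)ᵀ * designMatrix x n)⁻¹
      = (normMatrix x n)⁻¹ * (gram x n)⁻¹ * (normMatrix x n)⁻¹ := by
  have hD : (normMatrix x n)ᵀ = normMatrix x n := Matrix.diagonal_transpose _
  rw [designMatrix_eq hx, Matrix.transpose_mul, hD, gram]
  rw [show normMatrix x n * (normDesign x n)ᵀ * (normDesign x n * normMatrix x n)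
    = normMatrix x n * ((normDesign x n)ᵀ * normDesign x n) * normMatrix x n by
      simp only [Matrix.mul_assoc], Matrix.mul_inv_rev, Matrix.mul_inv_rev, Matrix.mul_assoc]

theorem leastSquares_matrix_eq {x : ℕ → Fin p → ℝ} {n : ℕ} (hx : ∀ j, colNorm x n j ≠ 0) :
    ((designMatrix x n)ᵀ * designMatrix x n)⁻¹ * (designMatrix x n)ᵀ
      = (normMatrix x n)⁻¹ * ((gram x n)⁻¹ * (normDesign x n)ᵀ) := by
  have hD : (normMatrix x n)ᵀ = normMatrix x n := Matrix.diagonal_transpose _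
  rw [gram_inv_eq hx, designMatrix_eq hx, Matrix.transpose_mul, hD]
  simp only [Matrix.mul_assoc]
  rw [Matrix.nonsing_inv_mul_cancel_left _ _ (isUnit_det_normMatrix hx)]

theorem covEstimator_eq {x : ℕ → Fin p → ℝ} {n : ℕ} (hx : ∀ j, colNorm x n j ≠ 0)
    (K : ℝ → ℝ) (h : ℝ) (y : ℕ → ℝ) :
    covEstimator K h x y n
      = (gram x n)⁻¹ * ((normDesign x n)ᵀ * taperedCov K h x y n * normDesign x n)
        * (gram x n)⁻¹ := by
  have hD : (normMatrix x n)ᵀ = normMatrix x n := Matrix.diagonal_transpose _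
  rw [covEstimator, gram_inv_eq hx, designMatrix_eq hx, Matrix.transpose_mul, hD]
  simp only [Matrix.mul_assoc]
  rw [Matrix.nonsing_inv_mul _ (isUnit_det_normMatrix hx),
    Matrix.mul_nonsing_inv_cancel_left _ _ (isUnit_det_normMatrix hx),
    Matrix.nonsing_inv_mul_cancel_left _ _ (isUnit_det_normMatrix hx),
    Matrix.mul_nonsing_inv_cancel_left _ _ (isUnit_det_normMatrix hx), Matrix.mul_one]

theorem residualAutocov_eq (x : ℕ → Fin p → ℝ) (y : ℕ → ℝ) (n : ℕ) (k : ℤ) :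
    residualAutocov x y n k = (1 / (n : ℝ)) * lagSum n (residual x y n) (residual x y n) k := by
  rw [residualAutocov]
  congr 1
  have h1 : lagSum n (residual x y n) (residual x y n) k
      = lagSum n (residual x y n) (residual x y n) k.natAbs := by
    rcases Int.natAbs_eq k with h | h
    · rw [← h]
    · conv_lhs => rw [h]
      exact lagSum_neg _ _ _ _
  rw [h1, lagSum_natCast]
  exact Finset.sum_congr rfl fun i _ => mul_comm _ _

/-- The residual autocovariances are lag sums, so the exchange identity moves the lag sums to the
design columns. The data then enter as a plain quadratic form with weights fixed by the design. -/
theorem sandwich_taperedCov_apply (K : ℝ → ℝ) (h : ℝ) (x : ℕ → Fin p → ℝ) (y : ℕ → ℝ) (n : ℕ)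
    (j l : Fin p) :
    ((normDesign x n)ᵀ * taperedCov K h x y n * normDesign x n) j l
      = (1 / (n : ℝ)) * toeplitzForm n (taperWeight K h n (normCol x n j) (normCol x n l))
          (residual x y n) (residual x y n) := by
  have h1 := toeplitzForm_mul_lagSum_comm n (fun k => K (k / h)) (normCol x n j) (normCol x n l)
    (residual x y n) (residual x y n)
  rw [show taperWeight K h n (normCol x n j) (normCol x n l)
    = fun k : ℤ => K (k / h) * lagSum n (normCol x n j) (normCol x n l) k from rfl, ← h1]
  simp only [Matrix.mul_apply, Matrix.transpose_apply, taperedCov, normDesign, Matrix.of_apply,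
    residualAutocov_eq, toeplitzForm]
  rw [Finset.mul_sum, Finset.sum_range (n := n) (f := fun i => (1 / (n : ℝ)) * _)]
  simp only [Finset.sum_mul]
  rw [Finset.sum_comm]
  refine Finset.sum_congr rfl fun i _ => ?_
  rw [Finset.mul_sum, Finset.sum_range (n := n)]
  refine Finset.sum_congr rfl fun k _ => ?_
  push_cast
  ring

/-- The coefficients of the projection of `e` on the normalised columns. -/
noncomputable def projCoeff (x : ℕ → Fin p → ℝ) (n : ℕ) (e : ℕ → ℝ) (j : Fin p) : ℝ :=
  ∑ l, (gram x n)⁻¹ j l * ∑ i ∈ Finset.range n, normCol x n l i * e i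

/-- The signal lies in the column space and is reproduced exactly by least squares; `β` drops out
and only the projection of the errors is subtracted. -/
theorem residual_observation {x : ℕ → Fin p → ℝ} {n : ℕ} (hx : ∀ j, colNorm x n j ≠ 0)
    (hdet : IsUnit (gram x n).det) (β : Fin p → ℝ) (e : ℤ → ℝ) (i : ℕ) :
    residual x (observation β x e) n i
      = e (i + 1) - ∑ j, normCol x n j i * projCoeff x n (fun i => e (i + 1)) j := by
  set ev : Fin n → ℝ := fun i => e ((i : ℕ) + 1) with hev
  have h1 : (fun i : Fin n => observation β x e i) = designMatrix x n *ᵥ β + ev := by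
    ext i
    simp [observation, designMatrix, Matrix.mulVec, dotProduct, hev]
  have h2 : leastSquares x (observation β x e) n
      = β + (normMatrix x n)⁻¹ *ᵥ ((gram x n)⁻¹ *ᵥ ((normDesign x n)ᵀ *ᵥ ev)) := by
    rw [leastSquares, h1, Matrix.mulVec_mulVec, Matrix.mulVec_add, leastSquares_matrix_eq hx]
    congr 1
    · rw [Matrix.mulVec_mulVec, designMatrix_eq hx]
      rw [show (normMatrix x n)⁻¹ * ((gram x n)⁻¹ * (normDesign x n)ᵀ)
          * (normDesign x n * normMatrix x n)
        = (normMatrix x n)⁻¹ * ((gram x n)⁻¹ * (gram x n * normMatrix x n)) by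
          simp only [gram, Matrix.mul_assoc]]
      rw [Matrix.nonsing_inv_mul_cancel_left _ _ hdet,
        Matrix.nonsing_inv_mul _ (isUnit_det_normMatrix hx), Matrix.one_mulVec]
    · simp only [Matrix.mulVec_mulVec]
  have h3 : (gram x n)⁻¹ *ᵥ ((normDesign x n)ᵀ *ᵥ ev) = projCoeff x n (fun i => e (i + 1)) := by
    ext j
    simp only [Matrix.mulVec, dotProduct, projCoeff, Matrix.transpose_apply, normDesign,
      Matrix.of_apply, hev]
    refine Finset.sum_congr rfl fun l _ => ?_
    rw [Finset.sum_range]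
  have h4 : ∀ j, ((normMatrix x n)⁻¹ *ᵥ projCoeff x n (fun i => e (i + 1))) j
      = (colNorm x n j)⁻¹ * projCoeff x n (fun i => e (i + 1)) j := by
    intro j
    have h5 : (normMatrix x n)⁻¹ = Matrix.diagonal fun j => (colNorm x n j)⁻¹ := by
      refine Matrix.inv_eq_right_inv ?_
      rw [normMatrix, Matrix.diagonal_mul_diagonal, ← Matrix.diagonal_one]
      congr 1
      ext j
      exact mul_inv_cancel₀ (hx j)
    rw [h5, Matrix.mulVec_diagonal]
  rw [residual, h2, h3, observation]
  simp only [Pi.add_apply, h4, mul_add, Finset.sum_add_distrib]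
  rw [add_sub_add_left_eq_sub]
  congr 1
  exact Finset.sum_congr rfl fun j _ => by rw [normCol, div_eq_mul_inv, mul_assoc]

/-- Two applications of Cauchy–Schwarz; the factor `p` bounds the sum of the squared norms of the
columns. -/
theorem sum_proj_sq_le (x : ℕ → Fin p → ℝ) (n : ℕ) (e : ℕ → ℝ) :
    ∑ i ∈ Finset.range n, (∑ j, normCol x n j i * projCoeff x n e j) ^ 2
      ≤ p * (∑ j, ∑ l, (gram x n)⁻¹ j l ^ 2)
        * ∑ l, (∑ i ∈ Finset.range n, normCol x n l i * e i) ^ 2 := by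
  have h1 : ∀ i, (∑ j, normCol x n j i * projCoeff x n e j) ^ 2
      ≤ (∑ j, normCol x n j i ^ 2) * ∑ j, projCoeff x n e j ^ 2 := fun i =>
    Finset.sum_mul_sq_le_sq_mul_sq _ _ _
  have h2 : ∀ j, projCoeff x n e j ^ 2 ≤ (∑ l, (gram x n)⁻¹ j l ^ 2)
      * ∑ l, (∑ i ∈ Finset.range n, normCol x n l i * e i) ^ 2 := fun j =>
    Finset.sum_mul_sq_le_sq_mul_sq _ _ _
  have h3 : ∑ i ∈ Finset.range n, ∑ j, normCol x n j i ^ 2 ≤ p := by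
    rw [Finset.sum_comm]
    refine (Finset.sum_le_sum fun j _ => sum_normCol_sq_le x n j).trans (le_of_eq ?_)
    simp
  have h4 : ∑ j, projCoeff x n e j ^ 2 ≤ (∑ j, ∑ l, (gram x n)⁻¹ j l ^ 2)
        * ∑ l, (∑ i ∈ Finset.range n, normCol x n l i * e i) ^ 2 := by
    rw [Finset.sum_mul]
    exact Finset.sum_le_sum fun j _ => h2 j
  refine (Finset.sum_le_sum fun i _ => h1 i).trans ?_
  rw [← Finset.sum_mul, mul_assoc]
  exact mul_le_mul h3 h4 (Finset.sum_nonneg fun _ _ => sq_nonneg _) (Nat.cast_nonneg _)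

/-- The correlation matrices at all lags, `R(-k) = R(k)ᵗ`. -/
def extCorr (R : ℕ → Matrix (Fin p) (Fin p) ℝ) (k : ℤ) : Matrix (Fin p) (Fin p) ℝ :=
  if 0 ≤ k then R k.natAbs else (R k.natAbs)ᵀ

/-- `lagSum` advances the first column at positive lags whereas `empCorr` advances the second, hence
the sign in `extCorr R (-k)`. -/
theorem HannanDesign.lagConvergent {x : ℕ → Fin p → ℝ} {R : ℕ → Matrix (Fin p) (Fin p) ℝ}
    (hX : HannanDesign x R) (j l : Fin p) :
    LagConvergent (fun n => normCol x n j) (fun n => normCol x n l)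
      (fun k => extCorr R (-k) j l) where
  left n := sum_normCol_sq_le x n j
  right n := sum_normCol_sq_le x n l
  tendsto k := by
    rcases le_or_gt k 0 with hk | hk
    · obtain ⟨m, rfl⟩ : ∃ m : ℕ, k = -m := ⟨k.natAbs, by omega⟩
      have := hX.corr_tendsto j l m
      simp only [neg_neg, extCorr, Nat.cast_nonneg, if_true, Int.natAbs_natCast, lagSum_neg,
        lagSum_normCol]
      exact this
    · obtain ⟨m, rfl⟩ : ∃ m : ℕ, k = m := ⟨k.natAbs, by omega⟩
      have h0 : ¬ (0 : ℤ) ≤ -m := by omega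
      simp only [extCorr, h0, if_false, Int.natAbs_neg, Int.natAbs_natCast, lagSum_normCol]
      exact hX.corr_tendsto l j m

theorem HannanDesign.tendsto_gram {x : ℕ → Fin p → ℝ} {R : ℕ → Matrix (Fin p) (Fin p) ℝ}
    (hX : HannanDesign x R) : Tendsto (gram x) atTop (𝓝 (R 0)) := by
  refine tendsto_pi_nhds.2 fun j => tendsto_pi_nhds.2 fun l => ?_
  simp only [gram_apply]
  exact hX.corr_tendsto j l 0

theorem HannanDesign.isUnit_det {x : ℕ → Fin p → ℝ} {R : ℕ → Matrix (Fin p) (Fin p) ℝ}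
    (hX : HannanDesign x R) : IsUnit (R 0).det := hX.posDef.det_pos.ne'.isUnit

theorem HannanDesign.eventually_isUnit {x : ℕ → Fin p → ℝ} {R : ℕ → Matrix (Fin p) (Fin p) ℝ}
    (hX : HannanDesign x R) : ∀ᶠ n in atTop, IsUnit (gram x n).det := by
  have h1 : Tendsto (fun n => (gram x n).det) atTop (𝓝 (R 0).det) :=
    ((Continuous.matrix_det continuous_id).tendsto _).comp hX.tendsto_gram
  filter_upwards [h1.eventually_ne hX.isUnit_det.ne_zero] with n hn
  exact hn.isUnit

theorem HannanDesign.eventually_colNorm_ne {x : ℕ → Fin p → ℝ} {R : ℕ → Matrix (Fin p) (Fin p) ℝ}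
    (hX : HannanDesign x R) : ∀ᶠ n in atTop, ∀ j, colNorm x n j ≠ 0 :=
  eventually_all.2 fun j => (hX.norm_tendsto j).eventually_ne_atTop 0

theorem HannanDesign.tendsto_gram_inv {x : ℕ → Fin p → ℝ} {R : ℕ → Matrix (Fin p) (Fin p) ℝ}
    (hX : HannanDesign x R) : Tendsto (fun n => (gram x n)⁻¹) atTop (𝓝 (R 0)⁻¹) := by
  have h1 : Tendsto (fun n => (gram x n).det) atTop (𝓝 (R 0).det) :=
    ((Continuous.matrix_det continuous_id).tendsto _).comp hX.tendsto_gram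
  have h2 : Tendsto (fun n => (gram x n).adjugate) atTop (𝓝 (R 0).adjugate) :=
    ((Continuous.matrix_adjugate continuous_id).tendsto _).comp hX.tendsto_gram
  simp only [Matrix.inv_def, Ring.inverse_eq_inv']
  exact (h1.inv₀ hX.isUnit_det.ne_zero).smul h2

end NormalisedDesign

/-! ### The estimator for a deterministic design -/

theorem tendsto_sandwich {p : ℕ} {N : ℕ → Matrix (Fin p) (Fin p) ℝ} {A S : Matrix (Fin p) (Fin p) ℝ}
    (hN : Tendsto N atTop (𝓝 A)) : Tendsto (fun n => N n * S * N n) atTop (𝓝 (A * S * A)) :=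
  (hN.mul tendsto_const_nhds).mul hN

theorem abs_sum_mul_sub_le {ι : Type*} [Fintype ι] (u q s : ι → ℝ) (c : ℝ) :
    |(∑ a, u a * q a) * c - (∑ a, u a * s a) * c| ≤ ∑ a, |u a| * |c| * |q a - s a| := by
  rw [Finset.sum_mul, Finset.sum_mul, ← Finset.sum_sub_distrib]
  refine (Finset.abs_sum_le_sum_abs _ _).trans (Finset.sum_le_sum fun a _ => le_of_eq ?_)
  rw [← abs_mul, ← abs_mul]
  congr 1
  ring

section FixedDesign

variable {Ω : Type*} {F₀ : MeasurableSpace Ω} [mΩ : MeasurableSpace Ω] {P : Measure Ω}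
  {T : Ω ≃ᵐ Ω} {ε₀ : Ω → ℝ}

theorem integral_err_mul_err (hT : MeasurePreserving T P P) (s t : ℤ) :
    ∫ ω, err T ε₀ s ω * err T ε₀ t ω ∂P = autocov P T ε₀ (s - t) := by
  have h1 := integral_comp_iter hT t (fun ω => err T ε₀ 0 ω * err T ε₀ (s - t) ω)
  rw [autocov, ← h1]
  congr 1
  ext ω
  simp only [err]
  rw [← iter_add, ← iter_add, zero_add, sub_add_cancel, mul_comm]

/-- The second moment is the Toeplitz form of `γ`, so Schur's test bounds it uniformly in `n`. Hence
the projection of the errors on the columns stays of order one. -/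
theorem integral_sq_sum_err_le (hT : MeasurePreserving T P P) (hε : MemLp ε₀ 2 P)
    (hγ : Summable fun k : ℤ => |autocov P T ε₀ k|) {n : ℕ} {z : ℕ → ℝ}
    (hz : ∑ i ∈ Finset.range n, z i ^ 2 ≤ 1) :
    ∫ ω, (∑ i ∈ Finset.range n, z i * err T ε₀ (i + 1) ω) ^ 2 ∂P
      ≤ ∑' k : ℤ, |autocov P T ε₀ k| := by
  have hI : ∀ i j : ℕ, Integrable (fun ω => z i * z j * (err T ε₀ (i + 1) ω * err T ε₀ (j + 1) ω)) P :=
    fun i j => Integrable.const_mul ((memLp_err hT hε _).integrable_mul (memLp_err hT hε _)) _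
  have h1 : ∫ ω, (∑ i ∈ Finset.range n, z i * err T ε₀ (i + 1) ω) ^ 2 ∂P
      = toeplitzForm n (autocov P T ε₀) z z := by
    have h2 : ∀ ω, (∑ i ∈ Finset.range n, z i * err T ε₀ (i + 1) ω) ^ 2
        = ∑ i ∈ Finset.range n, ∑ j ∈ Finset.range n,
          z i * z j * (err T ε₀ (i + 1) ω * err T ε₀ (j + 1) ω) := by
      intro ω
      rw [sq, Finset.sum_mul_sum]
      exact Finset.sum_congr rfl fun i _ => Finset.sum_congr rfl fun j _ => by ring
    simp only [h2]
    rw [integral_finsetSum _ fun i _ => integrable_finsetSum _ fun j _ => hI i j, toeplitzForm]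
    refine Finset.sum_congr rfl fun i _ => ?_
    rw [integral_finsetSum _ fun j _ => hI i j]
    refine Finset.sum_congr rfl fun j _ => ?_
    rw [integral_const_mul, integral_err_mul_err hT, add_sub_add_right_eq_sub, mul_comm]
  rw [h1]
  refine (le_abs_self _).trans ((abs_toeplitzForm_le_of_summable hγ z).trans ?_)
  exact mul_le_of_le_one_right (tsum_nonneg fun _ => abs_nonneg _) hz

variable {p : ℕ} {x : ℕ → Fin p → ℝ} {β : Fin p → ℝ}

theorem memLp_residual [IsProbabilityMeasure P] (hT : MeasurePreserving T P P) (hε : MemLp ε₀ 2 P)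
    (x : ℕ → Fin p → ℝ) (β : Fin p → ℝ) (n i : ℕ) :
    MemLp (fun ω => residual x (observation β x fun i => err T ε₀ i ω) n i) 2 P := by
  have h1 : ∀ i, MemLp (fun ω => observation β x (fun i => err T ε₀ i ω) i) 2 P := by
    intro i
    have h0 : MemLp (fun ω => (∑ j, x i j * β j) + err T ε₀ ((i : ℤ) + 1) ω) 2 P :=
      (memLp_const (∑ j, x i j * β j)).add (memLp_err hT hε ((i : ℤ) + 1))
    exact h0
  have h2 : ∀ j, MemLp (fun ω =>
      leastSquares x (observation β x fun i => err T ε₀ i ω) n j) 2 P := by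
    intro j
    obtain ⟨A, hA⟩ : ∃ A : Matrix (Fin p) (Fin p) ℝ,
      A = ((designMatrix x n)ᵀ * designMatrix x n)⁻¹ := ⟨_, rfl⟩
    simp only [leastSquares, ← hA, Matrix.mulVec, dotProduct]
    refine memLp_finsetSum _ fun l _ => ?_
    refine MemLp.const_mul ?_ (A j l)
    refine memLp_finsetSum _ fun k _ => ?_
    exact MemLp.const_mul (h1 k) ((designMatrix x n)ᵀ l k)
  have h3 : MemLp (fun ω => ∑ j, x i j *
      leastSquares x (observation β x fun i => err T ε₀ i ω) n j) 2 P :=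
    memLp_finsetSum _ fun j _ => MemLp.const_mul (h2 j) _
  exact (h1 i).sub h3

theorem integrable_toeplitzForm_residual [IsProbabilityMeasure P] (hT : MeasurePreserving T P P)
    (hε : MemLp ε₀ 2 P) (x : ℕ → Fin p → ℝ) (β : Fin p → ℝ) (n : ℕ) (w : ℤ → ℝ) :
    Integrable (fun ω => toeplitzForm n w
      (residual x (observation β x fun i => err T ε₀ i ω) n)
      (residual x (observation β x fun i => err T ε₀ i ω) n)) P :=
  integrable_finsetSum _ fun _ _ => integrable_finsetSum _ fun _ _ => Integrable.const_mul
    ((memLp_residual hT hε x β n _).integrable_mul (memLp_residual hT hε x β n _)) _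

/-- The residuals may be replaced by the errors. -/
theorem tendsto_toeplitzForm_residual_sub [IsProbabilityMeasure P] (hT : MeasurePreserving T P P)
    (hε : MemLp ε₀ 2 P) (hγ : Summable fun k : ℤ => |autocov P T ε₀ k|)
    {R : ℕ → Matrix (Fin p) (Fin p) ℝ} (hX : HannanDesign x R) (β : Fin p → ℝ)
    {K : ℝ → ℝ} (hK : IsKernel K) {h : ℕ → ℝ} (hpos : ∀ n, 0 < h n)
    (hhn : Tendsto (fun n : ℕ => h n / √n) atTop (𝓝 0)) (j l : Fin p) :
    Tendsto (fun n : ℕ => ∫ ω, |(1 / (n : ℝ)) *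
      toeplitzForm n (taperWeight K (h n) n (normCol x n j) (normCol x n l))
        (residual x (observation β x fun i => err T ε₀ i ω) n)
        (residual x (observation β x fun i => err T ε₀ i ω) n)
      - (1 / (n : ℝ)) * toeplitzForm n (taperWeight K (h n) n (normCol x n j) (normCol x n l))
        (fun i => err T ε₀ (i + 1) ω) (fun i => err T ε₀ (i + 1) ω)| ∂P) atTop (𝓝 0) := by
  obtain ⟨B, A, hB0, hA, hband⟩ := hK.exists_band
  set CN : ℕ → ℝ := fun n => ∑ j, ∑ l, (gram x n)⁻¹ j l ^ 2 with hCN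
  have hCN0 : ∀ n, 0 ≤ CN n := fun n =>
    Finset.sum_nonneg fun _ _ => Finset.sum_nonneg fun _ _ => sq_nonneg _
  have hCNlim : Tendsto CN atTop (𝓝 (∑ j, ∑ l, (R 0)⁻¹ j l ^ 2)) :=
    tendsto_finsetSum _ fun j _ => tendsto_finsetSum _ fun l _ =>
      ((hX.tendsto_gram_inv.apply_nhds j).apply_nhds l).pow 2
  set Γ := ∑' k : ℤ, |autocov P T ε₀ k| with hΓ
  have hΓ0 : 0 ≤ Γ := tsum_nonneg fun _ => abs_nonneg _
  set σ := ∫ ω, ε₀ ω ^ 2 ∂P with hσ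
  have hσ0 : 0 ≤ σ := integral_nonneg fun _ => sq_nonneg _
  have hsq : Tendsto (fun n : ℕ => 1 / √(n : ℝ)) atTop (𝓝 0) := by
    simp only [one_div]
    exact (Real.tendsto_sqrt_atTop.comp tendsto_natCast_atTop_atTop).inv_tendsto_atTop
  have hmain : Tendsto (fun n : ℕ => (2 * A * (h n / √n) + 1 / √n) * B
      * (σ + 2 * (p * CN n * (p * Γ)))) atTop (𝓝 0) := by
    have h1 := ((hhn.const_mul (2 * A)).add hsq).mul_const B
    have h2 := (((hCNlim.const_mul (p : ℝ)).mul_const (p * Γ)).const_mul 2).const_add σ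
    have := h1.mul h2
    simpa using this
  refine squeeze_zero' (Eventually.of_forall fun _ => integral_nonneg fun _ => abs_nonneg _) ?_ hmain
  filter_upwards [hX.eventually_isUnit, hX.eventually_colNorm_ne, eventually_ge_atTop 1]
    with n hdet hcol hn1
  obtain ⟨hwB, hwm⟩ := hband (h n) (hpos n) n _ _ (sum_normCol_sq_le x n j) (sum_normCol_sq_le x n l)
  set m := ⌊A * h n⌋₊ with hm
  set w := taperWeight K (h n) n (normCol x n j) (normCol x n l) with hw
  have hn : (0 : ℝ) < n := by exact_mod_cast hn1
  have hsn : 0 < √(n : ℝ) := Real.sqrt_pos.2 hn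
  -- This balances `∑ ε²`, of order `n`, against the correction of order one; with a band of width
  -- `hₙ` and the factor `1/n` the total is `O(hₙ/√n)`.
  set t := √(n : ℝ) with ht
  have htt : t * t = n := Real.mul_self_sqrt hn.le
  have ht1 : 1 ≤ t := by
    rw [ht]
    exact Real.one_le_sqrt.2 (by exact_mod_cast hn1)
  set Y : Ω → ℝ := fun ω => ∑ l, (∑ i ∈ Finset.range n, normCol x n l i * err T ε₀ (i + 1) ω) ^ 2
    with hY
  have hYl : ∀ l, Integrable (fun ω =>
      (∑ i ∈ Finset.range n, normCol x n l i * err T ε₀ (i + 1) ω) ^ 2) P := fun l =>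
    (memLp_finsetSum _ fun i _ => (memLp_err hT hε _).const_mul _).integrable_sq
  have hYi : Integrable Y P := integrable_finsetSum _ fun l _ => hYl l
  have hYb : ∫ ω, Y ω ∂P ≤ p * Γ := by
    rw [hY, integral_finsetSum _ fun l _ => hYl l]
    refine (Finset.sum_le_sum fun l _ =>
      integral_sq_sum_err_le hT hε hγ (sum_normCol_sq_le x n l)).trans (le_of_eq ?_)
    simp [hΓ]
  have hEi : ∀ i : ℕ, Integrable (fun ω => err T ε₀ (i + 1) ω ^ 2) P := fun i =>
    (memLp_err hT hε _).integrable_sq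
  have hEs : Integrable (fun ω => ∑ i ∈ Finset.range n, err T ε₀ (i + 1) ω ^ 2) P :=
    integrable_finsetSum _ fun i _ => hEi i
  have hEb : ∫ ω, ∑ i ∈ Finset.range n, err T ε₀ (i + 1) ω ^ 2 ∂P = n * σ := by
    rw [integral_finsetSum _ fun i _ => hEi i]
    have : ∀ i : ℕ, ∫ ω, err T ε₀ (i + 1) ω ^ 2 ∂P = σ := fun i =>
      integral_comp_iter hT (i + 1) (fun ω => ε₀ ω ^ 2)
    simp [this]
  have hpt : ∀ ω, |(1 / (n : ℝ)) * toeplitzForm n w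
        (residual x (observation β x fun i => err T ε₀ i ω) n)
        (residual x (observation β x fun i => err T ε₀ i ω) n)
      - (1 / (n : ℝ)) * toeplitzForm n w
        (fun i => err T ε₀ (i + 1) ω) (fun i => err T ε₀ (i + 1) ω)|
      ≤ (1 / (n : ℝ)) * ((2 * m + 1) * B * (t⁻¹ * ∑ i ∈ Finset.range n, err T ε₀ (i + 1) ω ^ 2
        + (t + 1) * (p * CN n * Y ω))) := by
    intro ω
    have h1 : residual x (observation β x fun i => err T ε₀ i ω) n = fun i : ℕ =>
        err T ε₀ (i + 1) ω - ∑ j, normCol x n j i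
          * projCoeff x n (fun i : ℕ => err T ε₀ (i + 1) ω) j :=
      funext fun i => residual_observation hcol hdet β (fun i => err T ε₀ i ω) i
    rw [← mul_sub, abs_mul, abs_of_nonneg (by positivity : (0 : ℝ) ≤ 1 / n), h1]
    refine mul_le_mul_of_nonneg_left ?_ (by positivity)
    refine (abs_toeplitzForm_sub_le hwB hwm hsn _ _).trans ?_
    refine mul_le_mul_of_nonneg_left ?_ (by positivity)
    gcongr
    exact sum_proj_sq_le x n _
  have hdom : Integrable (fun ω => (1 / (n : ℝ)) * ((2 * m + 1) * B * (t⁻¹ *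
      ∑ i ∈ Finset.range n, err T ε₀ (i + 1) ω ^ 2 + (t + 1) * (p * CN n * Y ω)))) P :=
    (((hEs.const_mul _).add ((hYi.const_mul _).const_mul _)).const_mul _).const_mul _
  refine (integral_mono_of_nonneg (Eventually.of_forall fun _ => abs_nonneg _) hdom
    (Eventually.of_forall hpt)).trans ?_
  rw [integral_const_mul, integral_const_mul, integral_add (hEs.const_mul _)
    ((hYi.const_mul _).const_mul _), integral_const_mul, integral_const_mul, integral_const_mul, hEb]
  have hmA : (m : ℝ) ≤ A * h n := Nat.floor_le (mul_nonneg hA (hpos n).le)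
  -- Here `t ≥ 1` absorbs the `1` in `t + 1`, so that everything scales with `t`.
  have e1 : (1 / (n : ℝ)) * ((2 * m + 1) * B * (t⁻¹ * (n * σ) + (t + 1) * (p * CN n * ∫ ω, Y ω ∂P)))
      ≤ (1 / (n : ℝ)) * ((2 * (A * h n) + 1) * B * (t⁻¹ * (n * σ)
        + (t + t) * (p * CN n * (p * Γ)))) := by
    have := hCN0 n
    have := (hpos n).le
    have hY0 : 0 ≤ ∫ ω, Y ω ∂P := integral_nonneg fun ω => Finset.sum_nonneg fun _ _ => sq_nonneg _
    gcongr
  refine e1.trans (le_of_eq ?_)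
  rw [← htt]
  field_simp
  ring

theorem covEstimator_apply_eq {n : ℕ} (hx : ∀ j, colNorm x n j ≠ 0) (K : ℝ → ℝ) (h : ℝ) (y : ℕ → ℝ)
    (j l : Fin p) :
    covEstimator K h x y n j l = ∑ b, (∑ a, (gram x n)⁻¹ j a * ((1 / (n : ℝ)) *
      toeplitzForm n (taperWeight K h n (normCol x n a) (normCol x n b))
        (residual x y n) (residual x y n))) * (gram x n)⁻¹ b l := by
  rw [covEstimator_eq hx, Matrix.mul_apply]
  simp only [Matrix.mul_apply (M := (gram x n)⁻¹), sandwich_taperedCov_apply]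

/-- The limit of the estimator. -/
noncomputable def limitMatrix (γ : ℤ → ℝ) (R : ℕ → Matrix (Fin p) (Fin p) ℝ) :
    Matrix (Fin p) (Fin p) ℝ :=
  (R 0)⁻¹ * Matrix.of (fun j l => ∑' k : ℤ, γ k * extCorr R k j l) * (R 0)⁻¹

/-- For a fixed design the inverse Gram matrices are deterministic and converge, so only the middle
factor of the sandwich needs a probabilistic argument. -/
theorem tendsto_integral_covEstimator_of_toeplitzForm [IsProbabilityMeasure P]
    (hT : MeasurePreserving T P P) (hε : MemLp ε₀ 2 P)
    {R : ℕ → Matrix (Fin p) (Fin p) ℝ} (hX : HannanDesign x R) (β : Fin p → ℝ)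
    {K : ℝ → ℝ} {h : ℕ → ℝ} {S : Matrix (Fin p) (Fin p) ℝ}
    (hS : ∀ j l, Tendsto (fun n : ℕ => ∫ ω, |(1 / (n : ℝ)) *
      toeplitzForm n (taperWeight K (h n) n (normCol x n j) (normCol x n l))
        (residual x (observation β x fun i => err T ε₀ i ω) n)
        (residual x (observation β x fun i => err T ε₀ i ω) n) - S j l| ∂P) atTop (𝓝 0))
    (j l : Fin p) :
    Tendsto (fun n : ℕ => ∫ ω, |covEstimator K (h n) x (observation β x fun i => err T ε₀ i ω) n j l
      - ((R 0)⁻¹ * S * (R 0)⁻¹) j l| ∂P) atTop (𝓝 0) := by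
  set N : ℕ → Matrix (Fin p) (Fin p) ℝ := fun n => (gram x n)⁻¹ with hN
  have hNlim := hX.tendsto_gram_inv
  have hNe : ∀ a b, Tendsto (fun n => |N n a b|) atTop (𝓝 |(R 0)⁻¹ a b|) := fun a b =>
    ((hNlim.apply_nhds a).apply_nhds b).abs
  set Q : ℕ → Fin p → Fin p → Ω → ℝ := fun n a b ω => (1 / (n : ℝ)) *
      toeplitzForm n (taperWeight K (h n) n (normCol x n a) (normCol x n b))
        (residual x (observation β x fun i => err T ε₀ i ω) n)
        (residual x (observation β x fun i => err T ε₀ i ω) n) with hQ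
  have hQi : ∀ n a b, Integrable (fun ω => |Q n a b ω - S a b|) P := fun n a b =>
    (((integrable_toeplitzForm_residual hT hε x β n _).const_mul _).sub (integrable_const _)).abs
  have hlim : Tendsto (fun n => (∑ b, ∑ a, |N n j a| * |N n b l| * ∫ ω, |Q n a b ω - S a b| ∂P)
      + |(N n * S * N n) j l - ((R 0)⁻¹ * S * (R 0)⁻¹) j l|) atTop (𝓝 0) := by
    have h1 : Tendsto (fun n => ∑ b, ∑ a, |N n j a| * |N n b l| * ∫ ω, |Q n a b ω - S a b| ∂P)
        atTop (𝓝 (∑ b, ∑ a, |(R 0)⁻¹ j a| * |(R 0)⁻¹ b l| * 0)) :=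
      tendsto_finsetSum _ fun b _ => tendsto_finsetSum _ fun a _ =>
        ((hNe j a).mul (hNe b l)).mul (hS a b)
    have h2 := ((((tendsto_sandwich (S := S) hNlim).apply_nhds j).apply_nhds l).sub_const
      (((R 0)⁻¹ * S * (R 0)⁻¹) j l)).abs
    have := h1.add h2
    simpa using this
  refine squeeze_zero' (Eventually.of_forall fun _ => integral_nonneg fun _ => abs_nonneg _) ?_ hlim
  filter_upwards [hX.eventually_colNorm_ne] with n hcol
  have hpt : ∀ ω, |covEstimator K (h n) x (observation β x fun i => err T ε₀ i ω) n j l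
      - ((R 0)⁻¹ * S * (R 0)⁻¹) j l| ≤ (∑ b, ∑ a, |N n j a| * |N n b l| * |Q n a b ω - S a b|)
      + |(N n * S * N n) j l - ((R 0)⁻¹ * S * (R 0)⁻¹) j l| := by
    intro ω
    refine (abs_sub_le _ ((N n * S * N n) j l) _).trans (add_le_add ?_ le_rfl)
    have h1 : (N n * S * N n) j l = ∑ b, (∑ a, N n j a * S a b) * N n b l := by
      rw [Matrix.mul_apply]
      exact Finset.sum_congr rfl fun b _ => by rw [Matrix.mul_apply]
    rw [covEstimator_apply_eq hcol, h1, ← Finset.sum_sub_distrib]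
    refine (Finset.abs_sum_le_sum_abs _ _).trans (Finset.sum_le_sum fun b _ => ?_)
    exact abs_sum_mul_sub_le (N n j) (fun a => Q n a b ω) (fun a => S a b) (N n b l)
  have hI2 : Integrable (fun ω => ∑ b, ∑ a, |N n j a| * |N n b l| * |Q n a b ω - S a b|) P :=
    integrable_finsetSum _ fun b _ => integrable_finsetSum _ fun a _ => (hQi n a b).const_mul _
  refine (integral_mono_of_nonneg (Eventually.of_forall fun _ => abs_nonneg _)
    (hI2.add (integrable_const _)) (Eventually.of_forall hpt)).trans (le_of_eq ?_)
  rw [integral_add' hI2 (integrable_const _), integral_const,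
    integral_finsetSum _ fun b _ => integrable_finsetSum _ fun a _ => (hQi n a b).const_mul _]
  simp only [probReal_univ, one_smul]
  congr 1
  refine Finset.sum_congr rfl fun b _ => ?_
  rw [integral_finsetSum _ fun a _ => (hQi n a b).const_mul _]
  exact Finset.sum_congr rfl fun a _ => integral_const_mul _ _

/-- The bandwidth condition forces `hₙ = o(√n)` unless the errors vanish. -/
theorem tendsto_bandwidth_div_sqrt [IsProbabilityMeasure P] (hε : MemLp ε₀ 2 P)
    (hne : ¬ ε₀ =ᵐ[P] 0) {h : ℕ → ℝ} (hpos : ∀ n, 0 < h n) (hh : Tendsto h atTop atTop)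
    (hcond : Tendsto (fun n : ℕ => h n * ∫ ω, |ε₀ ω| ^ 2 * min 1 (h n / n * |ε₀ ω| ^ 2) ∂P)
      atTop (𝓝 0)) : Tendsto (fun n : ℕ => h n / √n) atTop (𝓝 0) := by
  -- Errors that are not almost surely zero exceed some level with positive probability; restricting
  -- the integral to that event bounds it from below.
  obtain ⟨c, hc, hq⟩ : ∃ c : ℝ, 0 < c ∧ 0 < P.real {ω | c ≤ |ε₀ ω|} := by
    by_contra hcon
    push Not at hcon
    refine hne ?_
    have h1 : ∀ k : ℕ, ∀ᵐ ω ∂P, |ε₀ ω| < 1 / ((k : ℝ) + 1) := by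
      intro k
      have h2 := le_antisymm (hcon (1 / ((k : ℝ) + 1)) (by positivity)) measureReal_nonneg
      rw [measureReal_eq_zero_iff] at h2
      rw [ae_iff]
      simpa only [not_lt] using h2
    filter_upwards [ae_all_iff.2 h1] with ω hω
    have h3 : |ε₀ ω| ≤ 0 := ge_of_tendsto' tendsto_one_div_add_atTop_nhds_zero_nat fun k => (hω k).le
    exact abs_nonpos_iff.1 h3
  set q := P.real {ω | c ≤ |ε₀ ω|} with hqdef
  have hlow : ∀ n : ℕ, c ^ 2 * min 1 (h n / n * c ^ 2) * q
      ≤ ∫ ω, |ε₀ ω| ^ 2 * min 1 (h n / n * |ε₀ ω| ^ 2) ∂P := by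
    intro n
    have hhn : 0 ≤ h n / n := div_nonneg (hpos n).le (Nat.cast_nonneg _)
    have hi : Integrable (fun ω => |ε₀ ω| ^ 2 * min 1 (h n / n * |ε₀ ω| ^ 2)) P := by
      refine Integrable.mono' hε.integrable_sq ?_ (Eventually.of_forall fun ω => ?_)
      · have h0 : AEMeasurable ε₀ P := hε.1.aemeasurable
        exact AEMeasurable.aestronglyMeasurable ((h0.abs.pow_const 2).mul
          (aemeasurable_const.min ((h0.abs.pow_const 2).const_mul _)))
      · rw [norm_mul, Real.norm_eq_abs, Real.norm_eq_abs, sq_abs, abs_of_nonneg (sq_nonneg (ε₀ ω)),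
          abs_of_nonneg (le_min zero_le_one (by positivity))]
        exact mul_le_of_le_one_right (sq_nonneg _) (min_le_left _ _)
    have h1 := mul_meas_ge_le_integral_of_nonneg (μ := P) (f := fun ω =>
      |ε₀ ω| ^ 2 * min 1 (h n / n * |ε₀ ω| ^ 2))
      (Eventually.of_forall fun ω => mul_nonneg (sq_nonneg _) (le_min zero_le_one (by positivity)))
      hi (c ^ 2 * min 1 (h n / n * c ^ 2))
    refine le_trans (mul_le_mul_of_nonneg_left (measureReal_mono ?_)
      (mul_nonneg (sq_nonneg _) (le_min zero_le_one (by positivity)))) h1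
    intro ω hω
    simp only [Set.mem_ofPred_eq] at hω ⊢
    have h3 : 0 ≤ min 1 (h n / n * c ^ 2) := le_min zero_le_one (by positivity)
    have h2 : c ^ 2 ≤ |ε₀ ω| ^ 2 := pow_le_pow_left₀ hc.le hω 2
    exact mul_le_mul h2 (min_le_min le_rfl (mul_le_mul_of_nonneg_left h2 hhn)) h3 (sq_nonneg _)
  have hlim1 : Tendsto (fun n : ℕ => h n * min 1 (h n / n * c ^ 2)) atTop (𝓝 0) := by
    have h1 := hcond.div_const (c ^ 2 * q)
    rw [zero_div] at h1
    refine squeeze_zero (fun n => ?_) (fun n => ?_) h1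
    · exact mul_nonneg (hpos n).le (le_min zero_le_one
        (mul_nonneg (div_nonneg (hpos n).le (Nat.cast_nonneg _)) (sq_nonneg _)))
    · rw [le_div_iff₀ (by positivity)]
      calc _ = h n * (c ^ 2 * min 1 (h n / n * c ^ 2) * q) := by ring
        _ ≤ _ := mul_le_mul_of_nonneg_left (hlow n) (hpos n).le
  -- Once `hₙ ≥ 1`, a minimum equal to `1` would keep the product at least `1`, so the minimum is
  -- eventually its second argument.
  have hlim2 : Tendsto (fun n : ℕ => h n * (h n / n * c ^ 2)) atTop (𝓝 0) := by
    refine hlim1.congr' ?_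
    filter_upwards [hh.eventually_ge_atTop 1, hlim1.eventually_lt_const zero_lt_one] with n h1 h2
    rw [min_eq_right]
    by_contra h3
    rw [min_eq_left (not_le.1 h3).le] at h2
    linarith
  have hlim3 : Tendsto (fun n : ℕ => √(h n * (h n / n * c ^ 2)) / c) atTop (𝓝 0) := by
    have := (hlim2.sqrt).div_const c
    simpa using this
  refine hlim3.congr fun n => ?_
  rw [show h n * (h n / n * c ^ 2) = (h n * c) ^ 2 / n by ring, Real.sqrt_div (sq_nonneg _),
    Real.sqrt_sq (mul_nonneg (hpos n).le hc.le)]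
  field_simp

theorem tendsto_integral_covEstimator [IsProbabilityMeasure P] (hT : MeasurePreserving T P P)
    (hF₀ : F₀ ≤ mΩ) (hF : F₀ ≤ F₀.comap T)
    (hbot : ∀ A : Set Ω, MeasurableSet[⨅ i : ℤ, filt F₀ T i] A → P A = 0 ∨ P A = 1)
    (hε_meas : Measurable[⨆ i : ℤ, filt F₀ T i] ε₀) (hε : MemLp ε₀ 2 P)
    (hε0 : ∫ ω, ε₀ ω ∂P = 0) (hC1 : HannanCondition F₀ P T ε₀)
    {R : ℕ → Matrix (Fin p) (Fin p) ℝ} (hX : HannanDesign x R) (β : Fin p → ℝ)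
    {K : ℝ → ℝ} (hK : IsKernel K) {h : ℕ → ℝ} (hpos : ∀ n, 0 < h n) (hh : Tendsto h atTop atTop)
    (hcond : Tendsto (fun n : ℕ => h n * ∫ ω, |ε₀ ω| ^ 2 * min 1 (h n / n * |ε₀ ω| ^ 2) ∂P)
      atTop (𝓝 0)) (j l : Fin p) :
    Tendsto (fun n : ℕ => ∫ ω, |covEstimator K (h n) x (observation β x fun i => err T ε₀ i ω) n j l
      - limitMatrix (autocov P T ε₀) R j l| ∂P) atTop (𝓝 0) := by
  refine tendsto_integral_covEstimator_of_toeplitzForm hT hε hX β (fun j l => ?_) j l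
  simp only [Matrix.of_apply]
  -- For vanishing errors the bandwidth condition says nothing, but residuals and autocovariances
  -- are then zero.
  by_cases hne : ε₀ =ᵐ[P] 0
  · have herr : ∀ᵐ ω ∂P, ∀ i, err T ε₀ i ω = 0 := ae_all_iff.2 fun i =>
      (measurePreserving_iter hT i).quasiMeasurePreserving.ae hne
    have hγ : ∀ k, autocov P T ε₀ k = 0 := fun k => by
      rw [autocov]
      refine integral_eq_zero_of_ae ?_
      filter_upwards [herr] with ω hω
      simp [hω]
    refine tendsto_const_nhds.congr' ?_
    filter_upwards [hX.eventually_isUnit, hX.eventually_colNorm_ne] with n hdet hcol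
    symm
    refine integral_eq_zero_of_ae ?_
    filter_upwards [herr] with ω hω
    have h1 : residual x (observation β x fun i => err T ε₀ i ω) n = fun _ => 0 := by
      ext i
      rw [residual_observation hcol hdet]
      simp [hω, projCoeff]
    simp [h1, hγ, toeplitzForm]
  · have hsq := tendsto_bandwidth_div_sqrt hε hne hpos hh hcond
    have hhn : Tendsto (fun n : ℕ => h n / n) atTop (𝓝 0) := by
      refine squeeze_zero' (Eventually.of_forall fun n =>
        div_nonneg (hpos n).le (Nat.cast_nonneg _)) ?_ hsq
      filter_upwards [eventually_ge_atTop 1] with n hn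
      have h1 : (1 : ℝ) ≤ n := by exact_mod_cast hn
      refine div_le_div_of_nonneg_left (hpos n).le (Real.sqrt_pos.2 (by linarith)) ?_
      rw [Real.sqrt_le_left (by linarith)]
      nlinarith
    have hγ := summable_abs_autocov hT hF₀ hF hbot hε_meas hε hε0 hC1
    have h1 := tendsto_toeplitzForm_residual_sub hT hε hγ hX β hK hpos hsq j l
    have h2 := tendsto_toeplitzForm_err hT hF₀ hF hbot hε_meas hε hε0 hC1 hK
      (hX.lagConvergent j l) hpos hh hhn
    simp only [neg_neg] at h2
    have h3 := h1.add h2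
    rw [add_zero] at h3
    refine squeeze_zero (fun _ => integral_nonneg fun _ => abs_nonneg _) (fun n => ?_) h3
    have hr := (integrable_toeplitzForm_residual hT hε x β n
      (taperWeight K (h n) n (normCol x n j) (normCol x n l))).const_mul (1 / (n : ℝ))
    have he : Integrable (fun ω => (1 / (n : ℝ)) * toeplitzForm n
        (taperWeight K (h n) n (normCol x n j) (normCol x n l))
        (fun i => err T ε₀ (i + 1) ω) (fun i => err T ε₀ (i + 1) ω)) P :=
      Integrable.const_mul (integrable_finsetSum _ fun _ _ => integrable_finsetSum _ fun _ _ =>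
        Integrable.const_mul ((memLp_err hT hε _).integrable_mul (memLp_err hT hε _)) _) _
    refine (integral_mono (hr.sub (integrable_const _)).abs
      ((hr.sub he).abs.add (he.sub (integrable_const _)).abs)
      fun ω => abs_sub_le _ _ _).trans (le_of_eq ?_)
    exact integral_add' (hr.sub he).abs (he.sub (integrable_const _)).abs

end FixedDesign

/-! ### Integrals against complex measures -/

section ComplexIntegral

variable {X : Type*} [MeasurableSpace X]

/-- The variation is dominated by the sum of those of the real and imaginary parts, so bounded
measurable functions are integrable. -/
instance isFiniteMeasure_variation (m : ComplexMeasure X) : IsFiniteMeasure m.variation := by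
  have h : m.variation ≤ (ComplexMeasure.re m).totalVariation
      + (ComplexMeasure.im m).totalVariation := by
    refine VectorMeasure.variation_le_of_forall_enorm_le fun E _ => ?_
    rw [Measure.add_apply]
    refine le_trans ?_ (add_le_add (SignedMeasure.enorm_le_totalVariation _ E)
      (SignedMeasure.enorm_le_totalVariation _ E))
    have h1 : m E = ((ComplexMeasure.re m E : ℝ) : ℂ) + ((ComplexMeasure.im m E : ℝ) : ℂ) * Complex.I :=
      (Complex.re_add_im (m E)).symm
    rw [h1]
    refine (enorm_add_le _ _).trans (le_of_eq ?_)
    rw [enorm_mul]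
    simp [← ofReal_norm]
  exact isFiniteMeasure_of_le _ h

/-- A functional on bounded measurable functions which is additive, continuous along bounded
pointwise convergence, and agrees with `m` on indicators, is the integral against `m`. -/
theorem complexIntegral_eq_of_indicator (m : ComplexMeasure X) {Φ : (X → ℂ) → ℂ}
    (hind : ∀ (c : ℂ) (s : Set X), MeasurableSet s → Φ (s.indicator fun _ => c) = c * m s)
    (hadd : ∀ f g : SimpleFunc X ℂ, Φ (f + g) = Φ f + Φ g)
    (hlim : ∀ (F : ℕ → SimpleFunc X ℂ) (f : X → ℂ) (C : ℝ), (∀ n x, ‖F n x‖ ≤ C) →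
      (∀ x, Tendsto (fun n => F n x) atTop (𝓝 (f x))) →
      Tendsto (fun n => Φ (F n)) atTop (𝓝 (Φ f)))
    {f : X → ℂ} (hf : StronglyMeasurable f) {C : ℝ} (hC : ∀ x, ‖f x‖ ≤ C) :
    m.integral f (ContinuousLinearMap.mul ℝ ℂ) = Φ f := by
  have h_int : ∀ g : SimpleFunc X ℂ, Integrable g m.variation := fun g => g.integrable_of_isFiniteMeasure
  classical
  have hsimple : ∀ g : SimpleFunc X ℂ, m.integral g (ContinuousLinearMap.mul ℝ ℂ) = Φ g := by
    intro g
    induction g using SimpleFunc.induction with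
    | const c hs =>
      rename_i s
      rw [SimpleFunc.coe_piecewise, SimpleFunc.coe_const, SimpleFunc.coe_const,
        Function.const_zero, Set.piecewise_eq_indicator]
      have h1 := hind c s hs
      rw [show Function.const X c = fun _ => c from rfl, h1, VectorMeasure.integral_eq_setToFun,
        setToFun_indicator_const _ hs (measure_ne_top _ _)]
      rfl
    | add hd h1 h2 =>
      rename_i f g
      rw [SimpleFunc.coe_add, hadd, ← h1, ← h2]
      exact VectorMeasure.integral_add (h_int f) (h_int g)
  have hC' : 0 ≤ max C 0 := le_max_right _ _
  have hlimf : ∀ x, Tendsto (fun n => hf.approxBounded (max C 0) n x) atTop (𝓝 (f x)) := fun x =>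
    hf.tendsto_approxBounded_of_norm_le ((hC x).trans (le_max_left _ _))
  have h1 := hlim (hf.approxBounded (max C 0)) f (max C 0)
    (fun n x => hf.norm_approxBounded_le hC' n x) hlimf
  have h2 : Tendsto (fun n => m.integral (hf.approxBounded (max C 0) n)
      (ContinuousLinearMap.mul ℝ ℂ)) atTop (𝓝 (m.integral f (ContinuousLinearMap.mul ℝ ℂ))) :=
    VectorMeasure.tendsto_integral_of_dominated_convergence (fun _ => max C 0)
      (fun n => (h_int _).1) (integrable_const _)
      (fun n => Eventually.of_forall fun x => hf.norm_approxBounded_le hC' n x)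
      (Eventually.of_forall hlimf)
  refine tendsto_nhds_unique h2 (h1.congr fun n => (hsimple _).symm)

theorem complexIntegral_eq_sum {ι : Type*} (t : Finset ι) (c : ι → ℂ) (μ : ι → Measure X)
    [∀ i, IsFiniteMeasure (μ i)] {m : ComplexMeasure X}
    (hm : ∀ s, MeasurableSet s → m s = ∑ i ∈ t, c i * ((μ i).real s : ℂ))
    {f : X → ℂ} (hf : StronglyMeasurable f) {C : ℝ} (hC : ∀ x, ‖f x‖ ≤ C) :
    m.integral f (ContinuousLinearMap.mul ℝ ℂ) = ∑ i ∈ t, c i * ∫ x, f x ∂(μ i) := by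
  refine complexIntegral_eq_of_indicator m (Φ := fun f => ∑ i ∈ t, c i * ∫ x, f x ∂(μ i))
    ?_ ?_ ?_ hf hC
  · intro a s hs
    rw [hm s hs, Finset.mul_sum]
    refine Finset.sum_congr rfl fun i _ => ?_
    rw [integral_indicator hs, setIntegral_const, Complex.real_smul]
    ring
  · intro f g
    rw [← Finset.sum_add_distrib]
    refine Finset.sum_congr rfl fun i _ => ?_
    rw [← mul_add, ← integral_add f.integrable_of_isFiniteMeasure g.integrable_of_isFiniteMeasure]
    rfl
  · intro F f C hF hlim
    refine tendsto_finsetSum _ fun i _ => Tendsto.const_mul _ ?_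
    exact tendsto_integral_of_dominated_convergence (fun _ => C)
      (fun n => (F n).aestronglyMeasurable) (integrable_const _)
      (fun n => Eventually.of_forall (hF n)) (Eventually.of_forall hlim)

theorem complexIntegral_conj {m m' : ComplexMeasure X}
    (hm : ∀ s, MeasurableSet s → m' s = starRingEnd ℂ (m s))
    {f : X → ℂ} (hf : StronglyMeasurable f) {C : ℝ} (hC : ∀ x, ‖f x‖ ≤ C) :
    m.integral (fun x => starRingEnd ℂ (f x)) (ContinuousLinearMap.mul ℝ ℂ)
      = starRingEnd ℂ (m'.integral f (ContinuousLinearMap.mul ℝ ℂ)) := by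
  have h := complexIntegral_eq_of_indicator m' (Φ := fun f => starRingEnd ℂ
    (m.integral (fun x => starRingEnd ℂ (f x)) (ContinuousLinearMap.mul ℝ ℂ))) ?_ ?_ ?_ hf hC
  · rw [h, Complex.conj_conj]
  · intro a s hs
    have h1 : (fun x => starRingEnd ℂ (s.indicator (fun _ => a) x))
        = s.indicator fun _ => starRingEnd ℂ a := by
      ext x
      by_cases hx : x ∈ s <;> simp [hx]
    rw [h1, VectorMeasure.integral_eq_setToFun, setToFun_indicator_const _ hs (measure_ne_top _ _),
      hm s hs]
    change starRingEnd ℂ (starRingEnd ℂ a * m s) = _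
    rw [map_mul, Complex.conj_conj]
  · intro f g
    have h1 : ∀ g : SimpleFunc X ℂ, Integrable (fun x => starRingEnd ℂ (g x)) m.variation := fun g =>
      (g.map (starRingEnd ℂ)).integrable_of_isFiniteMeasure
    rw [← map_add, ← VectorMeasure.integral_fun_add (h1 f) (h1 g)]
    simp
  · intro F f C hF hlim
    refine (Complex.continuous_conj.tendsto _).comp ?_
    refine VectorMeasure.tendsto_integral_of_dominated_convergence (fun _ => C)
      (fun n => ((F n).map (starRingEnd ℂ)).aestronglyMeasurable) (integrable_const _)
      (fun n => Eventually.of_forall fun x => ?_)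
      (Eventually.of_forall fun x => (Complex.continuous_conj.tendsto _).comp (hlim x))
    rw [RCLike.norm_conj]
    exact hF n x

end ComplexIntegral

/-! ### Linear relations between weak limits of measures -/

section WeakLimits

theorem FiniteMeasure.sum_smul_real {X : Type*} [MeasurableSpace X] {ι : Type*} (t : Finset ι) (a : ι → NNReal)
    (μ : ι → FiniteMeasure X) (s : Set X) :
    ((∑ i ∈ t, a i • μ i : FiniteMeasure X) : Measure X).real s
      = ∑ i ∈ t, (a i : ℝ) * (μ i : Measure X).real s := by
  classical
  induction t using Finset.induction_on with
  | empty => simp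
  | insert i t hi ih =>
    rw [Finset.sum_insert hi, Finset.sum_insert hi, FiniteMeasure.toMeasure_add,
      measureReal_add_apply, ih, FiniteMeasure.toMeasure_smul, measureReal_nnreal_smul_apply]

variable {X : Type*} [MeasurableSpace X] [TopologicalSpace X] [BorelSpace X] [HasOuterApproxClosed X]

/-- Finite measures form only a cone, so the relation is rewritten as an equality of two nonnegative
combinations. These have the same weak limit, and uniqueness of limits gives equality on every set,
not merely on continuity sets. -/
theorem sum_mul_real_eq_zero_of_tendsto {α ι : Type*} {l : Filter α} [l.NeBot] (t : Finset ι)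
    (c : ι → ℝ) {μ : ι → α → FiniteMeasure X} {ν : ι → FiniteMeasure X}
    (hμ : ∀ i, Tendsto (μ i) l (𝓝 (ν i)))
    (h0 : ∀ a s, MeasurableSet s → ∑ i ∈ t, c i * (μ i a : Measure X).real s = 0) (s : Set X) :
    ∑ i ∈ t, c i * (ν i : Measure X).real s = 0 := by
  have hc : ∀ i, c i = ((c i).toNNReal : ℝ) - ((-c i).toNNReal : ℝ) := fun i => by
    rw [Real.coe_toNNReal', Real.coe_toNNReal']
    rcases le_total 0 (c i) with h | h
    · simp [h]
    · simp [h]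
  have h1 : ∀ a, ∑ i ∈ t, (c i).toNNReal • μ i a = ∑ i ∈ t, (-c i).toNNReal • μ i a := by
    intro a
    refine FiniteMeasure.toMeasure_injective (Measure.ext fun s hs => ?_)
    rw [← measureReal_eq_measureReal_iff, FiniteMeasure.sum_smul_real, FiniteMeasure.sum_smul_real,
      ← sub_eq_zero, ← Finset.sum_sub_distrib, ← h0 a s hs]
    refine Finset.sum_congr rfl fun i _ => ?_
    rw [← sub_mul, ← hc]
  have h2 : ∑ i ∈ t, (c i).toNNReal • ν i = ∑ i ∈ t, (-c i).toNNReal • ν i := by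
    have e1 : Tendsto (fun a => ∑ i ∈ t, (c i).toNNReal • μ i a) l
        (𝓝 (∑ i ∈ t, (c i).toNNReal • ν i)) :=
      tendsto_finsetSum _ fun i _ => (hμ i).const_smul _
    have e2 : Tendsto (fun a => ∑ i ∈ t, (-c i).toNNReal • μ i a) l
        (𝓝 (∑ i ∈ t, (-c i).toNNReal • ν i)) :=
      tendsto_finsetSum _ fun i _ => (hμ i).const_smul _
    exact tendsto_nhds_unique e1 (e2.congr fun a => (h1 a).symm)
  have h3 := congrArg (fun m : FiniteMeasure X => (m : Measure X).real s) h2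
  simp only [FiniteMeasure.sum_smul_real] at h3
  rw [← sub_eq_zero, ← Finset.sum_sub_distrib] at h3
  rw [← h3]
  refine Finset.sum_congr rfl fun i _ => ?_
  rw [← sub_mul, ← hc]

theorem linearCombination_real_eq_zero_of_tendsto {α ι : Type*} {l : Filter α} [l.NeBot]
    (c : ι →₀ ℂ) {μ : ι → α → FiniteMeasure X} {ν : ι → FiniteMeasure X}
    (hμ : ∀ i, Tendsto (μ i) l (𝓝 (ν i)))
    (h0 : ∀ a s, MeasurableSet s →
      Finsupp.linearCombination ℂ (fun i => ((μ i a : Measure X).real s : ℂ)) c = 0) (s : Set X) :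
    Finsupp.linearCombination ℂ (fun i => ((ν i : Measure X).real s : ℂ)) c = 0 := by
  simp only [Finsupp.linearCombination_apply, Finsupp.sum, smul_eq_mul] at h0 ⊢
  have hre := sum_mul_real_eq_zero_of_tendsto c.support (fun i => (c i).re) hμ (fun a s hs => by
    have := congrArg Complex.re (h0 a s hs)
    simpa using this) s
  have him := sum_mul_real_eq_zero_of_tendsto c.support (fun i => (c i).im) hμ (fun a s hs => by
    have := congrArg Complex.im (h0 a s hs)
    simpa using this) s
  apply Complex.ext
  · simpa using hre
  · simpa using him

end WeakLimits

/-! ### Existence of the spectral measure -/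

section Polarisation

variable {p : ℕ}

/-- `|⟨w, z⟩|²`. -/
noncomputable def quadVal (z w : Fin p → ℂ) : ℝ :=
  Complex.normSq (∑ j, starRingEnd ℂ (w j) * z j)

/-- The formal polarisation of the entry `(j, l)` of a Hermitian form. -/
noncomputable def polar (j l : Fin p) : (Fin p → ℂ) →₀ ℂ :=
  (1 / 2 : ℂ) • ((Finsupp.single (Pi.single j 1 + Pi.single l 1) 1
      - Finsupp.single (Pi.single j 1) 1 - Finsupp.single (Pi.single l 1) 1)
    + Complex.I • (Finsupp.single (Pi.single j 1 - Complex.I • Pi.single l 1) 1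
      - Finsupp.single (Pi.single j 1) 1 - Finsupp.single (Pi.single l 1) 1))

theorem sum_conj_single_mul (z : Fin p → ℂ) (j : Fin p) (c : ℂ) :
    ∑ i, starRingEnd ℂ ((c • Pi.single j (1 : ℂ) : Fin p → ℂ) i) * z i = starRingEnd ℂ c * z j := by
  rw [Finset.sum_eq_single j]
  · simp
  · intro i _ hi
    simp [hi]
  · simp

theorem quadVal_single_add (z : Fin p → ℂ) (j l : Fin p) (c : ℂ) :
    quadVal z (Pi.single j 1 + c • Pi.single l 1) = Complex.normSq (z j + starRingEnd ℂ c * z l) := by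
  have h1 := sum_conj_single_mul z j 1
  rw [one_smul, map_one, one_mul] at h1
  rw [quadVal]
  simp only [Pi.add_apply, map_add, add_mul, Finset.sum_add_distrib]
  rw [sum_conj_single_mul, h1]

theorem quadVal_single (z : Fin p → ℂ) (j : Fin p) :
    quadVal z (Pi.single j 1) = Complex.normSq (z j) := by
  have h1 := sum_conj_single_mul z j 1
  rw [one_smul, map_one, one_mul] at h1
  rw [quadVal, h1]

/-- The vector `eⱼ + eₗ` yields the real part of the entry and `eⱼ - i eₗ` its imaginary part. -/
theorem linearCombination_quadVal_polar (z : Fin p → ℂ) (j l : Fin p) :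
    Finsupp.linearCombination ℂ (fun w => (quadVal z w : ℂ)) (polar j l)
      = z j * starRingEnd ℂ (z l) := by
  have h1 := quadVal_single_add z j l 1
  have h2 := quadVal_single_add z j l (-Complex.I)
  rw [one_smul, map_one, one_mul] at h1
  rw [neg_smul, ← sub_eq_add_neg, map_neg, Complex.conj_I, neg_neg] at h2
  simp only [polar, map_smul, map_add, map_sub, Finsupp.linearCombination_single, h1, h2,
    quadVal_single, smul_eq_mul]
  apply Complex.ext
  · simp [Complex.normSq_apply]
    ring
  · simp [Complex.normSq_apply]
    ring

/-- A relation between the values of all rank-one forms holds at each frequency, hence for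
periodograms and their weak limits. This one will express the quadratic form of the limit at `v` by
a positive measure. -/
theorem linearCombination_quadVal_sum_polar (z v : Fin p → ℂ) :
    Finsupp.linearCombination ℂ (fun w => (quadVal z w : ℂ))
      ((∑ j, ∑ l, (starRingEnd ℂ (v j) * v l) • polar j l) - Finsupp.single v 1) = 0 := by
  rw [map_sub, map_sum, Finsupp.linearCombination_single, one_smul, sub_eq_zero]
  simp only [map_sum, map_smul, linearCombination_quadVal_polar, smul_eq_mul]
  rw [quadVal, ← Complex.mul_conj, map_sum, Finset.sum_mul_sum]
  refine Finset.sum_congr rfl fun j _ => Finset.sum_congr rfl fun l _ => ?_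
  rw [map_mul, Complex.conj_conj]
  ring

theorem linearCombination_quadVal_polar_swap (z : Fin p → ℂ) (j l : Fin p) :
    starRingEnd ℂ (Finsupp.linearCombination ℂ (fun w => (quadVal z w : ℂ)) (polar l j))
      = Finsupp.linearCombination ℂ (fun w => (quadVal z w : ℂ)) (polar j l) := by
  rw [linearCombination_quadVal_polar, linearCombination_quadVal_polar, map_mul, Complex.conj_conj,
    mul_comm]

/-- The coefficients with conjugated values. -/
noncomputable def conjCoeff (c : (Fin p → ℂ) →₀ ℂ) : (Fin p → ℂ) →₀ ℂ :=
  c.mapRange (starRingEnd ℂ) (map_zero _)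

theorem linearCombination_conjCoeff (c : (Fin p → ℂ) →₀ ℂ) (q : (Fin p → ℂ) → ℝ) :
    Finsupp.linearCombination ℂ (fun w => (q w : ℂ)) (conjCoeff c)
      = starRingEnd ℂ (Finsupp.linearCombination ℂ (fun w => (q w : ℂ)) c) := by
  rw [Finsupp.linearCombination_apply, Finsupp.linearCombination_apply, conjCoeff,
    Finsupp.sum_mapRange_index (by simp), Finsupp.sum, Finsupp.sum, map_sum]
  refine Finset.sum_congr rfl fun w _ => ?_
  simp

end Polarisation

/-! ### Periodograms of the design and their weak limits -/

section Periodogram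

variable {p : ℕ}

theorem integral_exp_int (k : ℤ) :
    ∫ θ in (-Real.pi)..Real.pi, Complex.exp (Complex.I * k * θ) = if k = 0 then (2 * Real.pi : ℂ) else 0 := by
  split_ifs with h
  · subst h
    simp
    ring
  · have hc : Complex.I * (k : ℂ) ≠ 0 := mul_ne_zero Complex.I_ne_zero (by exact_mod_cast h)
    rw [integral_exp_mul_complex hc, div_eq_zero_iff]
    left
    rw [sub_eq_zero, Complex.exp_eq_exp_iff_exists_int]
    refine ⟨k, ?_⟩
    push_cast
    ring

/-- `∑ zₘ e^{imθ}` for a normalised column of the design. -/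
noncomputable def trigPoly (x : ℕ → Fin p → ℝ) (n : ℕ) (j : Fin p) (θ : ℝ) : ℂ :=
  ∑ m ∈ Finset.range n, (normCol x n j m : ℂ) * Complex.exp (Complex.I * m * θ)

theorem continuous_trigPoly (x : ℕ → Fin p → ℝ) (n : ℕ) (j : Fin p) :
    Continuous (trigPoly x n j) := by
  unfold trigPoly
  fun_prop

/-- Lebesgue measure on `[-π, π]`. -/
noncomputable def freqVolume : Measure (Set.Icc (-Real.pi) Real.pi) :=
  Measure.comap Subtype.val volume

instance : IsFiniteMeasure freqVolume := by
  refine ⟨?_⟩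
  rw [freqVolume, comap_subtype_coe_apply measurableSet_Icc, Set.image_univ, Subtype.range_coe]
  exact measure_Icc_lt_top

theorem integral_freqVolume (f : ℝ → ℂ) :
    ∫ θ, f θ ∂freqVolume = ∫ θ in (-Real.pi)..Real.pi, f θ := by
  rw [intervalIntegral.integral_of_le (by linarith [Real.pi_pos]), ← integral_Icc_eq_integral_Ioc]
  exact integral_subtype_comap measurableSet_Icc f

/-- Orthogonality of exponentials keeps exactly the pairs with `s - t = k`, so the empirical
correlations are Fourier coefficients of the periodogram. -/
theorem integral_exp_mul_trigPoly (x : ℕ → Fin p → ℝ) (n k : ℕ) (j l : Fin p) :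
    ∫ θ, Complex.exp (Complex.I * k * (θ : ℝ)) *
      (trigPoly x n j θ * starRingEnd ℂ (trigPoly x n l θ)) ∂freqVolume = 2 * Real.pi * (empCorr x n k j l : ℂ) := by
  rw [integral_freqVolume fun θ => Complex.exp (Complex.I * k * θ) *
      (trigPoly x n j θ * starRingEnd ℂ (trigPoly x n l θ))]
  have h1 : ∀ θ : ℝ, Complex.exp (Complex.I * k * θ) *
      (trigPoly x n j θ * starRingEnd ℂ (trigPoly x n l θ))
      = ∑ s ∈ Finset.range n, ∑ t ∈ Finset.range n, ((normCol x n l s * normCol x n j t : ℝ) : ℂ)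
        * Complex.exp (Complex.I * ((k + t - s : ℤ) : ℂ) * θ) := by
    intro θ
    rw [trigPoly, trigPoly, map_sum, Finset.sum_mul_sum, Finset.sum_comm, Finset.mul_sum]
    refine Finset.sum_congr rfl fun s _ => ?_
    rw [Finset.mul_sum]
    refine Finset.sum_congr rfl fun t _ => ?_
    rw [map_mul, Complex.conj_ofReal, ← Complex.exp_conj]
    simp only [map_mul, Complex.conj_I, Complex.conj_ofReal, Complex.conj_natCast]
    rw [show Complex.I * ((k + t - s : ℤ) : ℂ) * θ
      = Complex.I * k * θ + Complex.I * t * θ + -Complex.I * s * θ by push_cast; ring,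
      Complex.exp_add, Complex.exp_add]
    push_cast
    ring
  simp only [h1]
  have hI : ∀ s t : ℕ, IntervalIntegrable (fun θ : ℝ => ((normCol x n l s * normCol x n j t : ℝ) : ℂ)
        * Complex.exp (Complex.I * ((k + t - s : ℤ) : ℂ) * θ)) volume (-Real.pi) Real.pi := fun s t =>
    Continuous.intervalIntegrable (by fun_prop) _ _
  have hI' : ∀ s : ℕ, IntervalIntegrable (fun θ : ℝ => ∑ t ∈ Finset.range n,
      ((normCol x n l s * normCol x n j t : ℝ) : ℂ)
        * Complex.exp (Complex.I * ((k + t - s : ℤ) : ℂ) * θ)) volume (-Real.pi) Real.pi := fun s =>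
    Continuous.intervalIntegrable (by fun_prop) _ _
  rw [intervalIntegral.integral_finsetSum fun s _ => hI' s,
    ← lagSum_normCol, lagSum, Complex.ofReal_sum, Finset.mul_sum]
  refine Finset.sum_congr rfl fun s _ => ?_
  rw [intervalIntegral.integral_finsetSum fun t _ => hI s t, Complex.ofReal_sum, Finset.mul_sum]
  refine Finset.sum_congr rfl fun t _ => ?_
  rw [intervalIntegral.integral_const_mul, integral_exp_int]
  by_cases h : (s : ℤ) - t = k
  · rw [if_pos (by omega), if_pos h]
    push_cast
    ring
  · rw [if_neg (by omega), if_neg h]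
    simp

/-- The density of the periodogram in the direction `w`. -/
noncomputable def specDens (x : ℕ → Fin p → ℝ) (n : ℕ) (w : Fin p → ℂ) (θ : ℝ) : ℝ :=
  1 / (2 * Real.pi) * quadVal (fun j => trigPoly x n j θ) w

theorem continuous_specDens (x : ℕ → Fin p → ℝ) (n : ℕ) (w : Fin p → ℂ) :
    Continuous (specDens x n w) := by
  have := continuous_trigPoly x n
  have h1 : Continuous fun θ => ∑ j, starRingEnd ℂ (w j) * trigPoly x n j θ :=
    continuous_finsetSum _ fun j _ => continuous_const.mul (this j)
  exact continuous_const.mul (Complex.continuous_normSq.comp h1)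

theorem specDens_nonneg (x : ℕ → Fin p → ℝ) (n : ℕ) (w : Fin p → ℂ) (θ : ℝ) :
    0 ≤ specDens x n w θ :=
  mul_nonneg (by positivity) (Complex.normSq_nonneg _)

theorem integrable_specDens (x : ℕ → Fin p → ℝ) (n : ℕ) (w : Fin p → ℂ) :
    Integrable (fun θ : Set.Icc (-Real.pi) Real.pi => specDens x n w θ) freqVolume :=
  ((continuous_specDens x n w).comp continuous_subtype_val).integrable_of_hasCompactSupport
    (HasCompactSupport.of_compactSpace _)

/-- The periodogram in the direction `w`. -/
noncomputable def periodogram (x : ℕ → Fin p → ℝ) (n : ℕ) (w : Fin p → ℂ) :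
    FiniteMeasure (Set.Icc (-Real.pi) Real.pi) :=
  ⟨freqVolume.withDensity fun θ => ENNReal.ofReal (specDens x n w θ),
    isFiniteMeasure_withDensity_ofReal (integrable_specDens x n w).2⟩

theorem integral_periodogram (x : ℕ → Fin p → ℝ) (n : ℕ) (w : Fin p → ℂ)
    (g : Set.Icc (-Real.pi) Real.pi → ℂ) :
    ∫ θ, g θ ∂(periodogram x n w : Measure (Set.Icc (-Real.pi) Real.pi))
      = ∫ θ, (specDens x n w θ : ℂ) * g θ ∂freqVolume := by
  change ∫ θ, g θ ∂(freqVolume.withDensity fun θ : Set.Icc (-Real.pi) Real.pi =>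
    ENNReal.ofReal (specDens x n w θ)) = _
  have hm : Measurable fun θ : Set.Icc (-Real.pi) Real.pi => ENNReal.ofReal (specDens x n w θ) :=
    ((continuous_specDens x n w).measurable.comp measurable_subtype_coe).ennreal_ofReal
  rw [integral_withDensity_eq_integral_toReal_smul hm
    (Eventually.of_forall fun _ => ENNReal.ofReal_lt_top)]
  refine integral_congr_ae (Eventually.of_forall fun θ => ?_)
  simp only [Complex.real_smul, ENNReal.toReal_ofReal (specDens_nonneg x n w θ)]

theorem linearCombination_integral_periodogram (x : ℕ → Fin p → ℝ) (n : ℕ)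
    (c : (Fin p → ℂ) →₀ ℂ) {g : Set.Icc (-Real.pi) Real.pi → ℂ} (hg : StronglyMeasurable g) {C : ℝ}
    (hC : ∀ θ, ‖g θ‖ ≤ C) :
    Finsupp.linearCombination ℂ (fun w => ∫ θ, g θ ∂(periodogram x n w : Measure (Set.Icc (-Real.pi) Real.pi))) c
      = 1 / (2 * Real.pi) * ∫ θ, g θ * Finsupp.linearCombination ℂ
        (fun w => (quadVal (fun j => trigPoly x n j (θ : ℝ)) w : ℂ)) c ∂freqVolume := by
  have hI : ∀ w, Integrable (fun θ : Set.Icc (-Real.pi) Real.pi =>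
      c w * ((specDens x n w θ : ℂ) * g θ)) freqVolume := fun w =>
    ((integrable_specDens x n w).ofReal.mul_bdd hg.aestronglyMeasurable
      (Eventually.of_forall hC)).const_mul _
  simp only [Finsupp.linearCombination_apply, Finsupp.sum, smul_eq_mul, integral_periodogram]
  rw [← integral_const_mul]
  simp only [← integral_const_mul]
  rw [← integral_finsetSum _ fun w _ => hI w]
  refine integral_congr_ae (Eventually.of_forall fun θ => ?_)
  simp only [Finset.mul_sum]
  refine Finset.sum_congr rfl fun w _ => ?_
  rw [specDens]
  push_cast
  ring

theorem linearCombination_real_periodogram (x : ℕ → Fin p → ℝ) (n : ℕ)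
    {c : (Fin p → ℂ) →₀ ℂ}
    (hc : ∀ z, Finsupp.linearCombination ℂ (fun w => (quadVal z w : ℂ)) c = 0)
    {s : Set (Set.Icc (-Real.pi) Real.pi)} (hs : MeasurableSet s) :
    Finsupp.linearCombination ℂ (fun w => ((periodogram x n w : Measure (Set.Icc (-Real.pi) Real.pi)).real s : ℂ)) c = 0 := by
  have h1 : ∀ w, ((periodogram x n w : Measure (Set.Icc (-Real.pi) Real.pi)).real s : ℂ)
      = ∫ θ, s.indicator (fun _ => (1 : ℂ)) θ ∂(periodogram x n w : Measure (Set.Icc (-Real.pi) Real.pi)) := by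
    intro w
    rw [integral_indicator hs, setIntegral_const, Complex.real_smul, mul_one]
  simp only [h1]
  rw [linearCombination_integral_periodogram x n c
    (stronglyMeasurable_const.indicator hs) (C := 1) (fun θ => ?_)]
  · simp [hc]
  · refine (norm_indicator_le_norm_self _ _).trans ?_
    simp

/-- Cauchy–Schwarz and the normalisation of the columns give a bound independent of `n`, which
supplies the compactness below. -/
theorem mass_periodogram_le (x : ℕ → Fin p → ℝ) (n : ℕ) (w : Fin p → ℂ) :
    (periodogram x n w : Measure (Set.Icc (-Real.pi) Real.pi)).real Set.univ ≤ p * ∑ j, ‖w j‖ ^ 2 := by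
  have h0 : ∀ j, ∫ θ, Complex.normSq (trigPoly x n j θ) ∂freqVolume
      = 2 * Real.pi * empCorr x n 0 j j := by
    intro j
    have h1 := integral_exp_mul_trigPoly x n 0 j j
    simp only [Nat.cast_zero, mul_zero, zero_mul, Complex.exp_zero, one_mul, Complex.mul_conj] at h1
    rw [integral_complex_ofReal] at h1
    exact_mod_cast h1
  have hcont : ∀ j, Integrable (fun θ : Set.Icc (-Real.pi) Real.pi =>
      Complex.normSq (trigPoly x n j θ)) freqVolume := fun j =>
    (Complex.continuous_normSq.comp ((continuous_trigPoly x n j).comp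
      continuous_subtype_val)).integrable_of_hasCompactSupport (HasCompactSupport.of_compactSpace _)
  have h2 : (periodogram x n w : Measure (Set.Icc (-Real.pi) Real.pi)).real Set.univ
      = ∫ θ, specDens x n w θ ∂freqVolume := by
    have h3 := integral_periodogram x n w fun _ => 1
    simp only [integral_const, Complex.real_smul, mul_one] at h3
    rw [integral_complex_ofReal] at h3
    exact_mod_cast h3
  have h4 : ∀ θ : ℝ, specDens x n w θ ≤ 1 / (2 * Real.pi) * ((∑ j, ‖w j‖ ^ 2)
      * ∑ j, Complex.normSq (trigPoly x n j θ)) := by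
    intro θ
    refine mul_le_mul_of_nonneg_left ?_ (by positivity)
    rw [quadVal, Complex.normSq_eq_norm_sq]
    refine (pow_le_pow_left₀ (norm_nonneg _) (norm_sum_le _ _) 2).trans ?_
    simp only [norm_mul, RCLike.norm_conj, Complex.normSq_eq_norm_sq]
    exact Finset.sum_mul_sq_le_sq_mul_sq _ _ _
  have h5 : ∀ j, empCorr x n 0 j j ≤ 1 := by
    intro j
    refine le_trans (le_of_eq ?_) (sum_normCol_sq_le x n j)
    rw [empCorr, tsub_zero]
    refine Finset.sum_congr rfl fun i _ => ?_
    rw [normCol, div_pow, add_zero, sq, sq]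
  rw [h2]
  refine (integral_mono (integrable_specDens x n w)
    (((integrable_finsetSum _ fun j _ => hcont j).const_mul _).const_mul _) fun θ => h4 θ).trans ?_
  rw [integral_const_mul, integral_const_mul, integral_finsetSum _ fun j _ => hcont j]
  simp only [h0]
  rw [← Finset.mul_sum]
  have hpi := Real.pi_pos
  calc _ = (∑ j, ‖w j‖ ^ 2) * ∑ j, empCorr x n 0 j j := by field_simp
    _ ≤ (∑ j, ‖w j‖ ^ 2) * ∑ _j : Fin p, (1 : ℝ) := by
        refine mul_le_mul_of_nonneg_left (Finset.sum_le_sum fun j _ => h5 j)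
          (Finset.sum_nonneg fun _ _ => by positivity)
    _ = _ := by simp [mul_comm]

/-- Along an ultrafilter compactness gives limits in all directions `w` simultaneously, with no
extraction of subsequences. -/
theorem exists_tendsto_periodogram (x : ℕ → Fin p → ℝ) (w : Fin p → ℂ) :
    ∃ ν, Tendsto (fun n => periodogram x n w) (hyperfilter ℕ : Filter ℕ) (𝓝 ν) := by
  have hC0 : 0 ≤ (p : ℝ) * ∑ j, ‖w j‖ ^ 2 := by positivity
  obtain ⟨ν, -, hν⟩ := (isCompact_setOfPred_finiteMeasure_le_of_compactSpace
    (Set.Icc (-Real.pi) Real.pi) ⟨_, hC0⟩).ultrafilter_le_nhds'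
    ((hyperfilter ℕ).map fun n => periodogram x n w) (by
      refine Ultrafilter.mem_map.2 (univ_mem' fun n => ?_)
      exact mass_periodogram_le x n w)
  exact ⟨ν, hν⟩

/-- The complex measure `∑ c_w ν_w`. -/
noncomputable def combMeasure {X ι : Type*} [MeasurableSpace X] (ν : ι → FiniteMeasure X)
    (c : ι →₀ ℂ) : ComplexMeasure X :=
  ∑ w ∈ c.support, ((c w).re • (ν w : Measure X).toSignedMeasure).toComplexMeasure
    ((c w).im • (ν w : Measure X).toSignedMeasure)

theorem combMeasure_apply {X ι : Type*} [MeasurableSpace X] (ν : ι → FiniteMeasure X)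
    (c : ι →₀ ℂ) {s : Set X} (hs : MeasurableSet s) :
    combMeasure ν c s = ∑ w ∈ c.support, c w * ((ν w : Measure X).real s : ℂ) := by
  rw [combMeasure]
  have h1 : ∀ (t : Finset ι) (m : ι → ComplexMeasure X), (∑ w ∈ t, m w) s = ∑ w ∈ t, m w s := by
    intro t m
    rw [FunLike.coe_sum, Finset.sum_apply]
  rw [h1]
  refine Finset.sum_congr rfl fun w _ => ?_
  rw [SignedMeasure.toComplexMeasure_apply]
  apply Complex.ext <;> simp [Measure.toSignedMeasure_apply_measurable hs]

theorem linearCombination_limit_eq_zero {x : ℕ → Fin p → ℝ}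
    {ν : (Fin p → ℂ) → FiniteMeasure (Set.Icc (-Real.pi) Real.pi)}
    (hν : ∀ w, Tendsto (fun n => periodogram x n w) (hyperfilter ℕ : Filter ℕ) (𝓝 (ν w)))
    {c : (Fin p → ℂ) →₀ ℂ}
    (hc : ∀ z, Finsupp.linearCombination ℂ (fun w => (quadVal z w : ℂ)) c = 0)
    (s : Set (Set.Icc (-Real.pi) Real.pi)) :
    Finsupp.linearCombination ℂ
      (fun w => ((ν w : Measure (Set.Icc (-Real.pi) Real.pi)).real s : ℂ)) c = 0 :=
  linearCombination_real_eq_zero_of_tendsto c hν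
    (fun n _ hs => linearCombination_real_periodogram x n hc hs) s

theorem combMeasure_eq_linearCombination {X ι : Type*} [MeasurableSpace X] (ν : ι → FiniteMeasure X)
    (c : ι →₀ ℂ) {s : Set X} (hs : MeasurableSet s) :
    combMeasure ν c s = Finsupp.linearCombination ℂ (fun w => ((ν w : Measure X).real s : ℂ)) c :=
  combMeasure_apply ν c hs

/-- Linear relations between rank-one forms survive in the limit. They show the matrix to be
Hermitian and its quadratic form at `v` to be the mass of `A` under the positive measure `ν v`. -/
theorem posSemidef_combMeasure {x : ℕ → Fin p → ℝ}
    {ν : (Fin p → ℂ) → FiniteMeasure (Set.Icc (-Real.pi) Real.pi)}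
    (hν : ∀ w, Tendsto (fun n => periodogram x n w) (hyperfilter ℕ : Filter ℕ) (𝓝 (ν w)))
    {A : Set (Set.Icc (-Real.pi) Real.pi)} (hA : MeasurableSet A) :
    (Matrix.of fun j l => combMeasure ν (polar j l) A).PosSemidef := by
  set q : (Fin p → ℂ) → ℂ := fun w => ((ν w : Measure (Set.Icc (-Real.pi) Real.pi)).real A : ℂ)
    with hq
  have hval : ∀ j l, combMeasure ν (polar j l) A = Finsupp.linearCombination ℂ q (polar j l) :=
    fun j l => combMeasure_eq_linearCombination ν (polar j l) hA
  have hrel : ∀ c : (Fin p → ℂ) →₀ ℂ,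
      (∀ z, Finsupp.linearCombination ℂ (fun w => (quadVal z w : ℂ)) c = 0) →
      Finsupp.linearCombination ℂ q c = 0 := fun c hc => linearCombination_limit_eq_zero hν hc A
  simp only [hval]
  refine Matrix.PosSemidef.of_dotProduct_mulVec_nonneg ?_ fun v => ?_
  · ext j l
    have h1 := hrel (conjCoeff (polar l j) - polar j l) (fun z => by
      rw [map_sub, linearCombination_conjCoeff, linearCombination_quadVal_polar_swap, sub_self])
    rw [map_sub, hq, linearCombination_conjCoeff, sub_eq_zero] at h1
    exact h1
  · have h1 := hrel _ (fun z => linearCombination_quadVal_sum_polar z v)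
    rw [map_sub, map_sum, Finsupp.linearCombination_single, one_smul, sub_eq_zero] at h1
    have h2 : star v ⬝ᵥ (Matrix.of fun j l => Finsupp.linearCombination ℂ q (polar j l)) *ᵥ v
        = q v := by
      rw [← h1]
      simp only [dotProduct, Matrix.mulVec, Matrix.of_apply, Pi.star_apply, Finset.mul_sum, map_sum,
        map_smul, smul_eq_mul]
      refine Finset.sum_congr rfl fun j _ => Finset.sum_congr rfl fun l _ => ?_
      rw [starRingEnd_apply]
      ring
    rw [h2]
    exact Complex.zero_le_real.2 measureReal_nonneg

/-- The exponential is continuous on a compact interval, so its integral passes to the weak limit,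
while the empirical correlations converge to `R k`. -/
theorem cintegral_combMeasure {x : ℕ → Fin p → ℝ} {R : ℕ → Matrix (Fin p) (Fin p) ℝ}
    (hX : HannanDesign x R) {ν : (Fin p → ℂ) → FiniteMeasure (Set.Icc (-Real.pi) Real.pi)}
    (hν : ∀ w, Tendsto (fun n => periodogram x n w) (hyperfilter ℕ : Filter ℕ) (𝓝 (ν w)))
    (k : ℕ) (j l : Fin p) :
    cintegral (fun θ => Complex.exp (Complex.I * k * θ)) (combMeasure ν (polar j l))
      = (R k j l : ℂ) := by
  obtain ⟨g, hg⟩ : ∃ g : Set.Icc (-Real.pi) Real.pi → ℂ,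
    g = fun θ : Set.Icc (-Real.pi) Real.pi =>
      Complex.exp (Complex.I * k * ((θ : ℝ) : ℂ)) := ⟨_, rfl⟩
  have hcont : Continuous g := by
    rw [hg]
    fun_prop
  have hnorm : ∀ θ, ‖g θ‖ ≤ 1 := fun θ => by
    rw [hg, Complex.norm_exp]
    simp
  have h1 : cintegral (fun θ => Complex.exp (Complex.I * k * θ)) (combMeasure ν (polar j l))
      = Finsupp.linearCombination ℂ
        (fun w => ∫ θ, g θ ∂(ν w : Measure (Set.Icc (-Real.pi) Real.pi))) (polar j l) := by
    have := complexIntegral_eq_sum (polar j l).support (polar j l)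
      (fun w => (ν w : Measure (Set.Icc (-Real.pi) Real.pi)))
      (m := combMeasure ν (polar j l))
      (fun s hs => combMeasure_apply ν (polar j l) hs) hcont.stronglyMeasurable hnorm
    rw [cintegral, ← hg, this]
    rfl
  have h2 : Tendsto (fun n => Finsupp.linearCombination ℂ (fun w =>
      ∫ θ, g θ ∂(periodogram x n w : Measure (Set.Icc (-Real.pi) Real.pi))) (polar j l))
      (hyperfilter ℕ : Filter ℕ)
      (𝓝 (cintegral (fun θ => Complex.exp (Complex.I * k * θ)) (combMeasure ν (polar j l)))) := by
    rw [h1]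
    simp only [Finsupp.linearCombination_apply, Finsupp.sum]
    refine tendsto_finsetSum _ fun w _ => Tendsto.const_smul ?_ _
    exact (FiniteMeasure.tendsto_iff_forall_integral_rclike_tendsto ℂ).1 (hν w)
      (BoundedContinuousFunction.mkOfCompact ⟨g, hcont⟩)
  have h3 : ∀ n, Finsupp.linearCombination ℂ (fun w =>
      ∫ θ, g θ ∂(periodogram x n w : Measure (Set.Icc (-Real.pi) Real.pi))) (polar j l)
        = (empCorr x n k j l : ℂ) := by
    intro n
    rw [linearCombination_integral_periodogram x n _ hcont.stronglyMeasurable hnorm]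
    simp only [linearCombination_quadVal_polar, hg]
    rw [integral_exp_mul_trigPoly]
    have hpi : (Real.pi : ℂ) ≠ 0 := by exact_mod_cast Real.pi_pos.ne'
    field_simp
  simp only [h3] at h2
  refine tendsto_nhds_unique h2 ?_
  exact ((Complex.continuous_ofReal.tendsto _).comp (hX.corr_tendsto j l k)).mono_left
    Nat.hyperfilter_le_atTop

theorem HannanDesign.exists_isSpectralMeasure {x : ℕ → Fin p → ℝ}
    {R : ℕ → Matrix (Fin p) (Fin p) ℝ} (hX : HannanDesign x R) :
    ∃ M : MatrixMeasure p, IsSpectralMeasure R M := by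
  choose ν hν using exists_tendsto_periodogram x
  exact ⟨fun j l => combMeasure ν (polar j l), fun _ hA => posSemidef_combMeasure hν hA,
    cintegral_combMeasure hX hν⟩

end Periodogram

/-! ### The limiting covariance matrix -/

section LimitCov

variable {p : ℕ} {R : ℕ → Matrix (Fin p) (Fin p) ℝ} {M : MatrixMeasure p}

/-- Hermitian values make the entry `(l, j)` the conjugate of `(j, l)`; conjugating the formula at
`m = -k` and using that `R` is real gives negative frequencies. -/
theorem IsSpectralMeasure.fourier_int (hM : IsSpectralMeasure R M) (k : ℤ) (j l : Fin p) :
    cintegral (fun θ => Complex.exp (Complex.I * k * θ)) (M j l) = (extCorr R k j l : ℂ) := by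
  rcases le_or_gt 0 k with hk | hk
  · obtain ⟨m, rfl⟩ : ∃ m : ℕ, k = m := ⟨k.natAbs, by omega⟩
    simpa [extCorr] using hM.fourier m j l
  · obtain ⟨m, rfl⟩ : ∃ m : ℕ, k = -m := ⟨k.natAbs, by omega⟩
    have h0 : ¬ (0 : ℤ) ≤ -m := by omega
    have hconj : ∀ s, MeasurableSet s → M l j s = starRingEnd ℂ (M j l s) := fun s hs =>
      ((hM.posSemidef s hs).isHermitian.apply l j).symm
    have hcont : Continuous fun θ : Set.Icc (-Real.pi) Real.pi =>
        Complex.exp (Complex.I * m * ((θ : ℝ) : ℂ)) := by fun_prop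
    have h1 := complexIntegral_conj hconj hcont.stronglyMeasurable (C := 1) fun θ => by
      rw [Complex.norm_exp]
      simp
    have h2 := hM.fourier m l j
    rw [cintegral] at h2
    rw [h2, Complex.conj_ofReal] at h1
    simp only [extCorr, h0, if_false, Int.natAbs_neg, Int.natAbs_natCast, Matrix.transpose_apply]
    rw [← h1, cintegral]
    congr 1
    ext θ
    rw [← Complex.exp_conj]
    congr 1
    simp

theorem IsSpectralMeasure.apply_univ (hM : IsSpectralMeasure R M) (j l : Fin p) :
    M j l Set.univ = (R 0 j l : ℂ) := by
  rw [← hM.fourier 0 j l, cintegral]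
  simp

theorem IsSpectralMeasure.matF_eq (hM : IsSpectralMeasure R M) :
    matF M = (1 / (2 * Real.pi) : ℂ) • (R 0).map Complex.ofRealHom := by
  ext j l
  simp [matF, hM.apply_univ]

/-- The series of `f` is integrated term by term, dominated by `∑ |γ(k)|`. -/
theorem IsSpectralMeasure.cintegral_specDensity {Ω : Type*} [MeasurableSpace Ω] {P : Measure Ω}
    {T : Ω ≃ᵐ Ω} {ε₀ : Ω → ℝ} (hγ : Summable fun k : ℤ => |autocov P T ε₀ k|)
    (hM : IsSpectralMeasure R M) (j l : Fin p) :
    cintegral (specDensity P T ε₀) (M j l) = (1 / (2 * Real.pi) : ℂ) *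
      ((∑' k : ℤ, autocov P T ε₀ k * extCorr R k j l : ℝ) : ℂ) := by
  obtain ⟨c, hc⟩ : ∃ c : ℝ, c = 1 / (2 * Real.pi) := ⟨_, rfl⟩
  have hc' : (1 / (2 * Real.pi) : ℂ) = (c : ℂ) := by rw [hc]; push_cast; rfl
  have hnorm : ∀ (k : ℤ) (θ : ℝ), ‖Complex.exp (Complex.I * k * θ)‖ = 1 := fun k θ => by
    rw [Complex.norm_exp]
    simp
  have hsum : ∀ θ : ℝ, Summable fun k : ℤ =>
      (autocov P T ε₀ k : ℂ) * Complex.exp (Complex.I * k * θ) := fun θ => by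
    refine Summable.of_norm (hγ.congr fun k => ?_)
    rw [norm_mul, hnorm, mul_one, Complex.norm_real, Real.norm_eq_abs]
  have hmain : HasSum (fun k : ℤ => (M j l).integral
      (fun θ : Set.Icc (-Real.pi) Real.pi =>
        (c * autocov P T ε₀ k) • Complex.exp (Complex.I * k * ((θ : ℝ) : ℂ)))
      (ContinuousLinearMap.mul ℝ ℂ))
      ((M j l).integral (fun θ : Set.Icc (-Real.pi) Real.pi => specDensity P T ε₀ θ)
        (ContinuousLinearMap.mul ℝ ℂ)) :=
    VectorMeasure.hasSum_integral_of_dominated_convergence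
    (fun k _ => |c| * |autocov P T ε₀ k|)
    (fun k => Continuous.aestronglyMeasurable (by fun_prop))
    (fun k => Eventually.of_forall fun θ => by
      rw [norm_smul, hnorm, mul_one, Real.norm_eq_abs, abs_mul])
    (Eventually.of_forall fun _ => hγ.mul_left _) (integrable_const _)
    (Eventually.of_forall fun θ => by
      have h1 := (hsum θ).hasSum.mul_left (c : ℂ)
      rw [specDensity, hc']
      refine h1.congr_fun ?_
      intro k
      rw [Complex.real_smul]
      push_cast
      ring)
  rw [cintegral, ← hmain.tsum_eq, hc', Complex.ofReal_tsum, ← tsum_mul_left]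
  refine tsum_congr fun k => ?_
  rw [VectorMeasure.integral_fun_smul, Complex.real_smul]
  have h2 := hM.fourier_int k j l
  rw [cintegral] at h2
  rw [h2]
  push_cast
  ring

/-- Each `F⁻¹` brings a factor `2π`, while `G` and `f` bring one `1/(2π)` each, so they cancel. The
right side involves only `R`, hence every spectral measure gives the same `C`. -/
theorem IsSpectralMeasure.limitCov_eq {Ω : Type*} [MeasurableSpace Ω] {P : Measure Ω}
    {T : Ω ≃ᵐ Ω} {ε₀ : Ω → ℝ} (hγ : Summable fun k : ℤ => |autocov P T ε₀ k|)
    (hM : IsSpectralMeasure R M) (hR : IsUnit (R 0).det) (j l : Fin p) :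
    limitCov (specDensity P T ε₀) M j l = ((limitMatrix (autocov P T ε₀) R j l : ℝ) : ℂ) := by
  have hpi : (2 * Real.pi : ℂ) ≠ 0 := by exact_mod_cast Real.two_pi_pos.ne'
  have hinv : (matF M)⁻¹ = (2 * Real.pi : ℂ) • ((R 0)⁻¹).map Complex.ofRealHom := by
    refine Matrix.inv_eq_right_inv ?_
    rw [hM.matF_eq, Matrix.smul_mul, Matrix.mul_smul, smul_smul, ← Matrix.map_mul,
      Matrix.mul_nonsing_inv _ hR, one_div, inv_mul_cancel₀ hpi, one_smul,
      Matrix.map_one _ (map_zero _) (map_one _)]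
  have hG : matG (specDensity P T ε₀) M = ((1 / (2 * Real.pi)) * (1 / (2 * Real.pi)) : ℂ) •
      (Matrix.of fun j l => ∑' k : ℤ, autocov P T ε₀ k * extCorr R k j l).map
        Complex.ofRealHom := by
    ext j l
    rw [matG, Matrix.of_apply, hM.cintegral_specDensity hγ]
    simp [mul_assoc]
  rw [limitCov, hinv, hG, Matrix.smul_mul, Matrix.smul_mul, Matrix.mul_smul, Matrix.mul_smul,
    Matrix.smul_mul, smul_smul, smul_smul, ← Matrix.map_mul, ← Matrix.map_mul]
  rw [show ((2 * Real.pi) * (2 * Real.pi) * ((1 / (2 * Real.pi)) * (1 / (2 * Real.pi))) : ℂ) = 1 by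
    field_simp]
  rw [one_smul]
  rfl

end LimitCov

/-! ### Random designs -/

section Independence

variable {Ω X E : Type*} [MeasurableSpace Ω] [MeasurableSpace X] [MeasurableSpace E]
  {P : Measure Ω} [IsProbabilityMeasure P]

theorem measure_abs_ge_le_integral_div {g : Ω → ℝ} (hg : Integrable g P) {δ : ℝ} (hδ : 0 < δ) :
    P {ω | δ ≤ |g ω|} ≤ ENNReal.ofReal ((∫ ω, |g ω| ∂P) / δ) := by
  have h1 := mul_meas_ge_le_integral_of_nonneg (Eventually.of_forall fun ω => abs_nonneg (g ω))
    hg.abs δ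
  rw [← ENNReal.ofReal_toReal (measure_ne_top P {ω | δ ≤ |g ω|})]
  refine ENNReal.ofReal_le_ofReal ?_
  rw [le_div_iff₀ hδ, mul_comm]
  exact h1

theorem abs_integral_sub_le {g : Ω → ℝ} (hg : Integrable g P) (c : ℝ) :
    |∫ ω, g ω ∂P - c| ≤ ∫ ω, |g ω - c| ∂P := by
  have h1 : ∫ ω, g ω ∂P - c = ∫ ω, (g ω - c) ∂P := by
    rw [integral_sub hg (integrable_const c)]
    simp
  rw [h1]
  exact abs_integral_le_integral_abs

theorem integral_abs_sub_integral_le {g : Ω → ℝ} (hg : Integrable g P) (c : ℝ) :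
    ∫ ω, |g ω - ∫ ω', g ω' ∂P| ∂P ≤ 2 * ∫ ω, |g ω - c| ∂P := by
  have hgc : Integrable (fun ω => |g ω - c|) P := (hg.sub (integrable_const c)).abs
  have h1 : ∫ ω, |g ω - ∫ ω', g ω' ∂P| ∂P
      ≤ ∫ ω, (|g ω - c| + |∫ ω', g ω' ∂P - c|) ∂P := by
    refine integral_mono (hg.sub (integrable_const _)).abs (hgc.add (integrable_const _)) fun ω => ?_
    simp only
    rw [abs_sub_comm (∫ ω', g ω' ∂P) c]
    exact abs_sub_le _ _ _
  refine h1.trans ?_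
  have h2 : ∫ ω, (|g ω - c| + |∫ ω', g ω' ∂P - c|) ∂P
      = ∫ ω, |g ω - c| ∂P + |∫ ω', g ω' ∂P - c| := by
    rw [integral_add hgc (integrable_const _)]
    simp
  rw [h2, two_mul]
  exact add_le_add_right (abs_integral_sub_le hg c) _

/-- Convergence in `L¹` given one of two independent variables implies convergence in probability.
The limit is not assumed measurable. -/
theorem tendstoInMeasure_of_indepFun {x : Ω → X} {e : Ω → E} (hx : Measurable x) (he : Measurable e)
    (hind : ProbabilityTheory.IndepFun x e P) {Φ : ℕ → X × E → ℝ} (hΦ : ∀ n, Measurable (Φ n))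
    {c : Ω → ℝ} (h_int : ∀ᵐ ω ∂P, ∀ᶠ n in atTop, Integrable (fun ω' => Φ n (x ω, e ω')) P)
    (hlim : ∀ᵐ ω ∂P, Tendsto (fun n => ∫ ω', |Φ n (x ω, e ω') - c ω| ∂P) atTop (𝓝 0)) :
    TendstoInMeasure P (fun n ω => Φ n (x ω, e ω)) atTop c := by
  -- The mean over the errors with the design frozen is a measurable substitute for `c`, which makes
  -- Fubini applicable.
  set m : ℕ → X → ℝ := fun n a => ∫ ω', Φ n (a, e ω') ∂P with hm
  have hmm : ∀ n, Measurable (m n) := fun n => by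
    have h1 : StronglyMeasurable fun q : X × Ω => Φ n (q.1, e q.2) :=
      ((hΦ n).comp (measurable_fst.prodMk (he.comp measurable_snd))).stronglyMeasurable
    exact h1.integral_prod_right'.measurable
  have hmean : TendstoInMeasure P (fun n ω => m n (x ω)) atTop c := by
    refine tendstoInMeasure_of_tendsto_ae
      (fun n => ((hmm n).comp hx).aestronglyMeasurable) ?_
    filter_upwards [h_int, hlim] with ω h1 h2
    rw [tendsto_iff_norm_sub_tendsto_zero]
    refine squeeze_zero' (Eventually.of_forall fun _ => norm_nonneg _) ?_ h2
    filter_upwards [h1] with n hn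
    exact abs_integral_sub_le hn (c ω)
  have hdev : ∀ δ : ℝ, 0 < δ →
      Tendsto (fun n => P {ω | δ ≤ |Φ n (x ω, e ω) - m n (x ω)|}) atTop (𝓝 0) := by
    intro δ hδ
    have hS : ∀ n, MeasurableSet {q : X × E | δ ≤ |Φ n q - m n q.1|} := fun n =>
      measurableSet_le measurable_const ((hΦ n).sub ((hmm n).comp measurable_fst)).abs
    have h1 : ∀ n, P {ω | δ ≤ |Φ n (x ω, e ω) - m n (x ω)|}
        = ∫⁻ ω, P {ω' | δ ≤ |Φ n (x ω, e ω') - m n (x ω)|} ∂P := by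
      intro n
      have h2 := Measure.map_apply (μ := P) (hx.prodMk he) (hS n)
      have h3 : P.map (fun ω => (x ω, e ω)) = (P.map x).prod (P.map e) :=
        (ProbabilityTheory.indepFun_iff_map_prod_eq_prod_map_map hx.aemeasurable
          he.aemeasurable).1 hind
      have := Measure.isProbabilityMeasure_map (μ := P) he.aemeasurable
      rw [h3, Measure.prod_apply (hS n), lintegral_map (measurable_measure_prodMk_left (hS n)) hx] at h2
      refine h2.symm.trans (lintegral_congr fun ω => ?_)
      rw [Measure.map_apply he (measurable_prodMk_left (hS n))]
      rfl
    simp only [h1]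
    -- Markov's inequality makes the inner probabilities tend to zero for almost every frozen
    -- design; they are at most `1`, so dominated convergence applies.
    rw [← lintegral_zero (μ := P)]
    refine tendsto_lintegral_of_dominated_convergence (fun _ => 1) (fun n => ?_)
      (fun n => Eventually.of_forall fun ω => prob_le_one) (by simp) ?_
    · have hS' : MeasurableSet {q : X × Ω | δ ≤ |Φ n (q.1, e q.2) - m n q.1|} :=
        (measurable_fst.prodMk (he.comp measurable_snd)) (hS n)
      exact (measurable_measure_prodMk_left hS').comp hx
    · filter_upwards [h_int, hlim] with ω h2 h3
      have h4 : Tendsto (fun n => ENNReal.ofReal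
          ((2 * ∫ ω', |Φ n (x ω, e ω') - c ω| ∂P) / δ)) atTop (𝓝 0) := by
        have := ENNReal.tendsto_ofReal ((h3.const_mul 2).div_const δ)
        simpa using this
      refine tendsto_of_tendsto_of_tendsto_of_le_of_le' tendsto_const_nhds h4
        (Eventually.of_forall fun _ => zero_le) ?_
      filter_upwards [h2] with n hn
      refine (measure_abs_ge_le_integral_div (hn.sub (integrable_const (m n (x ω)))) hδ).trans
        (ENNReal.ofReal_le_ofReal (div_le_div_of_nonneg_right ?_ hδ.le))
      exact integral_abs_sub_integral_le hn (c ω)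
  rw [tendstoInMeasure_iff_norm] at hmean ⊢
  intro δ hδ
  have h1 := (hdev (δ / 2) (half_pos hδ)).add (hmean (δ / 2) (half_pos hδ))
  rw [add_zero] at h1
  refine tendsto_of_tendsto_of_tendsto_of_le_of_le tendsto_const_nhds h1 (fun _ => zero_le)
    fun n => ?_
  refine (measure_mono ?_).trans (measure_union_le _ _)
  intro ω hω
  simp only [Set.mem_ofPred_eq, Set.mem_union, Real.norm_eq_abs] at hω ⊢
  by_contra hcon
  push Not at hcon
  have := abs_sub_le (Φ n (x ω, e ω)) (m n (x ω)) (c ω)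
  linarith [hcon.1, hcon.2]

end Independence

/-! ### Joint measurability of the estimator -/

section EstimatorMeasurability

variable {A : Type*} [MeasurableSpace A] {p : ℕ}

theorem measurable_matrix_mul {k l m : Type*} [Fintype l] {M : A → Matrix k l ℝ}
    {N : A → Matrix l m ℝ} (hM : ∀ i j, Measurable fun a => M a i j)
    (hN : ∀ i j, Measurable fun a => N a i j) (i : k) (j : m) :
    Measurable fun a => (M a * N a) i j := by
  simp only [Matrix.mul_apply]
  exact Finset.measurable_fun_sum _ fun b _ => (hM i b).mul (hN b j)

theorem measurable_matrix_inv {M : A → Matrix (Fin p) (Fin p) ℝ}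
    (hM : ∀ i j, Measurable fun a => M a i j) (i j : Fin p) :
    Measurable fun a => (M a)⁻¹ i j := by
  have hM' : Measurable fun a => (fun i j => M a i j : Fin p → Fin p → ℝ) :=
    measurable_pi_lambda _ fun i => measurable_pi_lambda _ fun j => hM i j
  have hof : Continuous fun B : Fin p → Fin p → ℝ => (Matrix.of B : Matrix (Fin p) (Fin p) ℝ) :=
    continuous_id
  have hdet : Continuous fun B : Fin p → Fin p → ℝ => (Matrix.of B).det := hof.matrix_det
  have hadj : Continuous fun B : Fin p → Fin p → ℝ => (Matrix.of B).adjugate i j :=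
    hof.matrix_adjugate.matrix_elem i j
  simp only [Matrix.inv_def, Ring.inverse_eq_inv', Matrix.smul_apply, smul_eq_mul]
  exact (hdet.measurable.comp hM').inv.mul (hadj.measurable.comp hM')

variable {x : A → ℕ → Fin p → ℝ} {y : A → ℕ → ℝ}

theorem measurable_gramMatrix_inv (hx : ∀ i j, Measurable fun a => x a i j) (n : ℕ) (j l : Fin p) :
    Measurable fun a => ((designMatrix (x a) n)ᵀ * designMatrix (x a) n)⁻¹ j l := by
  have hX : ∀ (i : Fin n) j, Measurable fun a => designMatrix (x a) n i j := fun i j => hx i j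
  have hXt : ∀ j (i : Fin n), Measurable fun a => (designMatrix (x a) n)ᵀ j i := fun j i => hx i j
  exact measurable_matrix_inv (measurable_matrix_mul hXt hX) j l

theorem measurable_leastSquares (hx : ∀ i j, Measurable fun a => x a i j)
    (hy : ∀ i, Measurable fun a => y a i) (n : ℕ) (j : Fin p) :
    Measurable fun a => leastSquares (x a) (y a) n j := by
  simp only [leastSquares, Matrix.mulVec, dotProduct]
  exact Finset.measurable_fun_sum _ fun b _ => (measurable_gramMatrix_inv hx n j b).mul
    (Finset.measurable_fun_sum _ fun i _ => (hx i b).mul (hy i))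

theorem measurable_residual (hx : ∀ i j, Measurable fun a => x a i j)
    (hy : ∀ i, Measurable fun a => y a i) (n i : ℕ) :
    Measurable fun a => residual (x a) (y a) n i :=
  (hy i).sub (Finset.measurable_fun_sum _ fun j _ => (hx i j).mul (measurable_leastSquares hx hy n j))

theorem measurable_taperedCov (K : ℝ → ℝ) (h : ℝ) (hx : ∀ i j, Measurable fun a => x a i j)
    (hy : ∀ i, Measurable fun a => y a i) (n : ℕ) (i j : Fin n) :
    Measurable fun a => taperedCov K h (x a) (y a) n i j :=
  Measurable.const_mul (Measurable.const_mul (Finset.measurable_fun_sum _ fun m _ =>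
    (measurable_residual hx hy n m).mul (measurable_residual hx hy n _)) _) _

theorem measurable_covEstimator (K : ℝ → ℝ) (h : ℝ) (hx : ∀ i j, Measurable fun a => x a i j)
    (hy : ∀ i, Measurable fun a => y a i) (n : ℕ) (j l : Fin p) :
    Measurable fun a => covEstimator K h (x a) (y a) n j l := by
  have hD : ∀ i j, Measurable fun a => normMatrix (x a) n i j := fun i j => by
    by_cases hij : i = j
    · subst hij
      simp only [normMatrix, Matrix.diagonal_apply_eq, colNorm]
      exact (Finset.measurable_fun_sum _ fun m _ => (hx m i).pow_const 2).sqrt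
    · simp only [normMatrix, Matrix.diagonal_apply_ne _ hij]
      exact measurable_const
  have hG := measurable_gramMatrix_inv hx n
  have hX : ∀ (i : Fin n) j, Measurable fun a => designMatrix (x a) n i j := fun i j => hx i j
  have hXt : ∀ j (i : Fin n), Measurable fun a => (designMatrix (x a) n)ᵀ j i := fun j i => hx i j
  exact measurable_matrix_mul (measurable_matrix_mul (measurable_matrix_mul (measurable_matrix_mul
    (measurable_matrix_mul (measurable_matrix_mul hD hG) hXt) (measurable_taperedCov K h hx hy n))
    hX) hG) hD j l

end EstimatorMeasurability

/-! ### Convergence for a random design -/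

section RandomDesign

variable {Ω : Type*} {F₀ : MeasurableSpace Ω} [mΩ : MeasurableSpace Ω] {P : Measure Ω}
  {T : Ω ≃ᵐ Ω} {ε₀ : Ω → ℝ} {p : ℕ}

theorem HannanDesign.eventually_integrable_covEstimator [IsProbabilityMeasure P]
    (hT : MeasurePreserving T P P) (hε : MemLp ε₀ 2 P) {x : ℕ → Fin p → ℝ}
    {R : ℕ → Matrix (Fin p) (Fin p) ℝ} (hX : HannanDesign x R) (β : Fin p → ℝ) (K : ℝ → ℝ)
    (h : ℕ → ℝ) (j l : Fin p) :
    ∀ᶠ n in atTop, Integrable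
      (fun ω => covEstimator K (h n) x (observation β x fun i => err T ε₀ i ω) n j l) P := by
  filter_upwards [hX.eventually_colNorm_ne] with n hcol
  simp only [covEstimator_apply_eq hcol]
  exact integrable_finsetSum _ fun b _ => Integrable.mul_const (integrable_finsetSum _ fun a _ =>
    ((integrable_toeplitzForm_residual hT hε x β n _).const_mul _).const_mul _) _

theorem iSup_filt_le (hF₀ : F₀ ≤ mΩ) : ⨆ i : ℤ, filt F₀ T i ≤ mΩ :=
  iSup_le fun i => (MeasurableSpace.comap_mono hF₀).trans (measurable_iter i).comap_le

theorem tendstoInMeasure_covEstimator [IsProbabilityMeasure P] (hT : MeasurePreserving T P P)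
    (hF₀ : F₀ ≤ mΩ) (hF : F₀ ≤ F₀.comap T)
    (hbot : ∀ A : Set Ω, MeasurableSet[⨅ i : ℤ, filt F₀ T i] A → P A = 0 ∨ P A = 1)
    (hε_meas : Measurable[⨆ i : ℤ, filt F₀ T i] ε₀) (hε : MemLp ε₀ 2 P)
    (hε0 : ∫ ω, ε₀ ω ∂P = 0) (hC1 : HannanCondition F₀ P T ε₀)
    {x : Ω → ℕ → Fin p → ℝ} (hx : Measurable x)
    (hind : ProbabilityTheory.IndepFun x (fun ω (i : ℤ) => err T ε₀ i ω) P)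
    {R : Ω → ℕ → Matrix (Fin p) (Fin p) ℝ} (hX : ∀ᵐ ω ∂P, HannanDesign (x ω) (R ω))
    (β : Fin p → ℝ) {K : ℝ → ℝ} (hK : IsKernel K) {h : ℕ → ℝ} (hpos : ∀ n, 0 < h n)
    (hh : Tendsto h atTop atTop)
    (hcond : Tendsto (fun n : ℕ => h n * ∫ ω, |ε₀ ω| ^ 2 * min 1 (h n / n * |ε₀ ω| ^ 2) ∂P)
      atTop (𝓝 0)) (j l : Fin p) :
    TendstoInMeasure P (fun (n : ℕ) ω => covEstimator K (h n) (x ω)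
      (observation β (x ω) fun i => err T ε₀ i ω) n j l) atTop
      (fun ω => limitMatrix (autocov P T ε₀) (R ω) j l) := by
  have hεm : Measurable ε₀ := hε_meas.mono (iSup_filt_le hF₀) le_rfl
  have he : Measurable fun ω (i : ℤ) => err T ε₀ i ω :=
    measurable_pi_lambda _ fun i => hεm.comp (measurable_iter i)
  have hentry : ∀ i j, Measurable fun q : (ℕ → Fin p → ℝ) × (ℤ → ℝ) => q.1 i j := fun i j =>
    (measurable_pi_apply j).comp ((measurable_pi_apply i).comp measurable_fst)
  refine tendstoInMeasure_of_indepFun (Φ := fun n q => covEstimator K (h n) q.1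
    (observation β q.1 q.2) n j l) hx he hind (fun n => ?_) ?_ ?_
  · refine measurable_covEstimator K (h n) hentry (fun i => ?_) n j l
    exact (Finset.measurable_fun_sum _ fun j _ => (hentry i j).mul_const _).add
      ((measurable_pi_apply _).comp measurable_snd)
  · filter_upwards [hX] with ω hω
    exact hω.eventually_integrable_covEstimator hT hε β K h j l
  · filter_upwards [hX] with ω hω
    exact tendsto_integral_covEstimator hT hF₀ hF hbot hε_meas hε hε0 hC1 hω β hK hpos hh hcond j l

end RandomDesign

end HannanRegression

/-! ### The main theorem -/

theorem corollary3p3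
    {Ω : Type*} (F₀ : MeasurableSpace Ω) [mΩ : MeasurableSpace Ω] (P : Measure Ω) [IsProbabilityMeasure P]
    -- the error process `εᵢ = ε₀ ∘ 𝕋ⁱ` and the filtration `𝓕ᵢ = 𝕋⁻ⁱ(𝓕₀)`
    (T : Ω ≃ᵐ Ω) (hT : MeasurePreserving T P P)
    (hF₀ : F₀ ≤ mΩ) (hF₀_mono : F₀ ≤ F₀.comap T)
    (hF_bot : ∀ A : Set Ω, MeasurableSet[⨅ i : ℤ, HannanRegression.filt F₀ T i] A →
      P A = 0 ∨ P A = 1)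
    (ε₀ : Ω → ℝ) (hε_meas : Measurable[⨆ i : ℤ, HannanRegression.filt F₀ T i] ε₀)
    (hε_L2 : MemLp ε₀ 2 P) (hε_mean : ∫ ω, ε₀ ω ∂P = 0)
    (hC1 : HannanRegression.HannanCondition F₀ P T ε₀)
    -- the random design, independent of the error process, with its limiting correlations
    (p : ℕ) (x : Ω → ℕ → Fin p → ℝ) (hx_meas : Measurable x)
    (h_indep : ProbabilityTheory.IndepFun x (fun ω (i : ℤ) => HannanRegression.err T ε₀ i ω) P)
    (R : Ω → ℕ → Matrix (Fin p) (Fin p) ℝ)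
    (hX : ∀ᵐ ω ∂P, HannanRegression.HannanDesign (x ω) (R ω))
    -- the regression parameter, the kernel and the bandwidths
    (β : Fin p → ℝ) (K : ℝ → ℝ) (hK : HannanRegression.IsKernel K)
    (h : ℕ → ℝ) (h_pos : ∀ n, 0 < h n) (h_tendsto : Tendsto h atTop atTop)
    (h_cond : Tendsto (fun n : ℕ => h n * ∫ ω, |ε₀ ω| ^ 2 * min 1 (h n / n * |ε₀ ω| ^ 2) ∂P)
      atTop (𝓝 0)) :
    -- the autocovariances are summable and the spectral measure of the design exists,
    -- so that `f`, `F`, `G` and `C = F⁻¹ G F⁻¹` are well defined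
    (Summable fun k : ℤ => |HannanRegression.autocov P T ε₀ k|) ∧
    (∀ᵐ ω ∂P, ∃ M : HannanRegression.MatrixMeasure p,
      HannanRegression.IsSpectralMeasure (R ω) M) ∧
    -- `C_n` converges in probability to `C`
    ∀ FX : Ω → HannanRegression.MatrixMeasure p,
      (∀ᵐ ω ∂P, HannanRegression.IsSpectralMeasure (R ω) (FX ω)) →
      ∀ j l : Fin p, TendstoInMeasure P
        (fun (n : ℕ) (ω : Ω) => ((HannanRegression.covEstimator K (h n) (x ω)
          (HannanRegression.observation β (x ω) fun i => HannanRegression.err T ε₀ i ω)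
          n j l : ℝ) : ℂ))
        atTop
        (fun ω => HannanRegression.limitCov (HannanRegression.specDensity P T ε₀) (FX ω) j l) := by

  have hγ := HannanRegression.summable_abs_autocov hT hF₀ hF₀_mono hF_bot hε_meas hε_L2 hε_mean hC1
  refine ⟨hγ, ?_, fun FX hFX j l => ?_⟩
  · filter_upwards [hX] with ω hω
    exact hω.exists_isSpectralMeasure
  · have hlim := HannanRegression.tendstoInMeasure_covEstimator hT hF₀ hF₀_mono hF_bot hε_meas
      hε_L2 hε_mean hC1 hx_meas h_indep hX β hK h_pos h_tendsto h_cond j l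
    rw [tendstoInMeasure_iff_norm] at hlim
    have hlimC : TendstoInMeasure P
        (fun (n : ℕ) (ω : Ω) => ((HannanRegression.covEstimator K (h n) (x ω)
          (HannanRegression.observation β (x ω) fun i => HannanRegression.err T ε₀ i ω)
          n j l : ℝ) : ℂ)) atTop
        (fun ω => ((HannanRegression.limitMatrix (HannanRegression.autocov P T ε₀) (R ω) j l : ℝ)
          : ℂ)) := by
      rw [tendstoInMeasure_iff_norm]
      simpa only [← Complex.ofReal_sub, Complex.norm_real] using hlim
    -- The limit found above is expressed through `R`; almost surely it equals `C` for the given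
    -- `FX`.
    refine hlimC.congr_right ?_
    filter_upwards [hX, hFX] with ω h1 h2
    exact (h2.limitCov_eq hγ h1.isUnit_det j l).symm
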